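/- Let $n\ge 1$ be an integer, $p\in(1,\infty)$, $m\in[p,\infty)$, $\Omega\subset\mathbb{R}^n$ open, and write $B_r$ for the open ball of radius $r$ centred at the origin, $B_r(x)$ for the one centred at $x$, and $\mathcal L^n$ for Lebesgue measure. Let $W:[-1,1]\to[0,\infty)$ be lower semicontinuous and suppose that for some $\lambda\in(0,1]$, $\Lambda\in[1,\infty)$, $\theta\in(-1,1)$, $q\in(0,1)$, $c_1\in(0,\infty)$ $$\lambda\,\chi_{(-\infty,\theta]}(x)\,|1+x|^m\le W(x)\le\Lambda|1+x|^m\qquad\text{for all }x\in[-1,1],$$ $$W(t)-W(r)\ge c_1(t-r)|1+r|^{m-1}+c_1(t-r)^{\lceil m\rceil}\qquad\text{for all }-1\le r\le t\le -1+q.$$ For $s\in(0,1)$ and measurable $u:\mathbb{R}^n\to\mathbb{R}$ put $$\mathcal K_s^p(u,\Omega)=\frac12\int_\Omega\int_\Omega\frac{|u(x)-u(y)|^p}{|x-y|^{n+sp}}\,dx\,dy+\int_\Omega\int_{\mathbb{R}^n\setminus\Omega}\frac{|u(x)-u(y)|^p}{|x-y|^{n+sp}}\,dx\,dy,$$ $$\mathcal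 E_s^p(u,\Omega)=(1-s)\mathcal K_s^p(u,\Omega)+\int_\Omega W(u)\,dx,$$ and let $X^{s,p}(\Omega)$ be the set of measurable $u:\mathbb{R}^n\to\mathbb{R}$ with $\mathcal K_s^p(u,\Omega)<\infty$ and $\|u\|_{L^\infty(\mathbb{R}^n)}\le1$. For $\epsilon\ge0$ and $\Omega$ bounded, $u\in X^{s,p}(\Omega)$ is an $\epsilon$-minimizer for $\mathcal E_s^p$ in $\Omega$ if $\mathcal E_s^p(u,\Omega)\le\epsilon+\mathcal E_s^p(v,\Omega)$ for every $v\in X^{s,p}(\Omega)$ with $v=u$ a.e. in $\mathbb{R}^n\setminus\Omega$; for $\Omega$ unbounded, $u\in X^{s,p}(\Omega)$ is an $\epsilon$-minimizer in $\Omega$ if it is one in every open $\Omega'\subset\subset\Omega$. For $\alpha\in(0,1)$ and $u\in C^\alpha_{\rm loc}(\Omega)$ put $$[u]_{B,\alpha}=\sup\bigl\{[u]_{C^\alpha(B_1(x_0))}:\ x_0\in B_R,\ R>0,\ B_{R+2}\subset\Omega\bigr\}$$ ($0$ if there is no such $R$), and let $C^\alpha_B(\Omega)$ be the set of $u\in C^\alpha_{\rm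 loc}(\Omega)$ with $[u]_{B,\alpha}<\infty$. **Theorem (stable density estimates for $\epsilon$-minimizers).** Let $s_0\in(\tfrac1p,1)$, $s\in[s_0,1)$, $\theta_1,\theta_2\in(-1,\theta]$, $\theta_*=\min\{\theta_1,\theta_2,-1+q\}$, $\theta^*=\max\{\theta_1,\theta_2,-1+q\}$, $\alpha\in(0,1)$, $M\in[0,\infty)$. Let $u\in C^\alpha_B(\Omega)\cap X^{s,p}(\Omega)$ with $[u]_{B,\alpha}\le M$, and let $c_0,r_0\in(0,\infty)$ satisfy $B_{r_0}\subset\Omega$ and $$\mathcal L^n\bigl(B_{r_0}\cap\{u>\theta_1\}\bigr)>c_0.$$ Then there are constants - $c>0$ depending only on $m,\theta_*$, - $\delta>0$ depending only on $s_0,n,p,m,c_1,\theta_*,c_0,\alpha,M$, - $R^*\in[r_0,\infty)$ depending only on $s_0,n,p,m,c_1,\theta_*,r_0$, - $\tilde c\in(0,1)$ depending only on $s_0,n,p,m,\Lambda,c_1,\theta_*,r_0,c_0,\alpha,M$ (in particular, none of them depends on $s$) such that, if $\epsilon\in[0,\delta)$ and $u$ is an $\epsilon$-minimizer for $\mathcal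 E_s^p$ in $\Omega$, then for every $r\in[R^*,\infty)$ with $B_{4r}\subset\Omega$ $$c\int_{B_r\cap\{\theta_*<u\le\theta^*\}}|1+u(x)|^m\,dx+\mathcal L^n\bigl(B_r\cap\{u>\theta_2\}\bigr)>\tilde c\,r^n.$$ -/

import Mathlib

open MeasureTheory Set

namespace DensityEstimates

noncomputable section

/-- Euclidean space `ℝⁿ`. -/
abbrev E (n : ℕ) := EuclideanSpace ℝ (Fin n)

/-- Hypotheses on the degenerate double-well potential `W : [-1,1] → [0,∞)`. Only the values of
`W` on `[-1,1]` are constrained (and used). The exponent `⌈m⌉₊` is `m` if `m` is an integer and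
`⌊m⌋ + 1` otherwise. -/
structure IsPotential (W : ℝ → ℝ) (m lam Lam θ q c₁ : ℝ) : Prop where
  lam_pos : 0 < lam
  lam_le_one : lam ≤ 1
  one_le_Lam : 1 ≤ Lam
  neg_one_lt_θ : -1 < θ
  θ_lt_one : θ < 1
  q_pos : 0 < q
  q_lt_one : q < 1
  c₁_pos : 0 < c₁
  lsc : LowerSemicontinuousOn W (Icc (-1) 1)
  lower : ∀ x ∈ Icc (-1 : ℝ) 1, (Iic θ).indicator (fun x => lam * |1 + x| ^ m) x ≤ W x
  upper : ∀ x ∈ Icc (-1 : ℝ) 1, W x ≤ Lam * |1 + x| ^ m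
  growth : ∀ r t : ℝ, -1 ≤ r → r ≤ t → t ≤ -1 + q →
    c₁ * (t - r) * |1 + r| ^ (m - 1) + c₁ * (t - r) ^ ⌈m⌉₊ ≤ W t - W r

/-- The Gagliardo interaction `∫_A ∫_B |u(x)-u(y)|^p / |x-y|^{n+sp} dy dx` in `[0,∞]`. -/
def interaction {n : ℕ} (s p : ℝ) (u : E n → ℝ) (A B : Set (E n)) : ENNReal :=
  ∫⁻ x in A, ∫⁻ y in B, ENNReal.ofReal (|u x - u y| ^ p / ‖x - y‖ ^ ((n : ℝ) + s * p))

/-- The kinetic energy `𝒦_s^p(u,Ω)`. -/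
def kinetic {n : ℕ} (s p : ℝ) (u : E n → ℝ) (Ω : Set (E n)) : ENNReal :=
  (1 / 2) * interaction s p u Ω Ω + interaction s p u Ω Ωᶜ

/-- The energy `ℰ_s^p(u,Ω) = (1-s) 𝒦_s^p(u,Ω) + ∫_Ω W(u)`. -/
def energy {n : ℕ} (W : ℝ → ℝ) (s p : ℝ) (u : E n → ℝ) (Ω : Set (E n)) : ENNReal :=
  ENNReal.ofReal (1 - s) * kinetic s p u Ω + ∫⁻ x in Ω, ENNReal.ofReal (W (u x))

/-- `u ∈ X^{s,p}(Ω)`: Lebesgue measurable on `ℝⁿ`, finite kinetic energy, `‖u‖_{L^∞(ℝⁿ)} ≤ 1`. -/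
structure MemX {n : ℕ} (s p : ℝ) (Ω : Set (E n)) (u : E n → ℝ) : Prop where
  aemeasurable : AEMeasurable u volume
  kinetic_lt_top : kinetic s p u Ω < ⊤
  bound : ∀ᵐ x ∂(volume : Measure (E n)), |u x| ≤ 1

/-- `v ∈ X_f^{s,p}(Ω)`: `v ∈ X^{s,p}(Ω)` and `v = f` a.e. in `ℝⁿ ∖ Ω`. -/
def MemXTrace {n : ℕ} (s p : ℝ) (Ω : Set (E n)) (f v : E n → ℝ) : Prop :=
  MemX s p Ω v ∧ ∀ᵐ x ∂(volume : Measure (E n)), x ∉ Ω → v x = f x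

/-- `u ∈ X^{s,p}(Ω)` minimizes `ℰ_s^p(·,Ω)` up to `ε` among all competitors with the same
exterior datum. -/
def MinimizesUpTo {n : ℕ} (W : ℝ → ℝ) (s p ε : ℝ) (Ω : Set (E n)) (u : E n → ℝ) : Prop :=
  MemX s p Ω u ∧
    ∀ v, MemXTrace s p Ω u v → energy W s p u Ω ≤ ENNReal.ofReal ε + energy W s p v Ω

/-- `ε`-minimizer in `Ω`: in `Ω` itself if `Ω` is bounded, and in every open `Ω' ⊂⊂ Ω`
if `Ω` is unbounded. -/
def IsEpsMinimizer {n : ℕ} (W : ℝ → ℝ) (s p ε : ℝ) (Ω : Set (E n)) (u : E n → ℝ) : Prop :=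
  MemX s p Ω u ∧
    (Bornology.IsBounded Ω → MinimizesUpTo W s p ε Ω u) ∧
    (¬ Bornology.IsBounded Ω → ∀ Ω' : Set (E n), IsOpen Ω' → IsCompact (closure Ω') →
      closure Ω' ⊆ Ω → MinimizesUpTo W s p ε Ω' u)

/-- The Hölder seminorm `[u]_{C^α(S)}` in `[0,∞]`; pairs `x = y` contribute `0 / 0 = 0`. -/
def holderSeminorm {n : ℕ} (α : ℝ) (u : E n → ℝ) (S : Set (E n)) : ENNReal :=
  ⨆ x ∈ S, ⨆ y ∈ S, edist (u x) (u y) / edist x y ^ α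

/-- `[u]_{B,α}`: the supremum of `[u]_{C^α(B_1(x₀))}` over all `x₀ ∈ B_R` and all `R > 0`
with `B_{R+2} ⊂ Ω`. -/
def ballHolderSeminorm {n : ℕ} (α : ℝ) (u : E n → ℝ) (Ω : Set (E n)) : ENNReal :=
  ⨆ (R : ℝ) (_ : 0 < R ∧ Metric.ball (0 : E n) (R + 2) ⊆ Ω) (x₀ ∈ Metric.ball (0 : E n) R),
    holderSeminorm α u (Metric.ball x₀ 1)

/-- `u ∈ C^α_loc(Ω)`. -/
def MemHolderLoc {n : ℕ} (α : ℝ) (Ω : Set (E n)) (u : E n → ℝ) : Prop :=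
  ∀ K : Set (E n), IsCompact K → K ⊆ Ω → holderSeminorm α u K < ⊤

/-- `u ∈ C_B^α(Ω)`. -/
def MemCB {n : ℕ} (α : ℝ) (Ω : Set (E n)) (u : E n → ℝ) : Prop :=
  MemHolderLoc α Ω u ∧ ballHolderSeminorm α u Ω < ⊤

end

end DensityEstimates

/-!
Fix a level `ϑ` near `-1` and let `V r` be the volume of `{u > ϑ}` in the ball `B_r`. An energy
estimate and an isoperimetric inequality combine into a superlinear recursion for `V`.

Energy estimate: compare `u` with `min u (z - 1)`, where the radial barrier `z` equals `2` outside
`B_{jT}` and its nonlocal operator is at most a small multiple of `z ^ (m - 1)`, uniformly in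
`s ∈ [s₀, 1)`. The growth of `W` at `-1` then pays for the kinetic energy of the truncation and
leaves over the volume of the layer where `u` lies between a fixed level in `(-1, ϑ)` and `ϑ`; the
price is `ε` plus the integral of `z ^ (m - 1)` over `{u > ϑ}`. The barrier decays like the power
`-s₀ p / (m - 1)` of the distance to the sphere `∂B_{jT}`. Since `s₀ p > 1`, summing `z ^ (m - 1)`
over `N < j ≤ 2N` gives a bounded function, so `N` times the volume of the layer in `B_{NT}` is at
most `N ε + C V(2NT)`.

Isoperimetric inequality: by Hölder continuity the layer meets every line that crosses it in a
definite length, so a Loomis-Whitney argument bounds `V(NT) ^ ((n - 1) / n)` by the volume of the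
layer plus `V(νNT) / N`. Hence `N * V(NT) ^ ((n - 1) / n) ≤ C * V(2νNT)`, and iteration gives
`V r ≥ c * r ^ n`.
-/

namespace DensityEstimates
noncomputable section

/-! ### Convexity inequalities for powers -/

lemma tangent_le_of_convexOn {S : Set ℝ} {f : ℝ → ℝ} {f' x y : ℝ} (hf : ConvexOn ℝ S f)
    (hx : x ∈ S) (hy : y ∈ S) (hd : HasDerivAt f f' x) : f x + f' * (y - x) ≤ f y := by
  rcases lt_trichotomy x y with h | rfl | h
  · have hslope := hf.le_slope_of_hasDerivAt hx hy h hd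
    rw [slope_def_field, le_div_iff₀ (sub_pos.2 h)] at hslope
    linarith
  · simp
  · have hslope := hf.slope_le_of_hasDerivAt hy hx h hd
    rw [slope_def_field, div_le_iff₀ (sub_pos.2 h)] at hslope
    linarith

lemma rpow_sub_rpow_le {b x y : ℝ} (hb : 1 ≤ b) (hx : 0 ≤ x) (hy : 0 ≤ y) :
    x ^ b - y ^ b ≤ b * x ^ (b - 1) * (x - y) := by
  have := tangent_le_of_convexOn (convexOn_rpow hb) (mem_Ici.2 hx) (mem_Ici.2 hy)
    (Real.hasDerivAt_rpow_const (Or.inr hb))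
  linarith

lemma one_add_rpow_le_quadratic {β r : ℝ} (hβ : 2 ≤ β) (hr : -1 ≤ r) (hr1 : r ≤ 1) :
    (1 + r) ^ β ≤ 1 + β * r + β * (β - 1) * 2 ^ (β - 2) * r ^ 2 := by
  have hs : 0 ≤ 1 + r := by linarith
  have htangent : (1 + r) ^ β ≤ 1 + β * (1 + r) ^ (β - 1) * r := by
    have := rpow_sub_rpow_le (b := β) (by linarith) hs zero_le_one
    rw [Real.one_rpow] at this
    linarith
  suffices hlip : r * ((1 + r) ^ (β - 1) - 1) ≤ (β - 1) * 2 ^ (β - 2) * r ^ 2 by nlinarith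
  rcases le_total 0 r with h | h
  · have hslope : (1 + r) ^ (β - 1) - 1 ≤ (β - 1) * (1 + r) ^ (β - 2) * r := by
      have := rpow_sub_rpow_le (b := β - 1) (by linarith) hs zero_le_one
      rwa [Real.one_rpow, add_sub_cancel_left, show β - 1 - 1 = β - 2 by ring] at this
    have hmono : (1 + r) ^ (β - 2) ≤ 2 ^ (β - 2) :=
      Real.rpow_le_rpow hs (by linarith) (by linarith)
    calc r * ((1 + r) ^ (β - 1) - 1) ≤ r * ((β - 1) * 2 ^ (β - 2) * r) := by
          gcongr
          exact hslope.trans (by gcongr; linarith)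
      _ = (β - 1) * 2 ^ (β - 2) * r ^ 2 := by ring
  · have hbernoulli := one_add_mul_self_le_rpow_one_add hr (p := β - 1) (by linarith)
    have hone : (1 : ℝ) ≤ 2 ^ (β - 2) := Real.one_le_rpow one_le_two (by linarith)
    have hsq : 0 ≤ (β - 1) * r ^ 2 := mul_nonneg (by linarith) (sq_nonneg r)
    nlinarith [mul_le_mul_of_nonpos_left hbernoulli h]

/-! ### The odd power -/

/-- The odd power `|t|^{p-2} t`: the derivative of `|t|^p / p`, and the nonlinearity in the
Euler-Lagrange operator of the fractional `p`-energy. -/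
def flux (p t : ℝ) : ℝ := |t| ^ (p - 2) * t

@[simp]
lemma flux_neg (p t : ℝ) : flux p (-t) = -flux p t := by simp [flux]

lemma flux_of_nonneg {p t : ℝ} (hp : p ≠ 1) (ht : 0 ≤ t) : flux p t = t ^ (p - 1) := by
  rcases ht.eq_or_lt with rfl | ht
  · simp [flux, Real.zero_rpow (sub_ne_zero.2 hp)]
  · rw [flux, abs_of_pos ht, show p - 1 = p - 2 + 1 by ring, Real.rpow_add_one ht.ne']

lemma abs_flux {p : ℝ} (hp : p ≠ 1) (t : ℝ) : |flux p t| = |t| ^ (p - 1) := by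
  rw [← flux_of_nonneg hp (abs_nonneg t), flux, flux, abs_mul, abs_abs,
    abs_of_nonneg (Real.rpow_nonneg (abs_nonneg t) _)]

@[fun_prop]
lemma measurable_flux (p : ℝ) : Measurable (flux p) := by
  unfold flux
  fun_prop

lemma hasDerivAt_abs_rpow_flux {p : ℝ} (hp : 1 < p) (x : ℝ) :
    HasDerivAt (fun x : ℝ => |x| ^ p) (p * flux p x) x := by
  simpa only [flux, mul_assoc] using hasDerivAt_abs_rpow x hp

lemma convexOn_norm_rpow {F : Type*} [NormedAddCommGroup F] [NormedSpace ℝ F] {p : ℝ}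
    (hp : 1 ≤ p) : ConvexOn ℝ univ (fun x : F => ‖x‖ ^ p) := by
  have hsub : norm '' (univ : Set F) ⊆ Ici (0 : ℝ) := by
    rintro _ ⟨x, -, rfl⟩
    exact norm_nonneg x
  have himage : Convex ℝ (norm '' (univ : Set F)) :=
    (isPreconnected_univ.image _ continuous_norm.continuousOn).ordConnected.convex
  exact ((convexOn_rpow hp).subset hsub himage).comp convexOn_univ_norm
    ((Real.monotoneOn_rpow_Ici_of_exponent_nonneg (by linarith)).mono hsub)

lemma flux_monotone {p : ℝ} (hp : 1 < p) : Monotone (flux p) := by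
  intro x y hxy
  have hd := hasDerivAt_abs_rpow_flux hp
  have h := (convexOn_norm_rpow (F := ℝ) hp.le).monotoneOn_deriv
    (fun x _ => (hd x).differentiableAt) (mem_univ x) (mem_univ y) hxy
  refine le_of_mul_le_mul_left ?_ (zero_lt_one.trans hp)
  rwa [← (hd x).deriv, ← (hd y).deriv]

lemma abs_rpow_tangent_le {p : ℝ} (hp : 1 < p) (x y : ℝ) :
    |x| ^ p + p * flux p x * (y - x) ≤ |y| ^ p :=
  tangent_le_of_convexOn (convexOn_norm_rpow hp.le) (mem_univ x) (mem_univ y)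
    (hasDerivAt_abs_rpow_flux hp x)

/-- Truncating `u` by a barrier `w` changes the energy density by at most its linearization at the
barrier: where `u` exceeds `w` the truncation equals `w`, and the flux is monotone. -/
lemma abs_sub_min_rpow_le {p : ℝ} (hp : 1 < p) (u₁ u₂ w₁ w₂ : ℝ) :
    |min u₁ w₁ - min u₂ w₂| ^ p ≤ |u₁ - u₂| ^ p +
      p * flux p (w₂ - w₁) * ((u₁ - min u₁ w₁) - (u₂ - min u₂ w₂)) := by
  have hflux (a b c d : ℝ) :
      flux p (b - d) * (a - min a b) ≤ flux p (min a b - min c d) * (a - min a b) := by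
    rcases le_total a b with h | h
    · simp [min_eq_left h]
    · rw [min_eq_right h]
      exact mul_le_mul_of_nonneg_right
        (flux_monotone hp (sub_le_sub_left (min_le_right c d) b)) (sub_nonneg.2 h)
  have h₁ := hflux u₁ w₁ u₂ w₂
  have h₂ := hflux u₂ w₂ u₁ w₁
  rw [← neg_sub (min u₁ w₁), flux_neg] at h₂
  rw [← neg_sub w₂, flux_neg] at h₁
  have htangent := abs_rpow_tangent_le hp (min u₁ w₁ - min u₂ w₂) (u₁ - u₂)
  nlinarith

/-! ### Second differences of the odd power -/

lemma flux_add_flux_le_of_le_two {p t a : ℝ} (hp : 1 < p) (hp2 : p ≤ 2) (ht : t ≠ 0)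
    (ha : 0 ≤ a) : flux p (t + a) + flux p (-t + a) ≤ 4 * |t| ^ (p - 2) * a := by
  wlog htpos : 0 < t generalizing t
  · have := this (neg_ne_zero.2 ht) (by grind)
    rw [neg_neg, abs_neg] at this
    linarith
  have hanti (x y : ℝ) (hx : 0 < x) (hxy : x ≤ y) : y ^ (p - 2) ≤ x ^ (p - 2) :=
    Real.rpow_le_rpow_of_nonpos hx hxy (by linarith)
  have hflux (x : ℝ) (hx : 0 ≤ x) : flux p x = x ^ (p - 2) * x := by rw [flux, abs_of_nonneg hx]
  have hsum := hanti t (t + a) htpos (by linarith)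
  have hpow : 0 ≤ t ^ (p - 2) := by positivity
  rw [abs_of_pos htpos, hflux _ (by linarith)]
  rcases lt_or_ge a t with h | h
  · rw [neg_add_eq_sub, ← neg_sub t a, flux_neg, hflux (t - a) (by linarith)]
    have hdiff := hanti (t - a) (t + a) (by linarith) (by linarith)
    nlinarith
  · have hmono : flux p (-t + a) ≤ t ^ (p - 2) * a := by
      refine (flux_monotone hp (by linarith : -t + a ≤ a)).trans ?_
      rw [hflux a ha]
      exact mul_le_mul_of_nonneg_right (hanti t a htpos h) ha
    nlinarith

lemma flux_sub_flux_le {p x y : ℝ} (hp : 2 ≤ p) (hyx : |y| ≤ x) :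
    flux p x - flux p y ≤ (p - 1) * x ^ (p - 2) * (x - y) := by
  have hx : 0 ≤ x := (abs_nonneg y).trans hyx
  rcases le_total 0 y with hy | hy
  · rw [flux_of_nonneg (by linarith) hx, flux_of_nonneg (by linarith) hy]
    have := rpow_sub_rpow_le (b := p - 1) (by linarith) hx hy
    rwa [show p - 1 - 1 = p - 2 by ring] at this
  · have hmono : |y| ^ (p - 2) ≤ x ^ (p - 2) :=
      Real.rpow_le_rpow (abs_nonneg y) hyx (by linarith)
    calc flux p x - flux p y ≤ x ^ (p - 2) * (x - y) := by
          rw [flux, flux, abs_of_nonneg hx]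
          nlinarith
      _ ≤ (p - 1) * (x ^ (p - 2) * (x - y)) :=
          le_mul_of_one_le_left (mul_nonneg (by positivity) (by linarith)) (by linarith)
      _ = _ := by ring

lemma flux_add_flux_le_of_two_le {p t a : ℝ} (hp : 2 ≤ p) (ha : 0 ≤ a) :
    flux p (t + a) + flux p (-t + a) ≤ 2 * (p - 1) * (|t| + a) ^ (p - 2) * a := by
  wlog ht : 0 ≤ t generalizing t
  · have := this (t := -t) (by linarith)
    rw [neg_neg, abs_neg] at this
    linarith
  have := flux_sub_flux_le hp (x := t + a) (y := t - a) (abs_le.2 ⟨by linarith, by linarith⟩)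
  rw [← neg_sub a t, flux_neg, sub_eq_neg_add a t] at this
  rw [abs_of_nonneg ht]
  linarith

/-! ### Kernel integrals in polar coordinates -/

lemma integrable_and_integral_le {X : Type*} [MeasurableSpace X] {μ : Measure X} {f : X → ℝ}
    {c : ℝ} (hc : 0 ≤ c) (hf : AEStronglyMeasurable f μ) (h0 : 0 ≤ᵐ[μ] f)
    (h : ∫⁻ x, ENNReal.ofReal (f x) ∂μ ≤ ENNReal.ofReal c) :
    Integrable f μ ∧ ∫ x, f x ∂μ ≤ c := by
  have hi : Integrable f μ :=
    ⟨hf, (hasFiniteIntegral_iff_ofReal h0).2 (h.trans_lt ENNReal.ofReal_lt_top)⟩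
  rw [← ofReal_integral_eq_lintegral_ofReal hi h0] at h
  exact ⟨hi, (ENNReal.ofReal_le_ofReal_iff hc).1 h⟩

lemma lintegral_Ioo_rpow {a L : ℝ} (ha : 0 < a) (hL : 0 ≤ L) :
    ∫⁻ r in Ioo 0 L, ENNReal.ofReal (r ^ (a - 1)) = ENNReal.ofReal (L ^ a / a) := by
  have hi : IntervalIntegrable (fun r : ℝ => r ^ (a - 1)) volume 0 L :=
    intervalIntegral.intervalIntegrable_rpow' (by linarith)
  rw [setLIntegral_congr Ioo_ae_eq_Ioc, ← ofReal_integral_eq_lintegral_ofReal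
    ((intervalIntegrable_iff_integrableOn_Ioc_of_le hL).1 hi),
    ← intervalIntegral.integral_of_le hL, integral_rpow (Or.inl (by linarith))]
  · simp [Real.zero_rpow ha.ne']
  · filter_upwards [ae_restrict_mem measurableSet_Ioc] with r hr
    exact Real.rpow_nonneg hr.1.le _

lemma lintegral_Ici_rpow {a L : ℝ} (ha : 0 < a) (hL : 0 < L) :
    ∫⁻ r in Ici L, ENNReal.ofReal (r ^ (-a - 1)) = ENNReal.ofReal (L ^ (-a) / a) := by
  rw [setLIntegral_congr Ioi_ae_eq_Ici.symm, ← ofReal_integral_eq_lintegral_ofReal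
    (integrableOn_Ioi_rpow_of_lt (by linarith) hL), integral_Ioi_rpow_of_lt (by linarith) hL,
    sub_add_cancel, neg_div_neg_eq]
  filter_upwards [ae_restrict_mem measurableSet_Ioi] with r hr
  exact Real.rpow_nonneg (hL.trans hr).le _

lemma ofReal_pow_mul_ofReal_rpow {d : ℕ} (hd : 0 < d) (a : ℝ) {r : ℝ} (hr : 0 < r) :
    ENNReal.ofReal (r ^ (d - 1)) * ENNReal.ofReal (r ^ (a - d)) = ENNReal.ofReal (r ^ (a - 1)) := by
  rw [← ENNReal.ofReal_mul (by positivity), ← Real.rpow_natCast, ← Real.rpow_add hr,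
    Nat.cast_sub hd, Nat.cast_one]
  ring_nf

section Polar

open Module

variable {F : Type*} [NormedAddCommGroup F] [NormedSpace ℝ F] [FiniteDimensional ℝ F]
  [Nontrivial F] [MeasurableSpace F] [BorelSpace F] (μ : Measure F) [μ.IsAddHaarMeasure]

lemma lintegral_polar {Θ : F → ENNReal} (hΘ : Measurable Θ) {ρ : ℝ → ENNReal}
    (hρ : Measurable ρ) :
    ∫⁻ h, Θ (‖h‖⁻¹ • h) * ρ ‖h‖ ∂μ = (∫⁻ ω, Θ ω ∂μ.toSphere) *
      ∫⁻ r in Ioi (0 : ℝ), ENNReal.ofReal (r ^ (finrank ℝ F - 1)) * ρ r := by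
  have hsphere : Measurable fun ω : Metric.sphere (0 : F) 1 => Θ ω :=
    hΘ.comp measurable_subtype_coe
  have hradius : Measurable fun r : Ioi (0 : ℝ) => ρ r := hρ.comp measurable_subtype_coe
  calc ∫⁻ h, Θ (‖h‖⁻¹ • h) * ρ ‖h‖ ∂μ
      = ∫⁻ x : ({0}ᶜ : Set F), Θ (‖x.1‖⁻¹ • x.1) * ρ ‖x.1‖ ∂μ.comap Subtype.val := by
        rw [lintegral_subtype_comap (measurableSet_singleton _).compl
          (fun h : F => Θ (‖h‖⁻¹ • h) * ρ ‖h‖), restrict_compl_singleton]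
    _ = ∫⁻ z, Θ z.1 * ρ z.2 ∂μ.toSphere.prod (Measure.volumeIoiPow (finrank ℝ F - 1)) := by
        simpa [homeomorphUnitSphereProd] using
          μ.measurePreserving_homeomorphUnitSphereProd.lintegral_comp_emb
            (Homeomorph.measurableEmbedding _)
            (fun z : Metric.sphere (0 : F) 1 × Ioi (0 : ℝ) => Θ z.1 * ρ z.2)
    _ = _ := by
        rw [lintegral_prod_mul hsphere.aemeasurable hradius.aemeasurable, Measure.volumeIoiPow,
          lintegral_withDensity_eq_lintegral_mul _ (by fun_prop) hradius,
          ← lintegral_subtype_comap measurableSet_Ioi]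
        rfl

lemma setLIntegral_polar {Θ : F → ENNReal} (hΘ : Measurable Θ) {ρ : ℝ → ENNReal}
    (hρ : Measurable ρ) {S : Set ℝ} (hS : MeasurableSet S) :
    ∫⁻ h in norm ⁻¹' S, Θ (‖h‖⁻¹ • h) * ρ ‖h‖ ∂μ = (∫⁻ ω, Θ ω ∂μ.toSphere) *
      ∫⁻ r in S ∩ Ioi 0, ENNReal.ofReal (r ^ (finrank ℝ F - 1)) * ρ r := by
  have h := lintegral_polar μ hΘ (hρ.indicator hS)
  rw [← lintegral_indicator (measurable_norm hS), ← Measure.restrict_restrict hS,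
    ← lintegral_indicator hS]
  simp only [indicator_mul_right] at h ⊢
  exact h

lemma lintegral_compl_ball_norm_rpow {a L : ℝ} (ha : 0 < a) (hL : 0 < L) :
    ∫⁻ h in (Metric.ball (0 : F) L)ᶜ, ENNReal.ofReal (‖h‖ ^ (-(finrank ℝ F + a))) ∂μ =
      μ.toSphere univ * ENNReal.ofReal (L ^ (-a) / a) := by
  have hset : (Metric.ball (0 : F) L)ᶜ = norm ⁻¹' Ici L := by ext; simp
  have hradial : Ici L ∩ Ioi 0 = Ici L := inter_eq_left.2 (Ici_subset_Ioi.2 hL)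
  have h := setLIntegral_polar μ (Θ := fun _ => 1) measurable_const
    (ρ := fun r => ENNReal.ofReal (r ^ (-a - finrank ℝ F))) (by fun_prop)
    (measurableSet_Ici (a := L))
  rw [hradial, setLIntegral_congr_fun measurableSet_Ici
    fun r hr => ofReal_pow_mul_ofReal_rpow finrank_pos (-a) (hL.trans_le hr),
    lintegral_Ici_rpow ha hL, lintegral_const] at h
  simpa only [one_mul, hset, neg_add, sub_eq_neg_add] using h

lemma integrableOn_compl_ball_norm_rpow {a L : ℝ} (ha : 0 < a) (hL : 0 < L) :
    IntegrableOn (fun h : F => ‖h‖ ^ (-(finrank ℝ F + a))) (Metric.ball 0 L)ᶜ μ ∧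
      ∫ h in (Metric.ball (0 : F) L)ᶜ, ‖h‖ ^ (-(finrank ℝ F + a)) ∂μ ≤
        μ.toSphere.real univ * (L ^ (-a) / a) := by
  refine integrable_and_integral_le (by positivity)
    (by fun_prop : Measurable fun h : F => ‖h‖ ^ (-(finrank ℝ F + a))).aestronglyMeasurable
    (ae_of_all _ fun h => by positivity) (le_of_eq ?_)
  rw [lintegral_compl_ball_norm_rpow μ ha hL, ENNReal.ofReal_mul (by positivity),
    ofReal_measureReal]

end Polar

section Inner

open Module

variable {F : Type*} [NormedAddCommGroup F] [InnerProductSpace ℝ F] [FiniteDimensional ℝ F]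
  [MeasurableSpace F] [BorelSpace F]

lemma lintegral_ball_abs_inner_rpow [Nontrivial F] (e : F) (b : ℝ) {a L : ℝ} (ha : 0 < a)
    (hL : 0 ≤ L) :
    ∫⁻ h in Metric.ball (0 : F) L,
        ENNReal.ofReal (|inner ℝ e h| ^ b * ‖h‖ ^ (a - finrank ℝ F - b)) =
      (∫⁻ ω, ENNReal.ofReal (|inner ℝ e (ω : F)| ^ b) ∂(volume : Measure F).toSphere) *
        ENNReal.ofReal (L ^ a / a) := by
  have hset : Metric.ball (0 : F) L = norm ⁻¹' Iio L := by ext; simp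
  have h := setLIntegral_polar (volume : Measure F)
    (Θ := fun h => ENNReal.ofReal (|inner ℝ e h| ^ b)) (by fun_prop)
    (ρ := fun r => ENNReal.ofReal (r ^ (a - finrank ℝ F))) (by fun_prop)
    (measurableSet_Iio (a := L))
  rw [inter_comm, Ioi_inter_Iio, setLIntegral_congr_fun measurableSet_Ioo
    fun r hr => ofReal_pow_mul_ofReal_rpow finrank_pos a hr.1, lintegral_Ioo_rpow ha hL] at h
  rw [← h, ← hset]
  refine lintegral_congr_ae (ae_restrict_of_ae ?_)
  filter_upwards [Measure.ae_ne volume (0 : F)] with x hx0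
  have hx : 0 < ‖x‖ := norm_pos_iff.2 hx0
  rw [← ENNReal.ofReal_mul (by positivity), real_inner_smul_right, abs_mul,
    abs_of_pos (inv_pos.2 hx), Real.mul_rpow (by positivity) (by positivity),
    Real.inv_rpow hx.le, Real.rpow_sub hx (a - finrank ℝ F)]
  congr 1
  field_simp

lemma lintegral_ball_inner_eq_of_norm_eq {e e' : F} (he : ‖e‖ = ‖e'‖) (r : ℝ)
    (g : ℝ → ENNReal) :
    ∫⁻ h in Metric.ball (0 : F) r, g (inner ℝ e h) =
      ∫⁻ h in Metric.ball (0 : F) r, g (inner ℝ e' h) := by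
  let O := (ℝ ∙ (e - e'))ᗮ.reflection
  have hO : O e' = e := by
    rw [← Submodule.reflection_sub he]
    exact Submodule.reflection_reflection _ _
  rw [← O.measurePreserving.setLIntegral_comp_preimage_emb
    O.toHomeomorph.measurableEmbedding, LinearIsometryEquiv.preimage_ball, map_zero]
  simp_rw [← hO, LinearIsometryEquiv.inner_map_map]

lemma ae_inner_ne_zero {e : F} (he : e ≠ 0) : ∀ᵐ h : F, inner ℝ e h ≠ 0 := by
  have hproper : (ℝ ∙ e)ᗮ ≠ ⊤ := by
    rw [Ne, Submodule.orthogonal_eq_top_iff, Submodule.span_singleton_eq_bot]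
    exact he
  refine measure_mono_null (fun h hh => ?_) (Measure.addHaar_submodule volume _ hproper)
  simpa [Submodule.mem_orthogonal_singleton_iff_inner_right] using hh

end Inner

lemma integrableOn_abs_rpow_Ioo {b r : ℝ} (hb : -1 < b) (hr : 0 < r) :
    IntegrableOn (fun t : ℝ => |t| ^ b) (Ioo (-r) r) := by
  have h : IntegrableOn (fun t : ℝ => ‖t‖ ^ b) (Metric.ball 0 r) := by
    rw [integrableOn_fun_norm_addHaar volume (f := fun t => t ^ b)]
    simpa [intervalIntegral.integrableOn_Ioo_rpow_iff hr] using hb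
  simpa [Real.ball_eq_Ioo] using h

lemma integrableOn_ball_abs_apply_rpow {ι : Type*} [Fintype ι] (i : ι) {b r : ℝ} (hb : -1 < b)
    (hr : 0 < r) : IntegrableOn (fun x : EuclideanSpace ℝ ι => |x i| ^ b) (Metric.ball 0 r) := by
  classical
  let f (j : ι) : ℝ → ℝ := (Ioo (-r) r).indicator fun t => if j = i then |t| ^ b else 1
  have hf (j : ι) : Integrable (f j) := by
    rw [integrable_indicator_iff measurableSet_Ioo]
    split_ifs
    · exact integrableOn_abs_rpow_Ioo hb hr
    · simp
  have hprod : Integrable fun x : EuclideanSpace ℝ ι => ∏ j, f j (x j) :=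
    (PiLp.volume_preserving_ofLp ι).integrable_comp_of_integrable (Integrable.fintype_prod hf)
  refine hprod.integrableOn.congr_fun (fun x hx => ?_) measurableSet_ball
  have hmem (j : ι) : x j ∈ Ioo (-r) r := by
    refine abs_lt.1 ?_
    rw [← Real.norm_eq_abs]
    exact (PiLp.norm_apply_le x j).trans_lt (mem_ball_zero_iff.1 hx)
  simp [f, hmem]

lemma exists_setIntegral_ball_abs_inner_rpow_le {n : ℕ} (hn : 1 ≤ n) {b : ℝ} (hb : -1 < b) :
    ∃ C : ℝ, 0 < C ∧ ∀ e : E n, ‖e‖ = 1 → ∀ a L : ℝ, 0 < a → 0 ≤ L →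
      IntegrableOn (fun h : E n => |inner ℝ e h| ^ b * ‖h‖ ^ (a - n - b)) (Metric.ball 0 L) ∧
        ∫ h in Metric.ball (0 : E n) L, |inner ℝ e h| ^ b * ‖h‖ ^ (a - n - b) ≤
          C * (L ^ a / a) := by
  have : Nonempty (Fin n) := ⟨⟨0, hn⟩⟩
  let e₀ : E n := EuclideanSpace.single ⟨0, hn⟩ 1
  let moment (e : E n) : ENNReal :=
    ∫⁻ ω, ENNReal.ofReal (|inner ℝ e (ω : E n)| ^ b) ∂(volume : Measure (E n)).toSphere
  have hdim : 0 < n + b := by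
    have : (1 : ℝ) ≤ n := by exact_mod_cast hn
    linarith
  have hball (e : E n) : ∫⁻ h in Metric.ball (0 : E n) 1, ENNReal.ofReal (|inner ℝ e h| ^ b) =
      moment e * ENNReal.ofReal (1 / (n + b)) := by
    simpa using lintegral_ball_abs_inner_rpow e b hdim zero_le_one
  have hfinite : moment e₀ ≠ ⊤ := by
    have h := (integrableOn_ball_abs_apply_rpow (⟨0, hn⟩ : Fin n) hb one_pos).lintegral_lt_top
    intro htop
    have hcoord (x : E n) : inner ℝ e₀ x = x ⟨0, hn⟩ := by
      simp [e₀, EuclideanSpace.inner_single_left]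
    have := hball e₀
    simp only [hcoord, htop] at this
    rw [ENNReal.top_mul (by simpa using hdim)] at this
    exact h.ne this
  have hrotation (e : E n) (he : ‖e‖ = 1) : moment e = moment e₀ := by
    have h := lintegral_ball_inner_eq_of_norm_eq (he.trans (by simp [e₀] : ‖e₀‖ = 1).symm) 1
      fun t => ENNReal.ofReal (|t| ^ b)
    rw [hball, hball] at h
    exact (ENNReal.mul_left_inj (by simpa using hdim) ENNReal.ofReal_ne_top).1 h
  refine ⟨(moment e₀).toReal + 1, by positivity, fun e he a L ha hL => ?_⟩
  refine integrable_and_integral_le (by positivity) (by fun_prop : Measurable fun h : E n =>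
      |inner ℝ e h| ^ b * ‖h‖ ^ (a - n - b)).aestronglyMeasurable
    (ae_of_all _ fun h => by positivity) ?_
  have hpolar := lintegral_ball_abs_inner_rpow e b ha hL
  rw [finrank_euclideanSpace_fin] at hpolar
  rw [hpolar, ENNReal.ofReal_mul (by positivity)]
  gcongr
  calc moment e = ENNReal.ofReal (moment e₀).toReal := by
        rw [hrotation e he, ENNReal.ofReal_toReal hfinite]
    _ ≤ _ := ENNReal.ofReal_le_ofReal (by simp)

/-! ### The truncated kernel -/

/-- The kernel `‖h‖^{-n-sp}` truncated to `‖h‖ > η`, which makes it integrable, so that the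
nonlocal operator converges absolutely and Fubini applies to the first variation of the energy. -/
def truncKernel {n : ℕ} (s p η : ℝ) (h : E n) : ℝ :=
  {h : E n | η < ‖h‖}.indicator (fun h => (‖h‖ ^ ((n : ℝ) + s * p))⁻¹) h

@[fun_prop]
lemma measurable_truncKernel {n : ℕ} (s p η : ℝ) : Measurable (truncKernel (n := n) s p η) :=
  Measurable.indicator (by fun_prop) (measurableSet_lt measurable_const measurable_norm)

lemma truncKernel_nonneg {n : ℕ} (s p η : ℝ) (h : E n) : 0 ≤ truncKernel s p η h :=
  indicator_nonneg (fun _ _ => by positivity) _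

lemma truncKernel_neg {n : ℕ} (s p η : ℝ) (h : E n) :
    truncKernel s p η (-h) = truncKernel s p η h := by
  simp [truncKernel, indicator]

lemma truncKernel_le {n : ℕ} (s p η : ℝ) (h : E n) :
    truncKernel s p η h ≤ (‖h‖ ^ ((n : ℝ) + s * p))⁻¹ :=
  indicator_le_self' (fun _ _ => by positivity) _

lemma integrable_truncKernel {n : ℕ} (hn : 1 ≤ n) {s p η : ℝ} (hsp : 0 < s * p) (hη : 0 < η) :
    Integrable (truncKernel (n := n) s p η) := by
  have : Nonempty (Fin n) := ⟨⟨0, hn⟩⟩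
  obtain ⟨hint, -⟩ := integrableOn_compl_ball_norm_rpow (volume : Measure (E n)) hsp hη
  simp_rw [finrank_euclideanSpace_fin, Real.rpow_neg (norm_nonneg _)] at hint
  exact (hint.mono_set fun h (hh : η < ‖h‖) => by simpa using hh.le).integrable_indicator
    (measurableSet_lt measurable_const measurable_norm)

lemma two_mul_integral_truncKernel_mul {n : ℕ} (hn : 1 ≤ n) {s p η M : ℝ} (hsp : 0 < s * p)
    (hη : 0 < η) {g : E n → ℝ} (hg : Measurable g) (hM : ∀ y, |g y| ≤ M) (x : E n) :
    Integrable (fun h => truncKernel s p η h * (g (x + h) + g (x - h))) ∧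
      2 * ∫ y, truncKernel s p η (x - y) * g y =
        ∫ h, truncKernel s p η h * (g (x + h) + g (x - h)) := by
  let F (h : E n) : ℝ := truncKernel s p η h * g (x + h)
  have hF : Integrable F := (integrable_truncKernel hn hsp hη).mul_bdd (c := M)
    (by fun_prop : Measurable fun h => g (x + h)).aestronglyMeasurable
    (ae_of_all _ fun h => hM (x + h))
  have hF_neg : Integrable (fun h => F (-h)) := hF.comp_neg
  have hsum (h : E n) : truncKernel s p η h * (g (x + h) + g (x - h)) = F h + F (-h) := by
    simp only [F, truncKernel_neg, ← sub_eq_add_neg]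
    ring
  have hcenter : ∫ y, truncKernel s p η (x - y) * g y = ∫ h, F h := by
    rw [← integral_add_left_eq_self _ x]
    simp [F, truncKernel_neg]
  simp_rw [hsum]
  refine ⟨hF.add hF_neg, ?_⟩
  rw [integral_add hF hF_neg, integral_neg_eq_self, hcenter]
  ring

/-! ### Radial bowls -/

section RadialExcess

variable {F : Type*} [NormedAddCommGroup F]

/-- The distance from `y` to the ball of radius `ℓ` centred at the origin. -/
def radialExcess (ℓ : ℝ) (y : F) : ℝ := max (‖y‖ - ℓ) 0

/-- The radial profile equal to `a` on the ball of radius `ℓ` and growing like the power `β` of the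
distance to that ball, up to the value `a + 2` at distance `L`; the barriers are infima of bowls. -/
def bowl (β ℓ L a : ℝ) (y : F) : ℝ := a + 2 * (radialExcess ℓ y / L) ^ β

lemma radialExcess_nonneg (ℓ : ℝ) (y : F) : 0 ≤ radialExcess ℓ y := le_max_right _ _

lemma radialExcess_of_pos {ℓ : ℝ} {y : F} (h : 0 < radialExcess ℓ y) :
    radialExcess ℓ y = ‖y‖ - ℓ :=
  max_eq_left ((lt_max_iff.1 h).resolve_right (lt_irrefl 0)).le

lemma radialExcess_add_le (ℓ : ℝ) (x h : F) :
    radialExcess ℓ (x + h) ≤ radialExcess ℓ x + ‖h‖ := by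
  refine max_le ?_ (add_nonneg (radialExcess_nonneg ℓ x) (norm_nonneg h))
  have hx : ‖x‖ - ℓ ≤ radialExcess ℓ x := le_max_left _ _
  linarith [norm_add_le x h]

lemma radialExcess_smul [NormedSpace ℝ F] {L : ℝ} (hL : 0 < L) (ℓ : ℝ) (y : F) :
    radialExcess ℓ (L • y) = L * radialExcess (ℓ / L) y := by
  rw [radialExcess, radialExcess, mul_max_of_nonneg _ _ hL.le, norm_smul,
    Real.norm_of_nonneg hL.le, mul_sub, mul_div_cancel₀ _ hL.ne', mul_zero]

lemma bowl_smul [NormedSpace ℝ F] {L : ℝ} (hL : 0 < L) (β ℓ a : ℝ) (y : F) :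
    bowl β ℓ L a (L • y) = bowl β (ℓ / L) 1 a y := by
  rw [bowl, bowl, radialExcess_smul hL, mul_div_cancel_left₀ _ hL.ne', div_one]

end RadialExcess

lemma add_rpow_le_quadratic {β t q : ℝ} (hβ : 2 ≤ β) (ht : 0 < t) (hq : |q| ≤ t) :
    (t + q) ^ β ≤ t ^ β + t ^ (β - 2) * (β * t * q + β * (β - 1) * 2 ^ (β - 2) * q ^ 2) := by
  obtain ⟨r, rfl⟩ : ∃ r, q = t * r := ⟨q / t, by field_simp⟩
  rw [abs_mul, abs_of_pos ht, mul_le_iff_le_one_right ht, abs_le] at hq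
  have hsq : t ^ β = t ^ (β - 2) * t ^ 2 := by
    rw [← Real.rpow_natCast, ← Real.rpow_add ht]
    norm_num
  calc (t + t * r) ^ β = t ^ β * (1 + r) ^ β := by
        rw [← Real.mul_rpow ht.le (by linarith)]
        ring_nf
    _ ≤ t ^ β * (1 + β * r + β * (β - 1) * 2 ^ (β - 2) * r ^ 2) := by
        gcongr
        exact one_add_rpow_le_quadratic hβ hq.1 hq.2
    _ = _ := by
        rw [hsq]
        ring

section Inner

variable {F : Type*} [NormedAddCommGroup F] [InnerProductSpace ℝ F]

lemma norm_add_le_inner {e x h : F} (hx : x = ‖x‖ • e) (hx0 : x ≠ 0) :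
    ‖x + h‖ ≤ ‖x‖ + inner ℝ e h + ‖h‖ ^ 2 / (2 * ‖x‖) := by
  have hinner : inner ℝ x h = ‖x‖ * inner ℝ e h := by
    conv_lhs => rw [hx]
    exact real_inner_smul_left _ _ _
  have hsq : ‖x + h‖ ^ 2 = ‖x‖ ^ 2 + 2 * (‖x‖ * inner ℝ e h) + ‖h‖ ^ 2 := by
    rw [norm_add_sq_real, hinner]
  refine le_of_mul_le_mul_left ?_ (mul_pos two_pos (norm_pos_iff.2 hx0))
  calc 2 * ‖x‖ * ‖x + h‖ ≤ ‖x‖ ^ 2 + ‖x + h‖ ^ 2 := two_mul_le_add_sq _ _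
    _ = 2 * ‖x‖ * (‖x‖ + inner ℝ e h + ‖h‖ ^ 2 / (2 * ‖x‖)) := by
        rw [hsq]
        field_simp
        ring

lemma radialExcess_add_le_inner {ℓ : ℝ} {e x h : F} (hℓ : 0 ≤ ℓ) (he : ‖e‖ = 1)
    (hx : x = ‖x‖ • e) (hh : 2 * ‖h‖ < radialExcess ℓ x) :
    radialExcess ℓ (x + h) ≤
      radialExcess ℓ x + (inner ℝ e h + ‖h‖ ^ 2 / (2 * radialExcess ℓ x)) := by
  have hh0 := norm_nonneg h
  have ht : 0 < radialExcess ℓ x := by linarith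
  have hxt := radialExcess_of_pos ht
  set t := radialExcess ℓ x
  have hx0 : 0 < ‖x‖ := by linarith
  have hi : |inner ℝ e h| ≤ ‖h‖ := by simpa [he] using abs_real_inner_le_norm e h
  have hquot : 0 ≤ ‖h‖ ^ 2 / (2 * t) := by positivity
  have hmono : ‖h‖ ^ 2 / (2 * ‖x‖) ≤ ‖h‖ ^ 2 / (2 * t) := by
    gcongr
    linarith
  refine max_le ?_ (by linarith [(abs_le.1 hi).1])
  linarith [norm_add_le_inner hx (norm_pos_iff.1 hx0) (h := h)]

lemma radialExcess_add_rpow_le {β ℓ : ℝ} {e x h : F} (hβ : 2 ≤ β) (hℓ : 0 ≤ ℓ) (he : ‖e‖ = 1)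
    (hx : x = ‖x‖ • e) (hh : 2 * ‖h‖ < radialExcess ℓ x) :
    radialExcess ℓ (x + h) ^ β ≤ radialExcess ℓ x ^ β +
      β * radialExcess ℓ x ^ (β - 1) * inner ℝ e h +
      β ^ 2 * 2 ^ (β - 1) * radialExcess ℓ x ^ (β - 2) * ‖h‖ ^ 2 := by
  have hexcess := radialExcess_add_le_inner hℓ he hx hh
  have ht : 0 < radialExcess ℓ x := by linarith [norm_nonneg h]
  set t := radialExcess ℓ x
  set i := inner ℝ e h
  set q := i + ‖h‖ ^ 2 / (2 * t) with hq
  have hi : |i| ≤ ‖h‖ := by simpa [he] using abs_real_inner_le_norm e h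
  have hquot0 : 0 ≤ ‖h‖ ^ 2 / (2 * t) := by positivity
  have hquot : ‖h‖ ^ 2 / (2 * t) ≤ ‖h‖ / 4 := by
    rw [div_le_iff₀ (by positivity)]
    nlinarith [norm_nonneg h]
  have hqabs : |q| ≤ 5 / 4 * ‖h‖ := by
    rw [abs_le] at hi ⊢
    constructor <;> linarith
  have hqsq : q ^ 2 ≤ 2 * ‖h‖ ^ 2 := by
    nlinarith [sq_le_sq' (abs_le.1 hqabs).1 (abs_le.1 hqabs).2]
  have hquadratic : β * t * q + β * (β - 1) * 2 ^ (β - 2) * q ^ 2 ≤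
      β * t * i + β ^ 2 * 2 ^ (β - 1) * ‖h‖ ^ 2 := by
    have htq : t * q = t * i + ‖h‖ ^ 2 / 2 := by
      rw [hq]
      field_simp
    have hpow : (2 : ℝ) ^ (β - 1) = 2 ^ (β - 2) * 2 := by
      rw [← Real.rpow_add_one two_ne_zero]
      ring_nf
    have hone : (1 : ℝ) ≤ 2 ^ (β - 2) := Real.one_le_rpow one_le_two (by linarith)
    have hK : 0 ≤ β * (β - 1) * 2 ^ (β - 2) :=
      mul_nonneg (mul_nonneg (by linarith) (by linarith)) (by positivity)
    have hβh : 0 ≤ β * ‖h‖ ^ 2 := mul_nonneg (by linarith) (by positivity)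
    rw [hpow, mul_assoc β t q, htq]
    nlinarith [mul_le_mul_of_nonneg_left hqsq hK, mul_le_mul_of_nonneg_left hone hβh]
  calc radialExcess ℓ (x + h) ^ β ≤ (t + q) ^ β :=
        Real.rpow_le_rpow (radialExcess_nonneg _ _) hexcess (by linarith)
    _ ≤ t ^ β + t ^ (β - 2) * (β * t * i + β ^ 2 * 2 ^ (β - 1) * ‖h‖ ^ 2) :=
        (add_rpow_le_quadratic hβ ht (by linarith [norm_nonneg h])).trans (by gcongr)
    _ = _ := by
        rw [show β - 1 = β - 2 + 1 by ring, Real.rpow_add_one ht.ne']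
        ring

end Inner

/-! ### The nonlocal operator at a contact point with a bowl -/

lemma flux_add_flux_le_abs_rpow_mul_sq {p A B P X i η : ℝ} (hp : 1 < p) (hp2 : p ≤ 2)
    (hA : 0 ≤ A) (hB : 0 < B) (hP : 0 ≤ P) (hX : 0 < X) (hXP : X ^ (p - 2) * P ≤ 1)
    (hi : i ≠ 0) :
    flux p (B * X * i + A * P * η ^ 2) + flux p (-(B * X * i) + A * P * η ^ 2) ≤
      4 * B ^ (p - 2) * A * (|i| ^ (p - 2) * η ^ 2) := by
  refine (flux_add_flux_le_of_le_two hp hp2 (by positivity) (by positivity)).trans ?_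
  calc 4 * |B * X * i| ^ (p - 2) * (A * P * η ^ 2)
      = 4 * B ^ (p - 2) * A * (|i| ^ (p - 2) * η ^ 2) * (X ^ (p - 2) * P) := by
        rw [abs_mul, abs_of_pos (mul_pos hB hX), Real.mul_rpow (by positivity) (by positivity),
          Real.mul_rpow hB.le hX.le]
        ring
    _ ≤ _ := mul_le_of_le_one_right (by positivity) hXP

lemma flux_add_flux_le_rpow {p A B P X i η : ℝ} (hp : 2 ≤ p) (hA : 0 ≤ A) (hB : 0 ≤ B)
    (hP : 0 ≤ P) (hX : 0 ≤ X) (hXP : X ^ (p - 2) * P ≤ 1) (hη : 0 < η) (hiη : |i| ≤ η)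
    (hPη : P * η ≤ X) :
    flux p (B * X * i + A * P * η ^ 2) + flux p (-(B * X * i) + A * P * η ^ 2) ≤
      2 * (p - 1) * (B + A) ^ (p - 2) * A * η ^ p := by
  refine (flux_add_flux_le_of_two_le hp (by positivity)).trans ?_
  have hp1 : 0 ≤ p - 1 := by linarith
  have hsize : |B * X * i| + A * P * η ^ 2 ≤ (B + A) * (X * η) := by
    rw [abs_mul, abs_of_nonneg (mul_nonneg hB hX)]
    have hfirst : B * X * |i| ≤ B * X * η := by gcongr
    have hsecond : A * η * (P * η) ≤ A * η * X := by gcongr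
    linarith
  have hpow : η ^ p = η ^ (p - 2) * η ^ 2 := by
    rw [← Real.rpow_natCast, ← Real.rpow_add hη]
    norm_num
  calc 2 * (p - 1) * (|B * X * i| + A * P * η ^ 2) ^ (p - 2) * (A * P * η ^ 2)
      ≤ 2 * (p - 1) * ((B + A) * (X * η)) ^ (p - 2) * (A * P * η ^ 2) := by
        gcongr
    _ = 2 * (p - 1) * (B + A) ^ (p - 2) * A * η ^ p * (X ^ (p - 2) * P) := by
        rw [Real.mul_rpow (by positivity) (by positivity), Real.mul_rpow hX hη.le, hpow]
        ring
    _ ≤ _ := mul_le_of_le_one_right (by positivity) hXP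

section Contact

variable {F : Type*} [NormedAddCommGroup F]

lemma flux_le_of_radialExcess_le {p β ℓ D : ℝ} {x h : F} (hp : 1 < p) (hβ : 0 ≤ β)
    (hβp : p ≤ β * (p - 1)) (hh : ‖h‖ ≤ 1) (hx : radialExcess ℓ x ≤ 2 * ‖h‖)
    (hD : D ≤ 2 * radialExcess ℓ (x + h) ^ β) :
    flux p D ≤ (2 * 3 ^ β) ^ (p - 1) * ‖h‖ ^ p := by
  have hexcess : radialExcess ℓ (x + h) ≤ 3 * ‖h‖ := by linarith [radialExcess_add_le ℓ x h]
  have hD' : D ≤ 2 * 3 ^ β * ‖h‖ ^ β := by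
    have := Real.rpow_le_rpow (radialExcess_nonneg _ _) hexcess hβ
    rw [Real.mul_rpow (by norm_num) (norm_nonneg h)] at this
    linarith
  calc flux p D ≤ flux p (2 * 3 ^ β * ‖h‖ ^ β) := flux_monotone hp hD'
    _ = (2 * 3 ^ β) ^ (p - 1) * ‖h‖ ^ (β * (p - 1)) := by
        rw [flux_of_nonneg hp.ne' (by positivity), Real.mul_rpow (by positivity) (by positivity),
          ← Real.rpow_mul (norm_nonneg h)]
    _ ≤ (2 * 3 ^ β) ^ (p - 1) * ‖h‖ ^ p := by
        gcongr ?_ * ?_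
        exact Real.rpow_le_rpow_of_exponent_ge' (norm_nonneg h) hh (by linarith) hβp

variable [InnerProductSpace ℝ F]

lemma exists_flux_add_flux_le_of_lt_radialExcess {p β : ℝ} (hp : 1 < p) (hβ : 2 ≤ β)
    (hβp : p ≤ β * (p - 1)) :
    ∃ C : ℝ, 0 < C ∧ ∀ {x h e : F} {ℓ D₁ D₂ : ℝ}, 0 ≤ ℓ → radialExcess ℓ x ≤ 1 →
      2 * ‖h‖ < radialExcess ℓ x → ‖e‖ = 1 → x = ‖x‖ • e → inner ℝ e h ≠ 0 →
      D₁ ≤ 2 * radialExcess ℓ (x + h) ^ β - 2 * radialExcess ℓ x ^ β →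
      D₂ ≤ 2 * radialExcess ℓ (x - h) ^ β - 2 * radialExcess ℓ x ^ β →
      flux p D₁ + flux p D₂ ≤ C * (‖h‖ ^ p + |inner ℝ e h| ^ (p - 2) * ‖h‖ ^ 2) := by
  have : 0 < β := by linarith
  let A := 2 * (β ^ 2 * 2 ^ (β - 1))
  let c₁ := 4 * (2 * β) ^ (p - 2) * A
  let c₂ := 2 * (p - 1) * (2 * β + A) ^ (p - 2) * A
  have hA : 0 < A := by positivity
  have hc₁ : 0 < c₁ := by positivity
  have hc₂ : 0 < c₂ := by
    have : 0 < p - 1 := by linarith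
    positivity
  refine ⟨c₁ + c₂, by positivity, fun {x h e ℓ D₁ D₂} hℓ hx1 hh he hx hi hD₁ hD₂ => ?_⟩
  have hplus := radialExcess_add_rpow_le hβ hℓ he hx hh
  have hminus := radialExcess_add_rpow_le (h := -h) hβ hℓ he hx (by rwa [norm_neg])
  rw [inner_neg_right, norm_neg, ← sub_eq_add_neg] at hminus
  have hη : 0 < ‖h‖ := norm_pos_iff.2 (by rintro rfl; simp at hi)
  have hiη : |inner ℝ e h| ≤ ‖h‖ := by simpa [he] using abs_real_inner_le_norm e h
  set t := radialExcess ℓ x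
  set i := inner ℝ e h
  have ht : 0 < t := by linarith
  have hXP : (t ^ (β - 1)) ^ (p - 2) * t ^ (β - 2) ≤ 1 := by
    rw [← Real.rpow_mul ht.le, ← Real.rpow_add ht]
    exact Real.rpow_le_one ht.le hx1 (by nlinarith)
  have hPη : t ^ (β - 2) * ‖h‖ ≤ t ^ (β - 1) := by
    rw [show β - 1 = β - 2 + 1 by ring, Real.rpow_add_one ht.ne']
    gcongr
    linarith
  have hsum : flux p D₁ + flux p D₂ ≤
      flux p (2 * β * t ^ (β - 1) * i + A * t ^ (β - 2) * ‖h‖ ^ 2) +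
        flux p (-(2 * β * t ^ (β - 1) * i) + A * t ^ (β - 2) * ‖h‖ ^ 2) :=
    add_le_add (flux_monotone hp (by linarith)) (flux_monotone hp (by linarith))
  have hη_nonneg : 0 ≤ ‖h‖ ^ p := by positivity
  have hi_nonneg : 0 ≤ |i| ^ (p - 2) * ‖h‖ ^ 2 := by positivity
  refine hsum.trans ?_
  rcases le_total p 2 with hp2 | hp2
  · refine (flux_add_flux_le_abs_rpow_mul_sq hp hp2 hA.le (by positivity) (by positivity)
      (by positivity) hXP hi).trans ?_
    exact mul_le_mul (by linarith) (by linarith) hi_nonneg (by positivity)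
  · refine (flux_add_flux_le_rpow hp2 hA.le (by positivity) (by positivity) (by positivity) hXP
      hη hiη hPη).trans ?_
    exact mul_le_mul (by linarith) (by linarith) hη_nonneg (by positivity)

lemma exists_flux_add_flux_le_of_touches_unit_bowl {p β : ℝ} (hp : 1 < p) (hβ : 2 ≤ β)
    (hβp : p ≤ β * (p - 1)) :
    ∃ C : ℝ, 0 < C ∧ ∀ {z : F → ℝ} {ℓ a : ℝ} {x h e : F}, 0 ≤ ℓ → z ≤ bowl β ℓ 1 a →
      z x = bowl β ℓ 1 a x → radialExcess ℓ x ≤ 1 → ‖e‖ = 1 → x = ‖x‖ • e → ‖h‖ ≤ 1 →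
      inner ℝ e h ≠ 0 →
      flux p (z (x + h) - z x) + flux p (z (x - h) - z x) ≤
        C * (‖h‖ ^ p + |inner ℝ e h| ^ (p - 2) * ‖h‖ ^ 2) := by
  obtain ⟨C, hC, hfar⟩ := exists_flux_add_flux_le_of_lt_radialExcess (F := F) hp hβ hβp
  let c := 2 * (2 * 3 ^ β : ℝ) ^ (p - 1)
  have hc : 0 < c := by positivity
  refine ⟨C + c, by positivity, fun {z ℓ a x h e} hℓ hz hzx hx1 he hx hh hi => ?_⟩
  have hD (y : F) : z y - z x ≤ 2 * radialExcess ℓ y ^ β - 2 * radialExcess ℓ x ^ β := by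
    have := hz y
    simp only [hzx, bowl, div_one] at this ⊢
    linarith
  have hη_nonneg : 0 ≤ ‖h‖ ^ p := by positivity
  have hi_nonneg : 0 ≤ |inner ℝ e h| ^ (p - 2) * ‖h‖ ^ 2 := by positivity
  rcases lt_or_ge (2 * ‖h‖) (radialExcess ℓ x) with hcase | hcase
  · refine (hfar hℓ hx1 hcase he hx hi (hD _) (hD _)).trans ?_
    gcongr
    linarith
  · have hβ0 : 0 ≤ β := by linarith
    have hx_nonneg : 0 ≤ radialExcess ℓ x ^ β := Real.rpow_nonneg (radialExcess_nonneg _ _) _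
    have hplus := flux_le_of_radialExcess_le hp hβ0 hβp hh hcase (D := z (x + h) - z x)
      (by linarith [hD (x + h)])
    have hminus := flux_le_of_radialExcess_le (h := -h) hp hβ0 hβp (by rwa [norm_neg])
      (by rwa [norm_neg]) (D := z (x - h) - z x) (by
        rw [← sub_eq_add_neg]
        linarith [hD (x - h)])
    rw [norm_neg] at hminus
    calc flux p (z (x + h) - z x) + flux p (z (x - h) - z x) ≤ c * ‖h‖ ^ p := by
          simp only [c]
          linarith
      _ ≤ _ := mul_le_mul (by linarith) (by linarith) hη_nonneg (by positivity)

lemma exists_flux_add_flux_le_of_touches_bowl {p β : ℝ} (hp : 1 < p) (hβ : 2 ≤ β)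
    (hβp : p ≤ β * (p - 1)) :
    ∃ C : ℝ, 0 < C ∧ ∀ {z : F → ℝ} {ℓ L a : ℝ} {x h e : F}, 0 ≤ ℓ → 0 < L →
      z ≤ bowl β ℓ L a → z x = bowl β ℓ L a x → radialExcess ℓ x ≤ L → ‖e‖ = 1 →
      x = ‖x‖ • e → ‖h‖ ≤ L → inner ℝ e h ≠ 0 →
      flux p (z (x + h) - z x) + flux p (z (x - h) - z x) ≤
        C * L ^ (-p) * (‖h‖ ^ p + |inner ℝ e h| ^ (p - 2) * ‖h‖ ^ 2) := by
  obtain ⟨C, hC, hunit⟩ := exists_flux_add_flux_le_of_touches_unit_bowl (F := F) hp hβ hβp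
  refine ⟨C, hC, fun {z ℓ L a x h e} hℓ hL hz hzx hxL he hx hh hi => ?_⟩
  obtain ⟨x, rfl⟩ : ∃ x', x = L • x' := ⟨L⁻¹ • x, (smul_inv_smul₀ hL.ne' x).symm⟩
  obtain ⟨h, rfl⟩ : ∃ h', h = L • h' := ⟨L⁻¹ • h, (smul_inv_smul₀ hL.ne' h).symm⟩
  rw [radialExcess_smul hL, mul_le_iff_le_one_right hL] at hxL
  rw [norm_smul, Real.norm_of_nonneg hL.le, mul_le_iff_le_one_right hL] at hh
  rw [norm_smul, Real.norm_of_nonneg hL.le, mul_smul, smul_right_inj hL.ne'] at hx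
  rw [inner_smul_right_eq_smul, smul_eq_mul] at hi ⊢
  have hz_unit : (fun y => z (L • y)) ≤ bowl β (ℓ / L) 1 a := fun y =>
    (hz (L • y)).trans_eq (bowl_smul hL β ℓ a y)
  have hscaled := hunit (by positivity) hz_unit (hzx.trans (bowl_smul hL β ℓ a x)) hxL he hx hh
    (right_ne_zero_of_mul hi)
  rw [smul_add, smul_sub] at hscaled
  refine hscaled.trans_eq ?_
  have hLp : L ^ (-p) * L ^ p = 1 := by rw [← Real.rpow_add hL, neg_add_cancel, Real.rpow_zero]
  have hLp2 : L ^ (-p) * (L ^ (p - 2) * L ^ 2) = 1 := by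
    rw [← Real.rpow_natCast, ← Real.rpow_add hL, ← Real.rpow_add hL]
    norm_num
  rw [norm_smul, Real.norm_of_nonneg hL.le, abs_mul, abs_of_pos hL,
    Real.mul_rpow hL.le (norm_nonneg _), Real.mul_rpow hL.le (abs_nonneg _), mul_pow]
  linear_combination -C * ‖h‖ ^ p * hLp - C * |inner ℝ e h| ^ (p - 2) * ‖h‖ ^ 2 * hLp2

end Contact

lemma exists_setIntegral_ball_kernel_le {n : ℕ} (hn : 1 ≤ n) {p : ℝ} (hp : 1 < p) :
    ∃ C : ℝ, 0 < C ∧ ∀ e : E n, ‖e‖ = 1 → ∀ a L : ℝ, 0 < a → 0 ≤ L →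
      IntegrableOn (fun h => ‖h‖ ^ (a - n) + |inner ℝ e h| ^ (p - 2) * ‖h‖ ^ (a - n - (p - 2)))
        (Metric.ball 0 L) ∧
      ∫ h in Metric.ball 0 L,
        (‖h‖ ^ (a - n) + |inner ℝ e h| ^ (p - 2) * ‖h‖ ^ (a - n - (p - 2))) ≤ C * (L ^ a / a) := by
  obtain ⟨C₁, hC₁, hradial⟩ :=
    exists_setIntegral_ball_abs_inner_rpow_le hn (b := 0) (by norm_num)
  obtain ⟨C₂, hC₂, hinner⟩ :=
    exists_setIntegral_ball_abs_inner_rpow_le hn (b := p - 2) (by linarith)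
  refine ⟨C₁ + C₂, by positivity, fun e he a L ha hL => ?_⟩
  obtain ⟨hint₁, hle₁⟩ := hradial e he a L ha hL
  obtain ⟨hint₂, hle₂⟩ := hinner e he a L ha hL
  simp only [Real.rpow_zero, one_mul, sub_zero] at hint₁ hle₁
  refine ⟨hint₁.add hint₂, ?_⟩
  rw [integral_add hint₁ hint₂]
  linarith

lemma truncKernel_mul_le_of_le {n : ℕ} {s p η D K : ℝ} {e h : E n} (hh : h ≠ 0) (hK : 0 ≤ K)
    (hD : D ≤ K * (‖h‖ ^ p + |inner ℝ e h| ^ (p - 2) * ‖h‖ ^ 2)) :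
    truncKernel s p η h * D ≤ K * (‖h‖ ^ (p * (1 - s) - n) +
      |inner ℝ e h| ^ (p - 2) * ‖h‖ ^ (p * (1 - s) - n - (p - 2))) := by
  have hh0 : 0 < ‖h‖ := norm_pos_iff.2 hh
  have hp : ‖h‖ ^ (p * (1 - s) - n) = ‖h‖ ^ (-((n : ℝ) + s * p)) * ‖h‖ ^ p := by
    rw [← Real.rpow_add hh0]
    ring_nf
  have htwo : ‖h‖ ^ (p * (1 - s) - n - (p - 2)) = ‖h‖ ^ (-((n : ℝ) + s * p)) * ‖h‖ ^ 2 := by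
    rw [← Real.rpow_natCast, ← Real.rpow_add hh0]
    push_cast
    ring_nf
  calc truncKernel s p η h * D
      ≤ truncKernel s p η h * (K * (‖h‖ ^ p + |inner ℝ e h| ^ (p - 2) * ‖h‖ ^ 2)) :=
        mul_le_mul_of_nonneg_left hD (truncKernel_nonneg s p η h)
    _ ≤ (‖h‖ ^ ((n : ℝ) + s * p))⁻¹ *
          (K * (‖h‖ ^ p + |inner ℝ e h| ^ (p - 2) * ‖h‖ ^ 2)) := by
        gcongr
        exact truncKernel_le s p η h
    _ = _ := by
        rw [← Real.rpow_neg hh0.le, hp, htwo]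
        ring

lemma exists_unit_vector_eq_norm_smul {n : ℕ} (hn : 1 ≤ n) (x : E n) :
    ∃ e : E n, ‖e‖ = 1 ∧ x = ‖x‖ • e := by
  rcases eq_or_ne x 0 with rfl | hx
  · exact ⟨EuclideanSpace.single ⟨0, hn⟩ 1, by simp, by simp⟩
  · exact ⟨‖x‖⁻¹ • x, norm_smul_inv_norm (𝕜 := ℝ) hx,
      (smul_inv_smul₀ (norm_ne_zero_iff.2 hx) x).symm⟩

lemma abs_flux_sub_le {p a b u v : ℝ} (hp : 1 < p) (hu : u ∈ Icc a b) (hv : v ∈ Icc a b) :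
    |flux p (u - v)| ≤ (b - a) ^ (p - 1) := by
  rw [abs_flux hp.ne']
  exact Real.rpow_le_rpow (abs_nonneg _) (Real.dist_le_of_mem_Icc hu hv) (by linarith)

lemma exists_two_mul_integral_truncKernel_mul_flux_le {n : ℕ} (hn : 1 ≤ n) {p β : ℝ} (hp : 1 < p)
    (hβ : 2 ≤ β) (hβp : p ≤ β * (p - 1)) :
    ∃ C : ℝ, 0 < C ∧ ∀ {s L ℓ a η : ℝ}, 0 < s * p → s < 1 → 0 < L → 0 ≤ ℓ → 0 < η →
      ∀ {z : E n → ℝ}, Measurable z → (∀ y, z y ∈ Icc 0 2) → z ≤ bowl β ℓ L a →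
      ∀ x, z x = bowl β ℓ L a x → radialExcess ℓ x ≤ L →
      2 * ∫ y, truncKernel s p η (x - y) * flux p (z y - z x) ≤
        C * (L ^ (-p) * (L ^ (p * (1 - s)) / (p * (1 - s))) + L ^ (-(s * p)) / (s * p)) := by
  have : Nonempty (Fin n) := ⟨⟨0, hn⟩⟩
  obtain ⟨C₁, hC₁, hflux⟩ := exists_flux_add_flux_le_of_touches_bowl (F := E n) hp hβ hβp
  obtain ⟨C₂, hC₂, hnear⟩ := exists_setIntegral_ball_kernel_le hn hp
  let C₃ := (volume : Measure (E n)).toSphere.real univ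
  have : 0 ≤ C₃ := measureReal_nonneg
  refine ⟨C₁ * C₂ + 2 * 2 ^ (p - 1) * C₃, by positivity, ?_⟩
  intro s L ℓ a η hsp hs hL hℓ hη z hzm hz hzb x hx hxL
  obtain ⟨e, he, hxe⟩ := exists_unit_vector_eq_norm_smul hn x
  have hq : 0 < p * (1 - s) := mul_pos (by linarith) (by linarith)
  have hfluxle (y : E n) : |flux p (z y - z x)| ≤ 2 ^ (p - 1) := by
    simpa only [sub_zero] using abs_flux_sub_le hp (hz y) (hz x)
  obtain ⟨hint, hsymm⟩ := two_mul_integral_truncKernel_mul (s := s) (p := p) hn hsp hη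
    (by fun_prop : Measurable fun y => flux p (z y - z x)) hfluxle x
  obtain ⟨hnear_int, hnear_le⟩ := hnear e he _ L hq hL.le
  obtain ⟨hfar_int, hfar_le⟩ :=
    integrableOn_compl_ball_norm_rpow (volume : Measure (E n)) hsp hL
  rw [finrank_euclideanSpace_fin] at hfar_int hfar_le
  have hne : ∀ᵐ h : E n, inner ℝ e h ≠ 0 := ae_inner_ne_zero (norm_ne_zero_iff.1 (by simp [he]))
  have hnear_bound := setIntegral_mono_on_ae hint.integrableOn
    (hnear_int.const_mul (C₁ * L ^ (-p))) measurableSet_ball (by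
      filter_upwards [hne] with h hi hh
      exact truncKernel_mul_le_of_le (by rintro rfl; simp at hi) (by positivity)
        (hflux hℓ hL hzb hx hxL he hxe (mem_ball_zero_iff.1 hh).le hi))
  have hfar_bound := setIntegral_mono_on hint.integrableOn
    (hfar_int.const_mul (2 * 2 ^ (p - 1))) measurableSet_ball.compl fun h _ => by
      have hplus := (abs_le.1 (hfluxle (x + h))).2
      have hminus := (abs_le.1 (hfluxle (x - h))).2
      rw [mul_comm, Real.rpow_neg (norm_nonneg h)]
      exact mul_le_mul (by linarith) (truncKernel_le s p η h) (truncKernel_nonneg s p η h)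
        (by positivity)
  rw [integral_const_mul] at hnear_bound hfar_bound
  have hnear' := hnear_bound.trans (mul_le_mul_of_nonneg_left hnear_le (by positivity))
  have hfar' := hfar_bound.trans (mul_le_mul_of_nonneg_left hfar_le (by positivity))
  rw [hsymm, ← integral_add_compl (measurableSet_ball (x := (0 : E n)) (ε := L)) hint]
  refine (add_le_add hnear' hfar').trans ?_
  have h₁ : 0 ≤ C₁ * C₂ * (L ^ (-(s * p)) / (s * p)) := by positivity
  have h₂ : 0 ≤ 2 * 2 ^ (p - 1) * C₃ * (L ^ (-p) * (L ^ (p * (1 - s)) / (p * (1 - s)))) := by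
    positivity
  linarith

lemma exists_integral_truncKernel_mul_flux_le {n : ℕ} (hn : 1 ≤ n) {p β : ℝ} (hp : 1 < p)
    (hβ : 2 ≤ β) (hβp : p ≤ β * (p - 1)) :
    ∃ C : ℝ, 0 < C ∧ ∀ {s L ℓ a η : ℝ}, 1 < s * p → s < 1 → 0 < L → 0 ≤ ℓ → 0 < η →
      ∀ {z : E n → ℝ}, Measurable z → (∀ y, z y ∈ Icc 0 2) → z ≤ bowl β ℓ L a →
      ∀ x, z x = bowl β ℓ L a x → radialExcess ℓ x ≤ L →
      (1 - s) * ∫ y, truncKernel s p η (x - y) * flux p (z y - z x) ≤ C * L ^ (-(s * p)) := by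
  obtain ⟨C, hC, hbound⟩ := exists_two_mul_integral_truncKernel_mul_flux_le hn hp hβ hβp
  refine ⟨C, hC, ?_⟩
  intro s L ℓ a η hsp hs hL hℓ hη z hzm hz hzb x hx hxL
  have hle := hbound (by linarith) hs hL hℓ hη hzm hz hzb x hx hxL
  have hs1 : 0 < 1 - s := by linarith
  have hs0 : 0 < s := by nlinarith
  have hX : 0 < L ^ (-(s * p)) := by positivity
  have hnear : (1 - s) * (L ^ (-p) * (L ^ (p * (1 - s)) / (p * (1 - s)))) ≤ L ^ (-(s * p)) := by
    rw [show -(s * p) = -p + p * (1 - s) by ring, Real.rpow_add hL]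
    calc (1 - s) * (L ^ (-p) * (L ^ (p * (1 - s)) / (p * (1 - s))))
        = L ^ (-p) * L ^ (p * (1 - s)) / p := by field_simp
      _ ≤ _ := div_le_self (by positivity) hp.le
  have hfar : (1 - s) * (L ^ (-(s * p)) / (s * p)) ≤ L ^ (-(s * p)) :=
    (mul_le_of_le_one_left (by positivity) (by linarith)).trans (div_le_self hX.le hsp.le)
  have hscaled := mul_le_mul_of_nonneg_left hle hs1.le
  have hnear' := mul_le_mul_of_nonneg_left hnear hC.le
  have hfar' := mul_le_mul_of_nonneg_left hfar hC.le
  linarith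

/-! ### First variation of the truncated kinetic energy -/

section FirstVariation

variable {X : Type*}

/-- The weight `1/2` on `Ω` and `1` off `Ω`, which turns the two interaction terms of the kinetic
energy into a single integral over `Ω × ℝⁿ`. -/
def halfWeight (Ω : Set X) (y : X) : ℝ := 1 - Ω.indicator (fun _ => 1 / 2) y

lemma halfWeight_of_mem {Ω : Set X} {y : X} (hy : y ∈ Ω) : halfWeight Ω y = 1 / 2 := by
  rw [halfWeight, indicator_of_mem hy]
  norm_num

lemma halfWeight_of_notMem {Ω : Set X} {y : X} (hy : y ∉ Ω) : halfWeight Ω y = 1 := by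
  rw [halfWeight, indicator_of_notMem hy, sub_zero]

lemma halfWeight_mem_Icc (Ω : Set X) (y : X) : halfWeight Ω y ∈ Icc 0 1 := by
  by_cases hy : y ∈ Ω
  · norm_num [halfWeight_of_mem hy]
  · norm_num [halfWeight_of_notMem hy]

variable [MeasurableSpace X] {μ : Measure X}

lemma integral_prod_eq_zero_of_antisymm [SFinite μ] {f : X × X → ℝ}
    (hf : ∀ z, f z.swap = -f z) : ∫ z, f z ∂(μ.prod μ) = 0 := by
  have hswap := integral_prod_swap (μ := μ) (ν := μ) f
  simp only [hf, integral_neg] at hswap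
  linarith

lemma ofReal_integral_le_lintegral_ofReal {f : X → ℝ} (hf : Integrable f μ) :
    ENNReal.ofReal (∫ x, f x ∂μ) ≤ ∫⁻ x, ENNReal.ofReal (f x) ∂μ := by
  rw [integral_eq_lintegral_pos_part_sub_lintegral_neg_part hf]
  exact (ENNReal.ofReal_le_ofReal (sub_le_self _ ENNReal.toReal_nonneg)).trans
    ENNReal.ofReal_toReal_le

lemma measurable_halfWeight {Ω : Set X} (hΩ : MeasurableSet Ω) : Measurable (halfWeight Ω) :=
  measurable_const.sub (measurable_const.indicator hΩ)

lemma integral_halfWeight_mul_sub [SFinite μ] {Ω : Set X} (hΩ : MeasurableSet Ω) {A : X × X → ℝ}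
    (hA : Integrable A ((μ.restrict Ω).prod μ)) (hAanti : ∀ z, A z.swap = -A z) {φ : X → ℝ} {M : ℝ}
    (hφ : Measurable φ) (hφM : ∀ x, |φ x| ≤ M) (hφ0 : ∀ x, x ∉ Ω → φ x = 0) :
    Integrable (fun z : X × X => halfWeight Ω z.2 * (A z * (φ z.1 - φ z.2)))
        ((μ.restrict Ω).prod μ) ∧
      Integrable (fun x => φ x * ∫ y, A (x, y) ∂μ) (μ.restrict Ω) ∧
      ∫ z : X × X, halfWeight Ω z.2 * (A z * (φ z.1 - φ z.2)) ∂((μ.restrict Ω).prod μ) =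
        ∫ x in Ω, φ x * (∫ y, A (x, y) ∂μ) ∂μ := by
  let S : Set (X × X) := univ ×ˢ Ω
  have hS : MeasurableSet S := MeasurableSet.univ.prod hΩ
  have hfst : Integrable (fun z => A z * φ z.1) ((μ.restrict Ω).prod μ) :=
    hA.mul_bdd (c := M) (by fun_prop : Measurable _).aestronglyMeasurable
      (ae_of_all _ fun z => hφM z.1)
  have hsnd : Integrable (fun z => A z * φ z.2) ((μ.restrict Ω).prod μ) :=
    hA.mul_bdd (c := M) (by fun_prop : Measurable _).aestronglyMeasurable
      (ae_of_all _ fun z => hφM z.2)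
  have hsymm : Integrable (S.indicator fun z => A z * φ z.1 + A z * φ z.2)
      ((μ.restrict Ω).prod μ) := (hfst.add hsnd).indicator hS
  -- On `Ω × Ω` the part of the integrand that is symmetric in `φ` is antisymmetric in `z`.
  have hsplit (z : X × X) : halfWeight Ω z.2 * (A z * (φ z.1 - φ z.2)) =
      A z * φ z.1 - 1 / 2 * S.indicator (fun z => A z * φ z.1 + A z * φ z.2) z := by
    by_cases hz : z.2 ∈ Ω
    · rw [halfWeight_of_mem hz, indicator_of_mem (by simpa [S] using hz)]
      ring
    · rw [halfWeight_of_notMem hz, indicator_of_notMem (by simpa [S] using hz), hφ0 _ hz]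
      ring
  have hsymm_zero : ∫ z, S.indicator (fun z => A z * φ z.1 + A z * φ z.2) z
      ∂((μ.restrict Ω).prod μ) = 0 := by
    have hμ : ((μ.restrict Ω).prod μ).restrict S = (μ.restrict Ω).prod (μ.restrict Ω) := by
      rw [← Measure.prod_restrict, Measure.restrict_univ]
    rw [integral_indicator hS, hμ]
    refine integral_prod_eq_zero_of_antisymm fun z => ?_
    rw [hAanti, Prod.fst_swap, Prod.snd_swap]
    ring
  have hpull (x : X) : ∫ y, A (x, y) * φ x ∂μ = φ x * ∫ y, A (x, y) ∂μ := by
    rw [integral_mul_const, mul_comm]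
  have hleft := hfst.integral_prod_left
  simp only [hsplit, hpull] at hleft ⊢
  refine ⟨hfst.sub (hsymm.const_mul _), hleft, ?_⟩
  rw [integral_sub hfst (hsymm.const_mul _), integral_const_mul, hsymm_zero, mul_zero, sub_zero,
    integral_prod _ hfst]
  simp only [hpull]

end FirstVariation

/-! ### The kinetic energy of a minimum -/

lemma kinetic_eq_lintegral_prod {n : ℕ} {s p : ℝ} {Ω : Set (E n)} (hΩ : MeasurableSet Ω)
    {u : E n → ℝ} (hu : Measurable u) :
    kinetic s p u Ω = ∫⁻ z : E n × E n, ENNReal.ofReal (halfWeight Ω z.2 *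
      (|u z.1 - u z.2| ^ p / ‖z.1 - z.2‖ ^ ((n : ℝ) + s * p)))
        ∂((volume.restrict Ω).prod volume) := by
  have hw := measurable_halfWeight hΩ
  have hinner : Measurable fun x : E n =>
      ∫⁻ y in Ω, ENNReal.ofReal (|u x - u y| ^ p / ‖x - y‖ ^ ((n : ℝ) + s * p)) :=
    Measurable.lintegral_prod_right' (f := fun z : E n × E n =>
      ENNReal.ofReal (|u z.1 - u z.2| ^ p / ‖z.1 - z.2‖ ^ ((n : ℝ) + s * p))) (by fun_prop)
  rw [lintegral_prod _ (by fun_prop), kinetic, interaction, interaction,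
    ← lintegral_const_mul _ hinner, ← lintegral_add_left (hinner.const_mul _)]
  refine lintegral_congr fun x => ?_
  conv_rhs => rw [← lintegral_add_compl _ hΩ]
  rw [← lintegral_const_mul' _ _ (by simp)]
  congr 1
  · refine setLIntegral_congr_fun hΩ fun y hy => ?_
    simp only [halfWeight_of_mem hy]
    rw [ENNReal.ofReal_mul (by norm_num), ENNReal.ofReal_div_of_pos two_pos]
    simp
  · refine setLIntegral_congr_fun hΩ.compl fun y hy => ?_
    simp only [halfWeight_of_notMem hy, one_mul]

lemma integrable_truncKernel_prod {n : ℕ} (hn : 1 ≤ n) {s p η : ℝ} (hsp : 0 < s * p) (hη : 0 < η)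
    (μ : Measure (E n)) [IsFiniteMeasure μ] :
    Integrable (fun z : E n × E n => truncKernel s p η (z.1 - z.2)) (μ.prod volume) := by
  have hk := integrable_truncKernel hn (n := n) hsp hη
  rw [integrable_prod_iff (by fun_prop : Measurable fun z : E n × E n =>
    truncKernel s p η (z.1 - z.2)).aestronglyMeasurable]
  refine ⟨ae_of_all _ fun x => hk.comp_sub_left x, ?_⟩
  simp_rw [integral_sub_left_eq_self (fun y => ‖truncKernel s p η y‖)]
  exact integrable_const _

/-- The integrand of the kinetic energy over `Ω × ℝⁿ`, with the kernel cut off at distance `η`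
from the diagonal. -/
def truncDensity {n : ℕ} (s p η : ℝ) (Ω : Set (E n)) (u : E n → ℝ) (z : E n × E n) : ℝ :=
  halfWeight Ω z.2 * (truncKernel s p η (z.1 - z.2) * |u z.1 - u z.2| ^ p)

section TruncDensity

variable {n : ℕ} {s p η : ℝ} {Ω : Set (E n)} {u w : E n → ℝ}

lemma truncDensity_nonneg (z : E n × E n) : 0 ≤ truncDensity s p η Ω u z :=
  mul_nonneg (halfWeight_mem_Icc Ω z.2).1
    (mul_nonneg (truncKernel_nonneg s p η _) (by positivity))

lemma measurable_truncDensity (hΩ : MeasurableSet Ω) (hu : Measurable u) :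
    Measurable (truncDensity s p η Ω u) := by
  have := measurable_halfWeight hΩ
  unfold truncDensity
  fun_prop

lemma integrable_truncDensity (hn : 1 ≤ n) (hp : 1 < p) (hsp : 0 < s * p) (hη : 0 < η)
    (hΩ : MeasurableSet Ω) (hΩf : volume Ω ≠ ⊤) (hu : Measurable u) (hu1 : ∀ x, u x ∈ Icc (-1) 1) :
    Integrable (truncDensity s p η Ω u) ((volume.restrict Ω).prod volume) := by
  have : IsFiniteMeasure ((volume : Measure (E n)).restrict Ω) := isFiniteMeasure_restrict.2 hΩf
  have hhalf := measurable_halfWeight hΩ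
  have hdiff (z : E n × E n) : |u z.1 - u z.2| ≤ 1 - -1 := Real.dist_le_of_mem_Icc (hu1 _) (hu1 _)
  refine ((integrable_truncKernel_prod hn hsp hη (volume.restrict Ω)).mul_bdd
    (g := fun z : E n × E n => halfWeight Ω z.2 * |u z.1 - u z.2| ^ p) (c := 1 * (1 - -1) ^ p)
    (by fun_prop) (ae_of_all _ fun z => ?_)).congr (ae_of_all _ fun z => ?_)
  · obtain ⟨h0, h1⟩ := halfWeight_mem_Icc Ω z.2
    rw [Real.norm_of_nonneg (by positivity)]
    gcongr
    exact hdiff z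
  · rw [truncDensity]
    ring

lemma truncDensity_le (z : E n × E n) : truncDensity s p η Ω u z ≤ halfWeight Ω z.2 *
    (|u z.1 - u z.2| ^ p / ‖z.1 - z.2‖ ^ ((n : ℝ) + s * p)) := by
  rw [truncDensity, div_eq_inv_mul]
  gcongr
  · exact (halfWeight_mem_Icc Ω z.2).1
  · exact truncKernel_le s p η _

lemma antitone_truncDensity (z : E n × E n) : Antitone fun η => truncDensity s p η Ω u z := by
  intro η η' h
  refine mul_le_mul_of_nonneg_left (mul_le_mul_of_nonneg_right ?_ (by positivity))
    (halfWeight_mem_Icc Ω z.2).1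
  exact indicator_le_indicator_of_subset (fun _ hh => h.trans_lt hh) (fun _ => by positivity) _

lemma kinetic_le_iSup_lintegral_truncDensity (hp : p ≠ 0) (hΩ : MeasurableSet Ω)
    (hu : Measurable u) :
    kinetic s p u Ω ≤ ⨆ N : ℕ, ∫⁻ z, ENNReal.ofReal (truncDensity s p (1 / (N + 1)) Ω u z)
      ∂((volume.restrict Ω).prod volume) := by
  rw [kinetic_eq_lintegral_prod hΩ hu, ← lintegral_iSup
    (fun N => (measurable_truncDensity hΩ hu).ennreal_ofReal) fun N N' hN z =>
      ENNReal.ofReal_le_ofReal (antitone_truncDensity z (Nat.one_div_le_one_div hN))]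
  refine lintegral_mono fun z => ?_
  rcases eq_or_ne z.1 z.2 with hz | hz
  · simp [hz, Real.zero_rpow hp]
  · obtain ⟨N, hN⟩ := exists_nat_one_div_lt (norm_pos_iff.2 (sub_ne_zero.2 hz))
    refine le_iSup_of_le N (le_of_eq ?_)
    rw [truncDensity, truncKernel, indicator_of_mem (by exact hN), div_eq_inv_mul]

lemma lintegral_truncDensity_le_kinetic (hΩ : MeasurableSet Ω) (hu : Measurable u) :
    ∫⁻ z, ENNReal.ofReal (truncDensity s p η Ω u z) ∂((volume.restrict Ω).prod volume) ≤
      kinetic s p u Ω := by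
  rw [kinetic_eq_lintegral_prod hΩ hu]
  exact lintegral_mono fun z => ENNReal.ofReal_le_ofReal (truncDensity_le z)

lemma truncDensity_min_le (hp : 1 < p) (z : E n × E n) :
    truncDensity s p η Ω (fun x => min (u x) (w x)) z ≤ truncDensity s p η Ω u z +
      p * (halfWeight Ω z.2 * (truncKernel s p η (z.1 - z.2) * flux p (w z.2 - w z.1) *
        ((u z.1 - min (u z.1) (w z.1)) - (u z.2 - min (u z.2) (w z.2))))) := by
  have h := mul_le_mul_of_nonneg_left (abs_sub_min_rpow_le hp (u z.1) (u z.2) (w z.1) (w z.2))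
    (mul_nonneg (halfWeight_mem_Icc Ω z.2).1 (truncKernel_nonneg s p η (z.1 - z.2)))
  unfold truncDensity
  linarith

lemma lintegral_truncDensity_min_le (hn : 1 ≤ n) (hp : 1 < p) (hsp : 0 < s * p) (hη : 0 < η)
    (hΩ : MeasurableSet Ω) (hΩf : volume Ω ≠ ⊤) (hu : Measurable u) (hw : Measurable w)
    (hu1 : ∀ x, u x ∈ Icc (-1) 1) (hw1 : ∀ x, w x ∈ Icc (-1) 1) (hwΩ : ∀ x, x ∉ Ω → w x = 1) :
    ∫⁻ z, ENNReal.ofReal (truncDensity s p η Ω (fun x => min (u x) (w x)) z)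
        ∂((volume.restrict Ω).prod volume) ≤
      ∫⁻ z, ENNReal.ofReal (truncDensity s p η Ω u z) ∂((volume.restrict Ω).prod volume) +
        ∫⁻ x in Ω, ENNReal.ofReal (p * ((u x - min (u x) (w x)) *
          ∫ y, truncKernel s p η (x - y) * flux p (w y - w x))) := by
  have : IsFiniteMeasure ((volume : Measure (E n)).restrict Ω) := isFiniteMeasure_restrict.2 hΩf
  let φ (x : E n) : ℝ := u x - min (u x) (w x)
  let A (z : E n × E n) : ℝ := truncKernel s p η (z.1 - z.2) * flux p (w z.2 - w z.1)
  have hmin1 (x : E n) : min (u x) (w x) ∈ Icc (-1) 1 :=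
    ⟨le_min (hu1 x).1 (hw1 x).1, (min_le_left _ _).trans (hu1 x).2⟩
  have hA : Integrable A ((volume.restrict Ω).prod volume) :=
    (integrable_truncKernel_prod hn hsp hη (volume.restrict Ω)).mul_bdd
      (c := (1 - -1) ^ (p - 1)) (by fun_prop : Measurable _).aestronglyMeasurable
      (ae_of_all _ fun z => abs_flux_sub_le hp (hw1 z.2) (hw1 z.1))
  have hAanti (z : E n × E n) : A z.swap = -A z := by
    simp only [A, Prod.fst_swap, Prod.snd_swap]
    rw [← neg_sub z.1 z.2, truncKernel_neg, ← neg_sub (w z.2), flux_neg, mul_neg]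
  obtain ⟨hvar_int, hright_int, hvar⟩ := integral_halfWeight_mul_sub hΩ hA hAanti
    (φ := φ) (M := 1 - -1) (by fun_prop) (fun x => Real.dist_le_of_mem_Icc (hu1 x) (hmin1 x))
    fun x hx => sub_eq_zero.2 (min_eq_left ((hu1 x).2.trans_eq (hwΩ x hx).symm)).symm
  have hu_int := integrable_truncDensity hn hp hsp hη hΩ hΩf hu hu1
  have hmin_int := integrable_truncDensity hn hp hsp hη hΩ hΩf (hu.min hw) hmin1
  rw [← ofReal_integral_eq_lintegral_ofReal hmin_int (ae_of_all _ truncDensity_nonneg),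
    ← ofReal_integral_eq_lintegral_ofReal hu_int (ae_of_all _ truncDensity_nonneg)]
  calc _ ≤ ENNReal.ofReal (∫ z, (truncDensity s p η Ω u z +
          p * (halfWeight Ω z.2 * (A z * (φ z.1 - φ z.2))))
            ∂((volume.restrict Ω).prod volume)) :=
        ENNReal.ofReal_le_ofReal (integral_mono hmin_int (hu_int.add (hvar_int.const_mul p))
          (truncDensity_min_le hp))
    _ ≤ _ := by
        rw [integral_add hu_int (hvar_int.const_mul p), integral_const_mul, hvar,
          ← integral_const_mul]
        refine ENNReal.ofReal_add_le.trans (add_le_add_right ?_ _)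
        exact ofReal_integral_le_lintegral_ofReal (hright_int.const_mul p)

lemma kinetic_min_le (hn : 1 ≤ n) (hp : 1 < p) (hsp : 0 < s * p) (hΩ : MeasurableSet Ω)
    (hΩf : volume Ω ≠ ⊤) (hu : Measurable u) (hw : Measurable w) (hu1 : ∀ x, u x ∈ Icc (-1) 1)
    (hw1 : ∀ x, w x ∈ Icc (-1) 1) (hwΩ : ∀ x, x ∉ Ω → w x = 1) {H : E n → ℝ}
    (hH : ∀ η > 0, ∀ x, w x < 1 → ∫ y, truncKernel s p η (x - y) * flux p (w y - w x) ≤ H x) :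
    kinetic s p (fun x => min (u x) (w x)) Ω ≤ kinetic s p u Ω +
      ∫⁻ x in Ω, ENNReal.ofReal (p * ((u x - min (u x) (w x)) * H x)) := by
  refine (kinetic_le_iSup_lintegral_truncDensity (by linarith) hΩ (hu.min hw)).trans
    (iSup_le fun N => ?_)
  refine (lintegral_truncDensity_min_le hn hp hsp Nat.one_div_pos_of_nat hΩ hΩf hu hw hu1 hw1
    hwΩ).trans (add_le_add (lintegral_truncDensity_le_kinetic hΩ hu)
      (lintegral_mono fun x => ENNReal.ofReal_le_ofReal ?_))
  rcases lt_or_ge (w x) 1 with hx | hx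
  · gcongr
    · exact sub_nonneg.2 (min_le_left _ _)
    · exact hH _ Nat.one_div_pos_of_nat x hx
  · simp [min_eq_left ((hu1 x).2.trans hx)]

end TruncDensity

section Congr

variable {n : ℕ} {W : ℝ → ℝ} {s p ε : ℝ} {Ω : Set (E n)} {u u' : E n → ℝ}

lemma interaction_congr_ae (h : u =ᵐ[volume] u') (A B : Set (E n)) :
    interaction s p u A B = interaction s p u' A B := by
  refine lintegral_congr_ae (ae_restrict_of_ae (h.mono fun x hx =>
    lintegral_congr_ae (ae_restrict_of_ae (h.mono fun y hy => ?_))))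
  simp only [hx, hy]

lemma kinetic_congr_ae (h : u =ᵐ[volume] u') (Ω : Set (E n)) :
    kinetic s p u Ω = kinetic s p u' Ω := by
  rw [kinetic, kinetic, interaction_congr_ae h, interaction_congr_ae h]

lemma energy_congr_ae (h : u =ᵐ[volume] u') (Ω : Set (E n)) :
    energy W s p u Ω = energy W s p u' Ω := by
  rw [energy, energy, kinetic_congr_ae h]
  congr 1
  exact lintegral_congr_ae (ae_restrict_of_ae (h.mono fun x hx => by simp only [hx]))

lemma MinimizesUpTo.congr_ae (hu : MinimizesUpTo W s p ε Ω u) (h : u =ᵐ[volume] u') :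
    MinimizesUpTo W s p ε Ω u' := by
  refine ⟨⟨hu.1.aemeasurable.congr h, kinetic_congr_ae h Ω ▸ hu.1.kinetic_lt_top, ?_⟩,
    fun v hv => energy_congr_ae h Ω ▸ hu.2 v ⟨hv.1, ?_⟩⟩
  · filter_upwards [hu.1.bound, h] with x hx hxu using hxu ▸ hx
  · filter_upwards [hv.2, h] with x hx hxu hxΩ using (hx hxΩ).trans hxu.symm

lemma MemX.exists_measurable_rep (hu : MemX s p Ω u) :
    ∃ u' : E n → ℝ, Measurable u' ∧ (∀ x, u' x ∈ Icc (-1) 1) ∧ u =ᵐ[volume] u' := by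
  refine ⟨fun x => max (-1) (min 1 (hu.aemeasurable.mk u x)),
    measurable_const.max (measurable_const.min hu.aemeasurable.measurable_mk),
    fun x => ⟨le_max_left _ _, max_le (by norm_num) (min_le_left _ _)⟩, ?_⟩
  filter_upwards [hu.bound, hu.aemeasurable.ae_eq_mk] with x hux hmk
  rw [← hmk, min_eq_right (abs_le.1 hux).2, max_eq_right (abs_le.1 hux).1]

end Congr

/-! ### Comparison with a barrier -/

namespace IsPotential

variable {W : ℝ → ℝ} {m lam Lam θ q c₁ : ℝ}

lemma nonneg (hW : IsPotential W m lam Lam θ q c₁) {x : ℝ} (hx : x ∈ Icc (-1 : ℝ) 1) :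
    0 ≤ W x := by
  have := hW.lam_pos
  exact (indicator_nonneg (fun _ _ => by positivity) _).trans (hW.lower x hx)

lemma measurable_comp (hW : IsPotential W m lam Lam θ q c₁) {α : Type*} [MeasurableSpace α]
    {u : α → ℝ} (hu : Measurable u) (hu1 : ∀ x, u x ∈ Icc (-1 : ℝ) 1) :
    Measurable (fun x => W (u x)) :=
  (lowerSemicontinuous_restrict_iff.2 hW.lsc).measurable.comp (hu.subtype_mk (h := hu1))

lemma min_add_le_of_le (hW : IsPotential W m lam Lam θ q c₁) (hm : 1 ≤ m) {t ζ : ℝ}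
    (htq : t ≤ -1 + q) (hζ : 0 < ζ) :
    W (min t (ζ - 1)) + c₁ * (t - min t (ζ - 1)) * ζ ^ (m - 1) +
      c₁ * (t - min t (ζ - 1)) ^ ⌈m⌉₊ ≤ W t := by
  rcases le_total t (ζ - 1) with h | h
  · have : ⌈m⌉₊ ≠ 0 := (Nat.ceil_pos.2 (by linarith)).ne'
    simp [min_eq_left h, this]
  · have hgrowth := hW.growth (ζ - 1) t (by linarith) h htq
    rw [add_sub_cancel, abs_of_pos hζ] at hgrowth
    rw [min_eq_right h]
    linarith

lemma min_add_le (hW : IsPotential W m lam Lam θ q c₁) {t ζ : ℝ}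
    (ht : t ∈ Icc (-1 : ℝ) 1) (hζ : ζ ∈ Ioc (0 : ℝ) 2) :
    W (min t (ζ - 1)) + c₁ * (t - min t (ζ - 1)) * ζ ^ (m - 1) ≤
      W t + (2 * Lam + 2 * c₁) * ζ ^ (m - 1) := by
  have hζm : 0 < ζ ^ (m - 1) := Real.rpow_pos_of_pos hζ.1 _
  have hc₁ := hW.c₁_pos
  have hLam := hW.one_le_Lam
  rcases le_total t (ζ - 1) with h | h
  · rw [min_eq_left h, sub_self, mul_zero, zero_mul]
    gcongr
    positivity
  · have hWt := hW.nonneg ht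
    have hWζ := hW.upper (ζ - 1) ⟨by linarith [hζ.1], by linarith [hζ.2]⟩
    have hζpow : ζ ^ m ≤ 2 * ζ ^ (m - 1) := by
      rw [← sub_add_cancel m 1, Real.rpow_add_one hζ.1.ne', add_sub_cancel_right, mul_comm]
      gcongr
      exact hζ.2
    have hgap : c₁ * (t - (ζ - 1)) * ζ ^ (m - 1) ≤ c₁ * 2 * ζ ^ (m - 1) := by
      gcongr
      linarith [ht.2, hζ.1]
    rw [add_sub_cancel, abs_of_pos hζ.1] at hWζ
    rw [min_eq_right h]
    linarith [mul_le_mul_of_nonneg_left hζpow (zero_le_one.trans hLam)]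

end IsPotential

lemma setLIntegral_ofReal_ne_top {X : Type*} [MeasurableSpace X] {μ : Measure X} {A : Set X}
    (hA : μ A ≠ ⊤) {f : X → ℝ} {B : ℝ} (hf : ∀ x, f x ≤ B) :
    ∫⁻ x in A, ENNReal.ofReal (f x) ∂μ ≠ ⊤ :=
  (setLIntegral_lt_top_of_le_nnreal hA
    ⟨B.toNNReal, fun x _ => ENNReal.ofReal_le_ofReal (hf x)⟩).ne

lemma setLIntegral_ofReal_indicator {X : Type*} [MeasurableSpace X] {μ : Measure X} {A B : Set X}
    (hB : MeasurableSet B) (hBA : B ⊆ A) (f : X → ℝ) :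
    ∫⁻ x in A, ENNReal.ofReal (B.indicator f x) ∂μ = ∫⁻ x in B, ENNReal.ofReal (f x) ∂μ := by
  simp_rw [← Function.comp_apply (f := ENNReal.ofReal) (g := B.indicator f),
    ← B.indicator_comp_of_zero ENNReal.ofReal_zero, lintegral_indicator hB,
    Measure.restrict_restrict hB, inter_eq_left.2 hBA, Function.comp_apply]

section Comparison

variable {n : ℕ} {W : ℝ → ℝ} {m lam Lam θ q c₁ s p ε ϑ a₀ : ℝ} {Ω : Set (E n)} {u v z : E n → ℝ}

lemma MinimizesUpTo.lintegral_potential_le (hmin : MinimizesUpTo W s p ε Ω u) (hs : s < 1)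
    (hv : AEMeasurable v) (hv1 : ∀ᵐ x, |v x| ≤ 1) (hvu : ∀ᵐ x, x ∉ Ω → v x = u x) {Y : ENNReal}
    (hY : Y ≠ ⊤) (hkin : ENNReal.ofReal (1 - s) * kinetic s p v Ω ≤
      ENNReal.ofReal (1 - s) * kinetic s p u Ω + Y) :
    ∫⁻ x in Ω, ENNReal.ofReal (W (u x)) ≤
      ENNReal.ofReal ε + Y + ∫⁻ x in Ω, ENNReal.ofReal (W (v x)) := by
  have hku : ENNReal.ofReal (1 - s) * kinetic s p u Ω ≠ ⊤ :=
    ENNReal.mul_ne_top ENNReal.ofReal_ne_top hmin.1.kinetic_lt_top.ne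
  have hkv : kinetic s p v Ω < ⊤ := by
    refine ENNReal.lt_top_of_mul_ne_top_right (ne_top_of_le_ne_top ?_ hkin) ?_
    · exact ENNReal.add_ne_top.2 ⟨hku, hY⟩
    · simpa using hs
  refine (ENNReal.add_le_add_iff_left hku).1 ?_
  calc energy W s p u Ω ≤ ENNReal.ofReal ε + energy W s p v Ω := hmin.2 v ⟨⟨hv, hkv, hv1⟩, hvu⟩
    _ ≤ ENNReal.ofReal ε + (ENNReal.ofReal (1 - s) * kinetic s p u Ω + Y +
        ∫⁻ x in Ω, ENNReal.ofReal (W (v x))) := by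
      unfold energy; gcongr
    _ = _ := by ring

lemma ofReal_mul_kinetic_min_le (hn : 1 ≤ n) (hp : 1 < p) (hsp : 0 < s * p) (hs : s < 1)
    (hΩ : MeasurableSet Ω) (hΩf : volume Ω ≠ ⊤) (hu : Measurable u) (hu1 : ∀ x, u x ∈ Icc (-1) 1)
    (hz : Measurable z) (hz02 : ∀ x, z x ∈ Ioc 0 2) (hzΩ : ∀ x, x ∉ Ω → z x = 2)
    (hbar : ∀ η > 0, ∀ x, z x < 2 →
      (1 - s) * ∫ y, truncKernel s p η (x - y) * flux p (z y - z x) ≤ c₁ / p * z x ^ (m - 1)) :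
    ENNReal.ofReal (1 - s) * kinetic s p (fun x => min (u x) (z x - 1)) Ω ≤
      ENNReal.ofReal (1 - s) * kinetic s p u Ω +
        ∫⁻ x in Ω, ENNReal.ofReal (c₁ * (u x - min (u x) (z x - 1)) * z x ^ (m - 1)) := by
  have hs0 : 0 < 1 - s := by linarith
  refine (mul_le_mul_right (kinetic_min_le hn hp hsp hΩ hΩf hu (hz.sub_const 1) hu1
    (fun x => ⟨by linarith [(hz02 x).1], by linarith [(hz02 x).2]⟩)
    (fun x hx => by rw [hzΩ x hx]; norm_num)
    (H := fun x => c₁ / p * z x ^ (m - 1) / (1 - s)) fun η hη x hx => ?_) _).trans_eq ?_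
  · rw [le_div_iff₀ hs0, mul_comm]
    simpa only [sub_sub_sub_cancel_right] using hbar η hη x (by linarith)
  · rw [mul_add, ← lintegral_const_mul' _ _ ENNReal.ofReal_ne_top]
    congr 1
    refine lintegral_congr fun x => ?_
    rw [← ENNReal.ofReal_mul hs0.le]
    congr 1
    field_simp

/-- The part of the layer `{2a₀ ≤ 1 + u, u ≤ ϑ}` on which the barrier `z - 1` is below `u` by at
least `a₀`. -/
def layer (u z : E n → ℝ) (a₀ ϑ : ℝ) : Set (E n) := {x | z x ≤ a₀ ∧ 2 * a₀ ≤ 1 + u x ∧ u x ≤ ϑ}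

lemma measurableSet_layer (hu : Measurable u) (hz : Measurable z) (a₀ ϑ : ℝ) :
    MeasurableSet (layer u z a₀ ϑ) :=
  (measurableSet_le hz measurable_const).inter
    ((measurableSet_le measurable_const (hu.const_add 1)).inter
      (measurableSet_le hu measurable_const))

lemma layer_subset (hu1 : ∀ x, u x ≤ 1) (hzΩ : ∀ x, x ∉ Ω → z x = 2) : layer u z a₀ ϑ ⊆ Ω := by
  intro x hx
  by_contra h
  linarith [hx.1, hx.2.1, hzΩ x h, hu1 x]

lemma indicator_layer_le (hW : IsPotential W m lam Lam θ q c₁) (hm : 1 ≤ m) (ha₀ : 0 < a₀)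
    (hϑ : ϑ ≤ -1 + q) {x : E n} (hu1 : u x ∈ Icc (-1) 1) (hz02 : z x ∈ Ioc 0 2) :
    W (min (u x) (z x - 1)) + c₁ * (u x - min (u x) (z x - 1)) * z x ^ (m - 1) +
        (layer u z a₀ ϑ).indicator (fun _ => c₁ * a₀ ^ ⌈m⌉₊) x ≤
      W (u x) + {x | z x < 2 ∧ ϑ < u x}.indicator
        (fun x => (2 * Lam + 2 * c₁) * z x ^ (m - 1)) x := by
  have hc₁ := hW.c₁_pos
  by_cases huϑ : u x ≤ ϑ
  · rw [indicator_of_notMem (s := {x | z x < 2 ∧ ϑ < u x}) fun h => h.2.not_ge huϑ, add_zero]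
    refine le_trans ?_ (hW.min_add_le_of_le hm (huϑ.trans hϑ) hz02.1)
    gcongr
    refine indicator_apply_le' (fun hx => ?_) fun _ => ?_
    · gcongr
      rw [min_eq_right] <;> linarith [hx.1, hx.2.1]
    · have : 0 ≤ u x - min (u x) (z x - 1) := sub_nonneg.2 (min_le_left _ _)
      positivity
  · rw [indicator_of_notMem (s := layer u z a₀ ϑ) fun h => huϑ h.2.2, add_zero]
    rcases hz02.2.lt_or_eq with hz2 | hz2
    · rw [indicator_of_mem (s := {x | z x < 2 ∧ ϑ < u x}) ⟨hz2, not_le.1 huϑ⟩]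
      exact hW.min_add_le hu1 hz02
    · rw [min_eq_left (by linarith [hu1.2])]
      simp [hz2]

lemma lintegral_potential_add_volume_layer_le (hW : IsPotential W m lam Lam θ q c₁) (hm : 1 ≤ m)
    (ha₀ : 0 < a₀) (hϑ : ϑ ≤ -1 + q) (hu : Measurable u) (hu1 : ∀ x, u x ∈ Icc (-1) 1)
    (hz : Measurable z) (hz02 : ∀ x, z x ∈ Ioc 0 2) (hzΩ : ∀ x, x ∉ Ω → z x = 2) :
    (∫⁻ x in Ω, ENNReal.ofReal (W (min (u x) (z x - 1)))) +
        (∫⁻ x in Ω, ENNReal.ofReal (c₁ * (u x - min (u x) (z x - 1)) * z x ^ (m - 1))) +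
        ENNReal.ofReal (c₁ * a₀ ^ ⌈m⌉₊) * volume (layer u z a₀ ϑ) ≤
      (∫⁻ x in Ω, ENNReal.ofReal (W (u x))) + ENNReal.ofReal (2 * Lam + 2 * c₁) *
        ∫⁻ x in {x | z x < 2 ∧ ϑ < u x}, ENNReal.ofReal (z x ^ (m - 1)) := by
  have hc₁ := hW.c₁_pos
  have hLam : 0 < Lam := zero_lt_one.trans_le hW.one_le_Lam
  have hzm : ∀ x, 0 < z x ^ (m - 1) := fun x => Real.rpow_pos_of_pos (hz02 x).1 _
  have hgap : ∀ x, 0 ≤ u x - min (u x) (z x - 1) := fun x => sub_nonneg.2 (min_le_left _ _)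
  have hmin : ∀ x, min (u x) (z x - 1) ∈ Icc (-1) 1 := fun x =>
    ⟨le_min (hu1 x).1 (by linarith [(hz02 x).1]), (min_le_left _ _).trans (hu1 x).2⟩
  have hWmin : Measurable fun x => W (min (u x) (z x - 1)) :=
    hW.measurable_comp (hu.min (hz.sub_const 1)) hmin
  have hsum : Measurable fun x => ENNReal.ofReal (W (min (u x) (z x - 1))) +
      ENNReal.ofReal (c₁ * (u x - min (u x) (z x - 1)) * z x ^ (m - 1)) :=
    hWmin.ennreal_ofReal.add (by fun_prop)
  have hWu : Measurable fun x => W (u x) := hW.measurable_comp hu hu1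
  have hG : MeasurableSet {x | z x < 2 ∧ ϑ < u x} :=
    (measurableSet_lt hz measurable_const).inter (measurableSet_lt measurable_const hu)
  have hGΩ : {x | z x < 2 ∧ ϑ < u x} ⊆ Ω := fun x hx => by
    by_contra h
    exact hx.1.ne (hzΩ x h)
  have hlayer : ENNReal.ofReal (c₁ * a₀ ^ ⌈m⌉₊) * volume (layer u z a₀ ϑ) =
      ∫⁻ x in Ω, ENNReal.ofReal ((layer u z a₀ ϑ).indicator (fun _ => c₁ * a₀ ^ ⌈m⌉₊) x) := by
    rw [setLIntegral_ofReal_indicator (measurableSet_layer hu hz a₀ ϑ)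
      (layer_subset (fun x => (hu1 x).2) hzΩ), setLIntegral_const]
  have habove : ENNReal.ofReal (2 * Lam + 2 * c₁) *
      ∫⁻ x in {x | z x < 2 ∧ ϑ < u x}, ENNReal.ofReal (z x ^ (m - 1)) =
        ∫⁻ x in Ω, ENNReal.ofReal ({x | z x < 2 ∧ ϑ < u x}.indicator
          (fun x => (2 * Lam + 2 * c₁) * z x ^ (m - 1)) x) := by
    simp_rw [setLIntegral_ofReal_indicator hG hGΩ,
      ENNReal.ofReal_mul (by positivity : 0 ≤ 2 * Lam + 2 * c₁)]
    exact (lintegral_const_mul' _ _ ENNReal.ofReal_ne_top).symm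
  rw [hlayer, habove, ← lintegral_add_left hWmin.ennreal_ofReal,
    ← lintegral_add_left hsum, ← lintegral_add_left hWu.ennreal_ofReal]
  refine lintegral_mono fun x => ?_
  have := hzm x
  have := hgap x
  rw [← ENNReal.ofReal_add (hW.nonneg (hmin x)) (by positivity),
    ← ENNReal.ofReal_add (add_nonneg (hW.nonneg (hmin x)) (by positivity))
      (indicator_nonneg (fun _ _ => by positivity) _),
    ← ENNReal.ofReal_add (hW.nonneg (hu1 x))
      (indicator_nonneg (fun y _ => by have := hzm y; positivity) _)]
  exact ENNReal.ofReal_le_ofReal (indicator_layer_le hW hm ha₀ hϑ (hu1 x) (hz02 x))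

lemma volume_layer_le_of_measurable (hn : 1 ≤ n) (hW : IsPotential W m lam Lam θ q c₁)
    (hp : 1 < p) (hm : 1 ≤ m) (hsp : 0 < s * p) (hs : s < 1) (ha₀ : 0 < a₀) (hϑ : ϑ ≤ -1 + q)
    (hΩ : MeasurableSet Ω) (hΩf : volume Ω ≠ ⊤) (hmin : MinimizesUpTo W s p ε Ω u)
    (hu : Measurable u) (hu1 : ∀ x, u x ∈ Icc (-1) 1)
    (hz : Measurable z) (hz02 : ∀ x, z x ∈ Ioc 0 2) (hzΩ : ∀ x, x ∉ Ω → z x = 2)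
    (hbar : ∀ η > 0, ∀ x, z x < 2 →
      (1 - s) * ∫ y, truncKernel s p η (x - y) * flux p (z y - z x) ≤ c₁ / p * z x ^ (m - 1)) :
    ENNReal.ofReal (c₁ * a₀ ^ ⌈m⌉₊) * volume (layer u z a₀ ϑ) ≤ ENNReal.ofReal ε +
      ENNReal.ofReal (2 * Lam + 2 * c₁) *
        ∫⁻ x in {x | z x < 2 ∧ ϑ < u x}, ENNReal.ofReal (z x ^ (m - 1)) := by
  have hc₁ := hW.c₁_pos
  have hLam : 0 ≤ Lam := zero_le_one.trans hW.one_le_Lam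
  have hmem : ∀ x, min (u x) (z x - 1) ∈ Icc (-1) 1 := fun x =>
    ⟨le_min (hu1 x).1 (by linarith [(hz02 x).1]), (min_le_left _ _).trans (hu1 x).2⟩
  set Y := ∫⁻ x in Ω, ENNReal.ofReal (c₁ * (u x - min (u x) (z x - 1)) * z x ^ (m - 1))
  have hY : Y ≠ ⊤ := setLIntegral_ofReal_ne_top hΩf (B := c₁ * 2 * 2 ^ (m - 1)) fun x => by
    have := (hz02 x).1
    gcongr
    · linarith [(hu1 x).2, (hmem x).1]
    · exact (hz02 x).2
  have hWmin : ∫⁻ x in Ω, ENNReal.ofReal (W (min (u x) (z x - 1))) ≠ ⊤ :=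
    setLIntegral_ofReal_ne_top hΩf (B := Lam * 2 ^ m) fun x => (hW.upper _ (hmem x)).trans (by
      gcongr
      exact abs_le.2 ⟨by linarith [(hmem x).1], by linarith [(hmem x).2]⟩)
  have hpot := hmin.lintegral_potential_le hs (hu.min (hz.sub_const 1)).aemeasurable
    (ae_of_all _ fun x => abs_le.2 (hmem x))
    (ae_of_all _ fun x hx => min_eq_left (by linarith [hzΩ x hx, (hu1 x).2])) hY
    (ofReal_mul_kinetic_min_le hn hp hsp hs hΩ hΩf hu hu1 hz hz02 hzΩ hbar)
  refine (ENNReal.add_le_add_iff_left (ENNReal.add_ne_top.2 ⟨hWmin, hY⟩)).1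
    ((lintegral_potential_add_volume_layer_le hW hm ha₀ hϑ hu hu1 hz hz02 hzΩ).trans
      ((add_le_add_left hpot _).trans_eq ?_))
  ring

lemma volume_layer_le (hn : 1 ≤ n) (hW : IsPotential W m lam Lam θ q c₁) (hp : 1 < p)
    (hm : 1 ≤ m) (hsp : 0 < s * p) (hs : s < 1) (ha₀ : 0 < a₀) (hϑ : ϑ ≤ -1 + q)
    (hΩ : MeasurableSet Ω) (hΩf : volume Ω ≠ ⊤) (hmin : MinimizesUpTo W s p ε Ω u)
    (hz : Measurable z) (hz02 : ∀ x, z x ∈ Ioc 0 2) (hzΩ : ∀ x, x ∉ Ω → z x = 2)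
    (hbar : ∀ η > 0, ∀ x, z x < 2 →
      (1 - s) * ∫ y, truncKernel s p η (x - y) * flux p (z y - z x) ≤ c₁ / p * z x ^ (m - 1)) :
    ENNReal.ofReal (c₁ * a₀ ^ ⌈m⌉₊) * volume (layer u z a₀ ϑ) ≤ ENNReal.ofReal ε +
      ENNReal.ofReal (2 * Lam + 2 * c₁) *
        ∫⁻ x in {x | z x < 2 ∧ ϑ < u x}, ENNReal.ofReal (z x ^ (m - 1)) := by
  obtain ⟨u', hu', hu'1, huu'⟩ := hmin.1.exists_measurable_rep
  have hlayer : layer u z a₀ ϑ =ᵐ[volume] layer u' z a₀ ϑ :=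
    huu'.mono fun x hx => propext <| by
      change _ ∧ _ ∧ _ ↔ _ ∧ _ ∧ _
      rw [hx]
  have habove : ({x | z x < 2 ∧ ϑ < u x} : Set (E n)) =ᵐ[volume] {x | z x < 2 ∧ ϑ < u' x} :=
    huu'.mono fun x hx => propext <| by
      change _ ∧ _ ↔ _ ∧ _
      rw [hx]
  rw [measure_congr hlayer, setLIntegral_congr habove]
  exact volume_layer_le_of_measurable hn hW hp hm hsp hs ha₀ hϑ hΩ hΩf (hmin.congr_ae huu') hu'
    hu'1 hz hz02 hzΩ hbar

end Comparison

/-! ### The barrier and the layer estimate -/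

section Barrier

variable {n : ℕ} {β γ T a₀ : ℝ} {j k : ℕ}

/-- The barrier for the ball of radius `j T`: the infimum, truncated at `2`, of bowls of the dyadic
widths `2 ^ k T` which all reach the value `2` inside that ball. Its `k`-th bowl has depth
`a₀ 2 ^ (-(γ k))`, so that the barrier decays polynomially away from the sphere. -/
def barrier (β γ T a₀ : ℝ) (j : ℕ) (y : E n) : ℝ :=
  min 2 ((Finset.range (Nat.log 2 j + 1)).inf' Finset.nonempty_range_add_one
    fun k => bowl β ((j - 2 ^ k) * T) (2 ^ k * T) (a₀ * 2 ^ (-(γ * k))) y)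

lemma measurable_bowl (β ℓ L a : ℝ) : Measurable (bowl β ℓ L a : E n → ℝ) := by
  unfold bowl radialExcess
  fun_prop

lemma le_bowl {ℓ L a : ℝ} (hL : 0 ≤ L) (y : E n) : a ≤ bowl β ℓ L a y := by
  have := Real.rpow_nonneg (div_nonneg (radialExcess_nonneg ℓ y) hL) β
  rw [bowl]
  linarith

lemma two_lt_bowl {ℓ L a : ℝ} (hβ : 0 ≤ β) (hL : 0 < L) (ha : 0 < a) {y : E n}
    (hy : L ≤ radialExcess ℓ y) : 2 < bowl β ℓ L a y := by
  have := Real.one_le_rpow ((one_le_div hL).2 hy) hβ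
  rw [bowl]
  linarith

lemma bowl_of_norm_le {ℓ : ℝ} (hβ : β ≠ 0) {y : E n} (hy : ‖y‖ ≤ ℓ) (L a : ℝ) :
    bowl β ℓ L a y = a := by
  simp [bowl, radialExcess, max_eq_right (sub_nonpos.2 hy), Real.zero_rpow hβ]

lemma barrier_le_two (y : E n) : barrier β γ T a₀ j y ≤ 2 := min_le_left _ _

lemma barrier_le_bowl (hk : k ∈ Finset.range (Nat.log 2 j + 1)) (y : E n) :
    barrier β γ T a₀ j y ≤ bowl β ((j - 2 ^ k) * T) (2 ^ k * T) (a₀ * 2 ^ (-(γ * k))) y :=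
  (min_le_right _ _).trans (Finset.inf'_le _ hk)

lemma exists_barrier_eq_bowl {y : E n} (hy : barrier β γ T a₀ j y < 2) :
    ∃ k ∈ Finset.range (Nat.log 2 j + 1), barrier β γ T a₀ j y =
      bowl β ((j - 2 ^ k) * T) (2 ^ k * T) (a₀ * 2 ^ (-(γ * k))) y := by
  obtain ⟨k, hk, hky⟩ := Finset.exists_mem_eq_inf'
    (Finset.nonempty_range_add_one (n := Nat.log 2 j))
    fun k => bowl β ((j - 2 ^ k) * T) (2 ^ k * T) (a₀ * 2 ^ (-(γ * k))) y
  exact ⟨k, hk, ((min_choice _ _).resolve_left hy.ne).trans hky⟩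

lemma measurable_barrier (β γ T a₀ : ℝ) (j : ℕ) :
    Measurable (barrier β γ T a₀ j : E n → ℝ) := by
  have hinf := Finset.inf'_induction (Finset.nonempty_range_add_one (n := Nat.log 2 j))
    (fun k => (bowl β ((j - 2 ^ k) * T) (2 ^ k * T) (a₀ * 2 ^ (-(γ * k))) : E n → ℝ))
    (p := Measurable) (fun _ hf _ hg => hf.inf hg) fun _ _ => measurable_bowl _ _ _ _
  simpa only [barrier, Finset.inf'_apply] using! measurable_const.min hinf

lemma barrier_pos (hT : 0 ≤ T) (ha₀ : 0 < a₀) (j : ℕ) (y : E n) : 0 < barrier β γ T a₀ j y :=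
  lt_min two_pos <| (Finset.lt_inf'_iff _).2 fun _ _ =>
    lt_of_lt_of_le (by positivity) (le_bowl (by positivity) y)

lemma barrier_mem_Ioc (hT : 0 ≤ T) (ha₀ : 0 < a₀) (j : ℕ) (y : E n) :
    barrier β γ T a₀ j y ∈ Ioc 0 2 :=
  ⟨barrier_pos hT ha₀ j y, barrier_le_two y⟩

lemma barrier_eq_two (hβ : 0 ≤ β) (hT : 0 < T) (ha₀ : 0 < a₀) {y : E n} (hy : j * T ≤ ‖y‖) :
    barrier β γ T a₀ j y = 2 :=
  min_eq_left <| (Finset.le_inf'_iff _ _).2 fun k _ =>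
    (two_lt_bowl hβ (by positivity) (by positivity)
      (le_trans (by linarith) (le_max_left (‖y‖ - (j - 2 ^ k) * T) 0))).le

lemma norm_lt_of_barrier_lt_two (hβ : 0 ≤ β) (hT : 0 < T) (ha₀ : 0 < a₀) {y : E n}
    (hy : barrier β γ T a₀ j y < 2) : ‖y‖ < j * T :=
  lt_of_not_ge fun h => hy.ne (barrier_eq_two hβ hT ha₀ h)

lemma barrier_le (hβ : β ≠ 0) {y : E n} (hy : ‖y‖ ≤ (j - 1) * T) :
    barrier β γ T a₀ j y ≤ a₀ := by
  have h := barrier_le_bowl (β := β) (γ := γ) (T := T) (a₀ := a₀) (j := j) (k := 0) (by simp) y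
  simpa [bowl_of_norm_le hβ hy] using h

lemma mul_two_rpow_neg_rpow (ha₀ : 0 ≤ a₀) (γ e : ℝ) (k : ℕ) :
    (a₀ * 2 ^ (-(γ * k))) ^ e = a₀ ^ e * (2 ^ k : ℝ) ^ (-(γ * e)) := by
  rw [Real.mul_rpow ha₀ (by positivity), ← Real.rpow_natCast, ← Real.rpow_mul two_pos.le,
    ← Real.rpow_mul two_pos.le]
  ring_nf

lemma two_pow_le_of_mem_range_log (hj : j ≠ 0) (hk : k ∈ Finset.range (Nat.log 2 j + 1)) :
    (2 : ℝ) ^ k ≤ j :=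
  mod_cast Nat.pow_le_of_le_log hj (Nat.lt_succ_iff.1 (Finset.mem_range.1 hk))

lemma barrier_rpow_le (hβ : β ≠ 0) (hT : 0 ≤ T) (ha₀ : 0 < a₀) {e : ℝ} (he : 0 ≤ e) (hγ : 0 ≤ γ)
    {i : ℕ} (hij : i ≤ j) {y : E n} (hy : ‖y‖ ≤ (j - i) * T) :
    barrier β γ T a₀ j y ^ e ≤ max (2 ^ e) (a₀ ^ e * 2 ^ (γ * e)) * (i + 1 : ℝ) ^ (-(γ * e)) := by
  have hpos := barrier_pos (β := β) (γ := γ) hT ha₀ j y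
  rcases eq_or_ne i 0 with rfl | hi
  · rw [Nat.cast_zero, zero_add, Real.one_rpow, mul_one]
    exact (Real.rpow_le_rpow hpos.le (barrier_le_two y) he).trans (le_max_left _ _)
  have hlog : Nat.log 2 i ∈ Finset.range (Nat.log 2 j + 1) :=
    Finset.mem_range_succ_iff.2 (Nat.log_mono_right hij)
  have h2i : (2 : ℝ) ^ Nat.log 2 i ≤ i := two_pow_le_of_mem_range_log hi (by simp)
  have hi2 : ((i : ℝ) + 1) / 2 ≤ 2 ^ Nat.log 2 i := by
    have : i + 1 ≤ 2 ^ Nat.log 2 i * 2 := Nat.lt_pow_succ_log_self one_lt_two i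
    rw [div_le_iff₀ two_pos]
    exact_mod_cast this
  have hle := barrier_le_bowl (β := β) (γ := γ) (T := T) (a₀ := a₀) hlog y
  rw [bowl_of_norm_le hβ (hy.trans (by gcongr))] at hle
  calc barrier β γ T a₀ j y ^ e ≤ a₀ ^ e * (2 ^ Nat.log 2 i : ℝ) ^ (-(γ * e)) :=
        (Real.rpow_le_rpow hpos.le hle he).trans_eq (mul_two_rpow_neg_rpow ha₀.le _ _ _)
    _ ≤ a₀ ^ e * (((i : ℝ) + 1) / 2) ^ (-(γ * e)) := by
        gcongr ?_ * ?_
        exact Real.rpow_le_rpow_of_nonpos (by positivity) hi2 (neg_nonpos.2 (by positivity))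
    _ = a₀ ^ e * 2 ^ (γ * e) * (i + 1 : ℝ) ^ (-(γ * e)) := by
        rw [Real.div_rpow (by positivity) two_pos.le, Real.rpow_neg two_pos.le]
        field_simp
    _ ≤ _ := by
        gcongr
        exact le_max_right _ _

lemma rpow_neg_mul_le {L σ τ : ℝ} (hL : 1 ≤ L) (hT : 1 ≤ T) (hσ : 1 ≤ σ) (hτ : σ ≤ τ) :
    (L * T) ^ (-τ) ≤ L ^ (-σ) / T := by
  calc (L * T) ^ (-τ) ≤ (L * T) ^ (-σ) :=
        Real.rpow_le_rpow_of_exponent_le (one_le_mul_of_one_le_of_one_le hL hT) (by linarith)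
    _ = L ^ (-σ) * T ^ (-σ) := Real.mul_rpow (by positivity) (by positivity)
    _ ≤ L ^ (-σ) * T ^ (-1 : ℝ) := by
        gcongr ?_ * ?_
        exact Real.rpow_le_rpow_of_exponent_le hT (by linarith)
    _ = L ^ (-σ) / T := by rw [Real.rpow_neg_one, div_eq_mul_inv]

lemma exists_barrier_supersolution (hn : 1 ≤ n) {p m c₁ : ℝ} (hp : 1 < p) (hβ : 2 ≤ β)
    (hβp : p ≤ β * (p - 1)) (hm : 1 ≤ m) (hγ : 1 < γ * (m - 1)) (hc₁ : 0 < c₁) (ha₀ : 0 < a₀) :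
    ∃ T : ℝ, 1 ≤ T ∧ ∀ {s η : ℝ} {j : ℕ}, γ * (m - 1) ≤ s * p → s < 1 → 0 < η → j ≠ 0 →
      ∀ x : E n, barrier β γ T a₀ j x < 2 →
        (1 - s) * ∫ y, truncKernel s p η (x - y) *
            flux p (barrier β γ T a₀ j y - barrier β γ T a₀ j x) ≤
          c₁ / p * barrier β γ T a₀ j x ^ (m - 1) := by
  obtain ⟨C, hC, hbowl⟩ := exists_integral_truncKernel_mul_flux_le hn hp hβ hβp
  set T := max 1 (C / (c₁ / p * a₀ ^ (m - 1)))
  have hT : 1 ≤ T := le_max_left _ _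
  refine ⟨T, hT, fun {s η j} hs hs1 hη hj x hx => ?_⟩
  obtain ⟨k, hk, hxk⟩ := exists_barrier_eq_bowl hx
  have h2k : (1 : ℝ) ≤ 2 ^ k := one_le_pow₀ one_le_two
  have hexcess : radialExcess ((j - 2 ^ k) * T) x ≤ 2 ^ k * T := by
    by_contra! h
    have : 2 < bowl β ((j - 2 ^ k) * T) (2 ^ k * T) (a₀ * 2 ^ (-(γ * k))) x :=
      two_lt_bowl (by linarith) (by positivity) (by positivity) h.le
    linarith
  have hdepth : a₀ * 2 ^ (-(γ * k)) ≤ barrier β γ T a₀ j x := hxk ▸ le_bowl (by positivity) x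
  have hT' : C / T ≤ c₁ / p * a₀ ^ (m - 1) :=
    (div_le_comm₀ (by positivity) (by positivity)).1 (le_max_right _ _)
  calc _ ≤ C * (2 ^ k * T) ^ (-(s * p)) :=
        hbowl (hγ.trans_le hs) hs1 (by positivity)
          (mul_nonneg (sub_nonneg.2 (two_pow_le_of_mem_range_log hj hk)) (by positivity)) hη
          (measurable_barrier β γ T a₀ j)
          (fun y => Ioc_subset_Icc_self (barrier_mem_Ioc (by positivity) ha₀ j y))
          (barrier_le_bowl hk) x hxk hexcess
    _ ≤ C * ((2 ^ k) ^ (-(γ * (m - 1))) / T) := by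
        gcongr
        exact rpow_neg_mul_le h2k hT hγ.le hs
    _ = C / T * (2 ^ k) ^ (-(γ * (m - 1))) := by ring
    _ ≤ c₁ / p * a₀ ^ (m - 1) * (2 ^ k) ^ (-(γ * (m - 1))) := by gcongr
    _ = c₁ / p * (a₀ * 2 ^ (-(γ * k))) ^ (m - 1) := by
        rw [mul_two_rpow_neg_rpow ha₀.le, mul_assoc]
    _ ≤ c₁ / p * barrier β γ T a₀ j x ^ (m - 1) := by gcongr

end Barrier

section LayerEstimate

lemma sum_setLIntegral_le {X ι : Type*} [MeasurableSpace X] {μ : Measure X} {F : Finset ι}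
    {A : ι → Set X} {B : Set X} {f : ι → X → ENNReal} {S : ENNReal}
    (hA : ∀ j, MeasurableSet (A j)) (hf : ∀ j, Measurable (f j)) (hAB : ∀ j ∈ F, A j ⊆ B)
    (hS : ∀ x, ∑ j ∈ F, (A j).indicator (f j) x ≤ S) :
    ∑ j ∈ F, ∫⁻ x in A j, f j x ∂μ ≤ S * μ B := by
  simp_rw [← lintegral_indicator (hA _)]
  rw [← lintegral_finsetSum _ fun j _ => (hf j).indicator (hA j)]
  refine (lintegral_mono fun x => ?_).trans (lintegral_indicator_const_le B S)
  by_cases hx : x ∈ B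
  · exact (hS x).trans_eq (indicator_of_mem (f := fun _ => S) hx).symm
  · exact (Finset.sum_eq_zero fun j hj =>
      indicator_of_notMem (fun h => hx (hAB j hj h)) _).trans_le zero_le

lemma sum_filter_sub_le_tsum (b : ℕ → ENNReal) (F : Finset ℕ) (j₀ : ℕ) :
    ∑ j ∈ F with j₀ ≤ j, b (j - j₀) ≤ ∑' i, b i := by
  have hinj : InjOn (fun j => j - j₀) ({j ∈ F | j₀ ≤ j} : Finset ℕ) := fun a ha c hc h => by
    have ha := (Finset.mem_filter.1 ha).2
    have hc := (Finset.mem_filter.1 hc).2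
    simp only at h
    omega
  rw [← Finset.sum_image (f := b) hinj]
  exact ENNReal.sum_le_tsum _

variable {n : ℕ} {β γ T a₀ e : ℝ}

lemma sum_indicator_barrier_rpow_le (hβ : 0 < β) (hT : 0 < T) (ha₀ : 0 < a₀) (he : 0 ≤ e)
    (hγ : 0 ≤ γ) (F : Finset ℕ) (x : E n) :
    ∑ j ∈ F, {x | barrier β γ T a₀ j x < 2}.indicator
        (fun x => ENNReal.ofReal (barrier β γ T a₀ j x ^ e)) x ≤
      ∑' i : ℕ, ENNReal.ofReal
        (max (2 ^ e) (a₀ ^ e * 2 ^ (γ * e)) * (i + 1 : ℝ) ^ (-(γ * e))) := by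
  refine le_trans ?_ (sum_filter_sub_le_tsum _ F ⌈‖x‖ / T⌉₊)
  rw [Finset.sum_filter]
  refine Finset.sum_le_sum fun j _ => indicator_apply_le' (fun hx => ?_) fun _ => zero_le
  have hceil : ⌈‖x‖ / T⌉₊ ≤ j :=
    Nat.ceil_le.2 ((div_le_iff₀ hT).2 (norm_lt_of_barrier_lt_two hβ.le hT ha₀ hx).le)
  have hnorm : ‖x‖ ≤ (j - (j - ⌈‖x‖ / T⌉₊ : ℕ)) * T := by
    rw [Nat.cast_sub hceil, sub_sub_cancel]
    exact (div_le_iff₀ hT).1 (Nat.le_ceil _)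
  rw [if_pos hceil]
  exact ENNReal.ofReal_le_ofReal
    (barrier_rpow_le hβ.ne' hT.le ha₀ he hγ (Nat.sub_le _ _) hnorm)

lemma sum_setLIntegral_barrier_rpow_le (hβ : 0 < β) (hT : 0 < T) (ha₀ : 0 < a₀) (he : 0 ≤ e)
    (hγ : 0 ≤ γ) (N : ℕ) (U : Set (E n)) :
    ∑ j ∈ Finset.Ioc N (2 * N), ∫⁻ x in {x | barrier β γ T a₀ j x < 2} ∩ U,
        ENNReal.ofReal (barrier β γ T a₀ j x ^ e) ≤
      (∑' i : ℕ, ENNReal.ofReal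
        (max (2 ^ e) (a₀ ^ e * 2 ^ (γ * e)) * (i + 1 : ℝ) ^ (-(γ * e)))) *
          volume (Metric.ball 0 (2 * N * T) ∩ U) := by
  have hmeas : ∀ j, MeasurableSet {x : E n | barrier β γ T a₀ j x < 2} := fun j =>
    measurableSet_lt (measurable_barrier _ _ _ _ j) measurable_const
  simp_rw [← Measure.restrict_restrict (hmeas _), ← Measure.restrict_apply measurableSet_ball]
  refine sum_setLIntegral_le hmeas
    (fun j => ((measurable_barrier _ _ _ _ j).pow_const e).ennreal_ofReal) (fun j hj x hx => ?_)
    (sum_indicator_barrier_rpow_le hβ hT ha₀ he hγ _)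
  have : (j : ℝ) ≤ 2 * N := mod_cast (Finset.mem_Ioc.1 hj).2
  rw [mem_ball_zero_iff]
  exact (norm_lt_of_barrier_lt_two hβ.le hT ha₀ hx).trans_le (by gcongr)

lemma tsum_ofReal_mul_rpow_neg_ne_top {σ : ℝ} (hσ : 1 < σ) {K : ℝ} (hK : 0 ≤ K) :
    ∑' i : ℕ, ENNReal.ofReal (K * (i + 1 : ℝ) ^ (-σ)) ≠ ⊤ := by
  have hsum : Summable fun i : ℕ => K * (i + 1 : ℝ) ^ (-σ) := by
    have := (summable_nat_add_iff 1).2 (Real.summable_nat_rpow.2 (neg_lt_neg hσ))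
    exact_mod_cast this.mul_left K
  rw [← ENNReal.ofReal_tsum_of_nonneg (fun i => by positivity) hsum]
  exact ENNReal.ofReal_ne_top

variable {s p m lam Lam θ q c₁ ϑ ε : ℝ} {W : ℝ → ℝ} {Ω : Set (E n)} {u : E n → ℝ} {N j : ℕ}

lemma volume_ball_inter_layer_le (hn : 1 ≤ n) (hW : IsPotential W m lam Lam θ q c₁) (hp : 1 < p)
    (hm : 1 ≤ m) (hsp : 0 < s * p) (hs : s < 1) (hβ : 0 < β) (hT : 0 < T) (ha₀ : 0 < a₀)
    (hϑ : ϑ ≤ -1 + q) (hΩ : MeasurableSet Ω) (hΩf : volume Ω ≠ ⊤)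
    (hmin : MinimizesUpTo W s p ε Ω u) (hNj : N < j) (hjΩ : Metric.ball 0 (j * T) ⊆ Ω)
    (hbar : ∀ η > 0, ∀ x : E n, barrier β γ T a₀ j x < 2 →
      (1 - s) * ∫ y, truncKernel s p η (x - y) *
          flux p (barrier β γ T a₀ j y - barrier β γ T a₀ j x) ≤
        c₁ / p * barrier β γ T a₀ j x ^ (m - 1)) :
    ENNReal.ofReal (c₁ * a₀ ^ ⌈m⌉₊) *
        volume (Metric.ball 0 (N * T) ∩ {x | 2 * a₀ ≤ 1 + u x ∧ u x ≤ ϑ}) ≤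
      ENNReal.ofReal ε + ENNReal.ofReal (2 * Lam + 2 * c₁) *
        ∫⁻ x in {x | barrier β γ T a₀ j x < 2} ∩ {x | ϑ < u x},
          ENNReal.ofReal (barrier β γ T a₀ j x ^ (m - 1)) := by
  have hNj' : (N : ℝ) + 1 ≤ j := mod_cast hNj
  refine le_trans ?_ (volume_layer_le hn hW hp hm hsp hs ha₀ hϑ hΩ hΩf hmin
    (measurable_barrier β γ T a₀ j) (barrier_mem_Ioc hT.le ha₀ j)
    (fun x hx => barrier_eq_two hβ.le hT ha₀ ?_) hbar)
  · gcongr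
    refine fun x hx => ⟨barrier_le hβ.ne' ((mem_ball_zero_iff.1 hx.1).le.trans ?_), hx.2⟩
    gcongr
    linarith
  · by_contra! h
    exact hx (hjΩ (mem_ball_zero_iff.2 h))

lemma mul_volume_layer_le (hn : 1 ≤ n) (hW : IsPotential W m lam Lam θ q c₁) (hp : 1 < p)
    (hm : 1 ≤ m) (hsp : 0 < s * p) (hs : s < 1) (hβ : 0 < β) (hγ : 0 ≤ γ) (hT : 0 < T)
    (ha₀ : 0 < a₀) (hϑ : ϑ ≤ -1 + q) (hΩ : MeasurableSet Ω) (hΩf : volume Ω ≠ ⊤)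
    (hmin : MinimizesUpTo W s p ε Ω u) (hNΩ : Metric.ball 0 (2 * N * T) ⊆ Ω)
    (hbar : ∀ j ≠ 0, ∀ η > 0, ∀ x : E n, barrier β γ T a₀ j x < 2 →
      (1 - s) * ∫ y, truncKernel s p η (x - y) *
          flux p (barrier β γ T a₀ j y - barrier β γ T a₀ j x) ≤
        c₁ / p * barrier β γ T a₀ j x ^ (m - 1)) :
    N * (ENNReal.ofReal (c₁ * a₀ ^ ⌈m⌉₊) *
        volume (Metric.ball 0 (N * T) ∩ {x | 2 * a₀ ≤ 1 + u x ∧ u x ≤ ϑ})) ≤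
      N * ENNReal.ofReal ε + ENNReal.ofReal (2 * Lam + 2 * c₁) *
        ((∑' i : ℕ, ENNReal.ofReal
          (max (2 ^ (m - 1)) (a₀ ^ (m - 1) * 2 ^ (γ * (m - 1))) *
            (i + 1 : ℝ) ^ (-(γ * (m - 1))))) *
          volume (Metric.ball 0 (2 * N * T) ∩ {x | ϑ < u x})) := by
  have hlayer := Finset.sum_le_sum fun j (hj : j ∈ Finset.Ioc N (2 * N)) => by
    obtain ⟨hNj, hjN⟩ := Finset.mem_Ioc.1 hj
    have hjN' : (j : ℝ) ≤ 2 * N := mod_cast hjN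
    have hjΩ : Metric.ball 0 (j * T) ⊆ Ω :=
      (Metric.ball_subset_ball (by gcongr)).trans hNΩ
    exact volume_ball_inter_layer_le hn hW hp hm hsp hs hβ hT ha₀ hϑ hΩ hΩf hmin hNj hjΩ
      (hbar j (by omega))
  have hcard : (Finset.Ioc N (2 * N)).card = N := by rw [Nat.card_Ioc]; omega
  rw [Finset.sum_add_distrib, ← Finset.mul_sum _ _ (ENNReal.ofReal (2 * Lam + 2 * c₁)),
    Finset.sum_const, Finset.sum_const, hcard, nsmul_eq_mul, nsmul_eq_mul] at hlayer
  exact hlayer.trans (by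
    gcongr
    exact sum_setLIntegral_barrier_rpow_le hβ hT ha₀ (by linarith) hγ N {x | ϑ < u x})

lemma exists_layer_estimate (hn : 1 ≤ n) {s₀ : ℝ} (hp : 1 < p) (hm : 1 < m) (hs₀ : 1 < s₀ * p)
    (hc₁ : 0 < c₁) (ha₀ : 0 < a₀) :
    ∃ T S : ℝ, 1 ≤ T ∧ 0 ≤ S ∧ ∀ {s lam Lam θ q ϑ ε : ℝ} {W : ℝ → ℝ} {Ω : Set (E n)} {u : E n → ℝ}
      {N : ℕ}, s₀ ≤ s → s < 1 → IsPotential W m lam Lam θ q c₁ → ϑ ≤ -1 + q → MeasurableSet Ω →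
      volume Ω ≠ ⊤ → 0 ≤ ε → MinimizesUpTo W s p ε Ω u → Metric.ball 0 (2 * N * T) ⊆ Ω →
      N * (c₁ * a₀ ^ ⌈m⌉₊ *
          volume.real (Metric.ball 0 (N * T) ∩ {x | 2 * a₀ ≤ 1 + u x ∧ u x ≤ ϑ})) ≤
        N * ε +
          (2 * Lam + 2 * c₁) * (S * volume.real (Metric.ball 0 (2 * N * T) ∩ {x | ϑ < u x})) := by
  have hγ : s₀ * p / (m - 1) * (m - 1) = s₀ * p := div_mul_cancel₀ _ (by linarith)
  have hγ0 : 0 ≤ s₀ * p / (m - 1) := div_nonneg (by linarith) (by linarith)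
  set γ := s₀ * p / (m - 1)
  set β := max 2 (p / (p - 1))
  have hβ : 2 ≤ β := le_max_left _ _
  have hβp : p ≤ β * (p - 1) := (div_le_iff₀ (by linarith)).1 (le_max_right _ _)
  obtain ⟨T, hT, hbar⟩ :=
    exists_barrier_supersolution hn hp hβ hβp hm.le (hγ ▸ hs₀) hc₁ ha₀
  set K := max (2 ^ (m - 1)) (a₀ ^ (m - 1) * 2 ^ (γ * (m - 1)))
  have : ∑' i : ℕ, ENNReal.ofReal (K * (i + 1 : ℝ) ^ (-(γ * (m - 1)))) ≠ ⊤ :=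
    tsum_ofReal_mul_rpow_neg_ne_top (hγ ▸ hs₀) (by positivity)
  refine ⟨T, (∑' i : ℕ, ENNReal.ofReal (K * (i + 1 : ℝ) ^ (-(γ * (m - 1))))).toReal, hT,
    ENNReal.toReal_nonneg, ?_⟩
  intro s lam Lam θ q ϑ ε W Ω u N hs hs1 hW hϑ hΩ hΩf hε hmin hNΩ
  have hLam : 0 ≤ Lam := zero_le_one.trans hW.one_le_Lam
  have hsp : s₀ * p ≤ s * p := by gcongr
  have hfin : volume (Metric.ball (0 : E n) (2 * N * T) ∩ {x | ϑ < u x}) ≠ ⊤ :=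
    measure_ne_top_of_subset inter_subset_left measure_ball_lt_top.ne
  have hreal := ENNReal.toReal_mono (by finiteness) <|
    mul_volume_layer_le hn hW hp hm.le (by linarith) hs1 (by linarith) hγ0 (by linarith) ha₀ hϑ hΩ
      hΩf hmin hNΩ fun j hj η hη => hbar (hγ ▸ hsp) hs1 hη hj
  rw [ENNReal.toReal_add (by finiteness) (by finiteness)] at hreal
  simpa only [measureReal_def, ENNReal.toReal_mul, ENNReal.toReal_natCast,
    ENNReal.toReal_ofReal hε, ENNReal.toReal_ofReal (by positivity : 0 ≤ c₁ * a₀ ^ ⌈m⌉₊),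
    ENNReal.toReal_ofReal (by positivity : 0 ≤ 2 * Lam + 2 * c₁)] using hreal

end LayerEstimate

/-! ### Transition layers -/

section Crossing

lemma continuousOn_of_local_holder {X : Type*} [PseudoMetricSpace X] {f : X → ℝ} {s : Set X}
    {M α : ℝ} (hα : 0 < α)
    (h : ∀ x ∈ s, ∀ y ∈ s, dist x y < 1 → |f x - f y| ≤ M * dist x y ^ α) : ContinuousOn f s := by
  intro x hx
  rw [ContinuousWithinAt, tendsto_iff_dist_tendsto_zero]
  have hbound : Filter.Tendsto (fun y => M * dist y x ^ α) (nhdsWithin x s) (nhds 0) := by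
    have hdist : Filter.Tendsto (fun y => dist y x) (nhdsWithin x s) (nhds 0) :=
      (tendsto_iff_dist_tendsto_zero.1 Filter.tendsto_id).mono_left nhdsWithin_le_nhds
    simpa only [Real.zero_rpow hα.ne', mul_zero] using
      (hdist.rpow_const (p := α) (Or.inr hα.le)).const_mul M
  refine squeeze_zero' (.of_forall fun _ => dist_nonneg) ?_ hbound
  filter_upwards [self_mem_nhdsWithin, nhdsWithin_le_nhds (Metric.ball_mem_nhds x one_pos)]
    with y hy hyx
  rw [Real.dist_eq]
  exact h y hy x hx hyx

variable {γ : ℝ → ℝ} {I : Set ℝ} {M α a b d t₀ t₁ : ℝ}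

lemma exists_crossing (hle : t₀ ≤ t₁) (hγ : ContinuousOn γ (Icc t₀ t₁)) (h₀ : b ≤ γ t₀)
    (h₁ : γ t₁ ≤ a) :
    ∃ v w, t₀ ≤ v ∧ v ≤ w ∧ w ≤ t₁ ∧ b ≤ γ v ∧ γ w ≤ a ∧ ∀ t ∈ Ioo v w, a < γ t ∧ γ t < b := by
  have hlow : IsCompact (Icc t₀ t₁ ∩ γ ⁻¹' Iic a) :=
    isCompact_Icc.of_isClosed_subset (hγ.preimage_isClosed_of_isClosed isClosed_Icc isClosed_Iic)
      inter_subset_left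
  obtain ⟨w, ⟨⟨htw, hwt⟩, hw⟩, hwmin⟩ := hlow.exists_isLeast ⟨t₁, ⟨hle, le_rfl⟩, h₁⟩
  have hhigh : IsCompact (Icc t₀ w ∩ γ ⁻¹' Ici b) :=
    isCompact_Icc.of_isClosed_subset
      ((hγ.mono (Icc_subset_Icc_right hwt)).preimage_isClosed_of_isClosed isClosed_Icc
        isClosed_Ici) inter_subset_left
  obtain ⟨v, ⟨⟨htv, hvw⟩, hv⟩, hvmax⟩ := hhigh.exists_isGreatest ⟨t₀, ⟨le_rfl, htw⟩, h₀⟩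
  refine ⟨v, w, htv, hvw, hwt, hv, hw, fun t ht => ⟨?_, ?_⟩⟩
  · by_contra hta
    exact ht.2.not_ge (hwmin ⟨⟨htv.trans ht.1.le, ht.2.le.trans hwt⟩, not_lt.1 hta⟩)
  · by_contra htb
    exact ht.1.not_ge (hvmax ⟨⟨htv.trans ht.1.le, ht.2.le⟩, not_lt.1 htb⟩)

lemma le_volume_crossing_of_le (hI : I.OrdConnected) (hα : 0 < α) (hM : 0 ≤ M) (hd : d ≤ 1)
    (hMd : M * d ^ α < b - a)
    (hγ : ∀ s ∈ I, ∀ t ∈ I, dist s t < 1 → |γ s - γ t| ≤ M * dist s t ^ α)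
    (ht₀ : t₀ ∈ I) (ht₁ : t₁ ∈ I) (hle : t₀ ≤ t₁) (h₀ : b ≤ γ t₀) (h₁ : γ t₁ ≤ a) :
    ENNReal.ofReal d ≤ volume (I ∩ {t | a < γ t ∧ γ t ≤ b}) := by
  have hcont := (continuousOn_of_local_holder hα hγ).mono (hI.out ht₀ ht₁)
  obtain ⟨v, w, htv, hvw, hwt, hv, hw, hlayer⟩ := exists_crossing hle hcont h₀ h₁
  have hmem : Icc v w ⊆ I := (Icc_subset_Icc htv hwt).trans (hI.out ht₀ ht₁)
  have hdvw : d ≤ w - v := by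
    by_contra! hlt
    have hdist : dist v w = w - v := by
      rw [dist_comm, Real.dist_eq, abs_of_nonneg (sub_nonneg.2 hvw)]
    have hosc := hγ v (hmem ⟨le_rfl, hvw⟩) w (hmem ⟨hvw, le_rfl⟩) (hdist ▸ hlt.trans_le hd)
    have : M * (w - v) ^ α ≤ M * d ^ α := by have := sub_nonneg.2 hvw; gcongr
    rw [hdist] at hosc
    linarith [le_abs_self (γ v - γ w)]
  calc ENNReal.ofReal d ≤ ENNReal.ofReal (w - v) := ENNReal.ofReal_le_ofReal hdvw
    _ = volume (Ioo v w) := Real.volume_Ioo.symm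
    _ ≤ volume (I ∩ {t | a < γ t ∧ γ t ≤ b}) := measure_mono fun t ht =>
      ⟨hmem (Ioo_subset_Icc_self ht), (hlayer t ht).1, (hlayer t ht).2.le⟩

lemma le_volume_crossing (hI : I.OrdConnected) (hα : 0 < α) (hM : 0 ≤ M) (hd : d ≤ 1)
    (hMd : M * d ^ α < b - a)
    (hγ : ∀ s ∈ I, ∀ t ∈ I, dist s t < 1 → |γ s - γ t| ≤ M * dist s t ^ α)
    (ht₀ : t₀ ∈ I) (ht₁ : t₁ ∈ I) (h₀ : b ≤ γ t₀) (h₁ : γ t₁ ≤ a) :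
    ENNReal.ofReal d ≤ volume (I ∩ {t | a < γ t ∧ γ t ≤ b}) := by
  rcases le_total t₀ t₁ with hle | hle
  · exact le_volume_crossing_of_le hI hα hM hd hMd hγ ht₀ ht₁ hle h₀ h₁
  · have hreflect := le_volume_crossing_of_le (γ := fun t => γ (-t)) (I := Neg.neg ⁻¹' I)
      (t₀ := -t₀) (t₁ := -t₁) (hI.preimage_anti fun _ _ => neg_le_neg) hα hM hd hMd
      (fun s hs t ht hst => by simpa only [dist_neg_neg] using hγ (-s) hs (-t) ht (by simpa))
      (by simpa) (by simpa) (neg_le_neg hle) (by simpa) (by simpa)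
    rwa [← Measure.measure_preimage_neg volume (I ∩ _)]

lemma exists_pos_mul_rpow_lt {ε : ℝ} (hα : 0 < α) (hε : 0 < ε) :
    ∃ d, 0 < d ∧ d ≤ 1 ∧ M * d ^ α < ε := by
  have hlim : Filter.Tendsto (fun d : ℝ => M * d ^ α) (nhdsWithin 0 (Ioi 0)) (nhds 0) := by
    simpa [Real.zero_rpow hα.ne'] using
      ((Filter.tendsto_id.rpow_const (p := α) (Or.inr hα.le)).const_mul M).mono_left
        (nhdsWithin_le_nhds (a := (0 : ℝ)))
  obtain ⟨d, hdε, hd⟩ :=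
    ((hlim.eventually_lt_const hε).and (Ioc_mem_nhdsGT one_pos)).exists
  exact ⟨d, hd.1, hd.2, hdε⟩

end Crossing

section Isoperimetric

variable {ι : Type*} [Fintype ι] [DecidableEq ι]

lemma mul_pi_rpow_le_lintegral {A : ι → Type*} [∀ i, MeasurableSpace (A i)]
    (μ : ∀ i, Measure (A i)) [∀ i, SigmaFinite (μ i)] [Nontrivial ι] {f : (∀ i, A i) → ENNReal}
    (hf : Measurable f) {S : Set (∀ i, A i)} (hS : MeasurableSet S) {d : ENNReal}
    (hline : ∀ x ∈ S, ∀ i, d ≤ ∫⁻ t, f (Function.update x i t) ∂μ i) :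
    d * Measure.pi μ S ^ ((Fintype.card ι - 1 : ℝ) / Fintype.card ι) ≤
      ∫⁻ x, f x ∂Measure.pi μ := by
  set k : ℝ := (Fintype.card ι : ℝ)
  have hk : 1 < k := Nat.one_lt_cast.2 Fintype.one_lt_card
  have hk0 : k - 1 ≠ 0 := by linarith
  have hexp : k / (k - 1) * ((k - 1) / k) = 1 := by field_simp
  have hlow : d ^ (k / (k - 1)) * Measure.pi μ S ≤
      ∫⁻ x, ∏ i, (∫⁻ t, f (Function.update x i t) ∂μ i) ^ (1 / (k - 1)) ∂Measure.pi μ := by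
    rw [← setLIntegral_const, ← lintegral_indicator hS]
    refine lintegral_mono (indicator_le fun x hx => ?_)
    calc d ^ (k / (k - 1)) = ∏ _i : ι, d ^ (1 / (k - 1)) := by
          rw [Finset.prod_const, Finset.card_univ, ← ENNReal.rpow_mul_natCast, one_div_mul_eq_div]
      _ ≤ _ := Finset.prod_le_prod' fun i _ =>
          ENNReal.rpow_le_rpow (hline x hx i) (div_nonneg zero_le_one (by linarith))
  have hgrid := ENNReal.rpow_le_rpow (z := (k - 1) / k)
    (hlow.trans (lintegral_prod_lintegral_pow_le μ (p := k / (k - 1)) (.conjExponent hk) hf))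
    (div_nonneg (by linarith) (by linarith))
  rwa [ENNReal.mul_rpow_of_nonneg _ _ (div_nonneg (by linarith) (by linarith)),
    ← ENNReal.rpow_mul, ← ENNReal.rpow_mul, hexp, ENNReal.rpow_one, ENNReal.rpow_one] at hgrid

lemma le_lintegral_pi_of_subsingleton {A : ι → Type*} [∀ i, MeasurableSpace (A i)]
    (μ : ∀ i, Measure (A i)) [∀ i, SigmaFinite (μ i)] [Subsingleton ι] (i : ι)
    {f : (∀ i, A i) → ENNReal} {d : ENNReal} (x : ∀ i, A i)
    (hline : d ≤ ∫⁻ t, f (Function.update x i t) ∂μ i) : d ≤ ∫⁻ x, f x ∂Measure.pi μ := by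
  have huniv : (Finset.univ : Finset ι) = {i} := by
    ext j; simp [Subsingleton.elim j i]
  rwa [lintegral_eq_lmarginal_univ x, huniv, lmarginal_singleton]

/-- The right-hand side is the integral of `1_{G \ S} + 1_G / (2 h)`, whose integral along every
axis-parallel line through a point of `S` is at least `d`. -/
lemma mul_volume_rpow_le_of_line [Nonempty ι] {h d : ℝ} (hh : 0 < h) (hd : d ≤ 1)
    {G S : Set (ι → ℝ)} (hG : MeasurableSet G) (hS : MeasurableSet S) (hSne : S.Nonempty)
    (hline : ∀ x ∈ S, ∀ i, (∀ t ∈ Ioo (-h) h, Function.update x i t ∈ G) ∨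
      ENNReal.ofReal d ≤ volume {t | Function.update x i t ∈ G \ S}) :
    ENNReal.ofReal d * volume S ^ ((Fintype.card ι - 1 : ℝ) / Fintype.card ι) ≤
      volume (G \ S) + ENNReal.ofReal (1 / (2 * h)) * volume G := by
  set c := ENNReal.ofReal (1 / (2 * h))
  let f : (ι → ℝ) → ENNReal := fun x => (G \ S).indicator 1 x + c * G.indicator 1 x
  have hmeas : Measurable ((G \ S).indicator (1 : (ι → ℝ) → ENNReal)) :=
    measurable_one.indicator (hG.diff hS)
  have hf : Measurable f := hmeas.add ((measurable_one.indicator hG).const_mul c)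
  have hintegral : ∫⁻ x, f x = volume (G \ S) + c * volume G := by
    rw [lintegral_add_left hmeas, lintegral_const_mul _ (measurable_one.indicator hG),
      lintegral_indicator_one (hG.diff hS), lintegral_indicator_one hG]
  have hd_le (x) (hx : x ∈ S) (i) : ENNReal.ofReal d ≤ ∫⁻ t, f (Function.update x i t) := by
    have hup : Measurable (Function.update x i) := measurable_update x
    have hslice : ∫⁻ t, f (Function.update x i t) =
        volume {t | Function.update x i t ∈ G \ S} +
          c * volume {t | Function.update x i t ∈ G} := by
      have hdiff : MeasurableSet {t | Function.update x i t ∈ G \ S} := hup (hG.diff hS)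
      have hG' : MeasurableSet {t | Function.update x i t ∈ G} := hup hG
      rw [← lintegral_indicator_one hdiff, ← lintegral_indicator_one hG',
        ← lintegral_const_mul _ (measurable_one.indicator hG'),
        ← lintegral_add_left (measurable_one.indicator hdiff)]
      rfl
    rw [hslice]
    rcases hline x hx i with hfull | hcross
    · calc ENNReal.ofReal d ≤ c * volume (Ioo (-h) h) := by
            rw [Real.volume_Ioo, ← ENNReal.ofReal_mul (by positivity)]
            refine ENNReal.ofReal_le_ofReal (hd.trans_eq ?_)
            field_simp
            ring
        _ ≤ _ := le_add_left (by gcongr; exact hfull)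
    · exact le_add_right hcross
  rw [← hintegral]
  rcases subsingleton_or_nontrivial ι with hι | hι
  · obtain ⟨x, hx⟩ := hSne
    obtain ⟨i⟩ := ‹Nonempty ι›
    have hcard : Fintype.card ι = 1 := Fintype.card_eq_one_iff.2 ⟨i, fun j => Subsingleton.elim j i⟩
    simpa [hcard] using! le_lintegral_pi_of_subsingleton _ i x (hd_le x hx i)
  · exact mul_pi_rpow_le_lintegral _ hf hS hd_le

end Isoperimetric

section Cube

variable {n : ℕ} {h : ℝ}

/-- The open cube of half side `h` centred at the origin, in which the isoperimetric inequality is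
proved line by line. -/
def cube (n : ℕ) (h : ℝ) : Set (E n) := {x | ∀ i, x i ∈ Ioo (-h) h}

lemma isOpen_cube (n : ℕ) (h : ℝ) : IsOpen (cube n h) := by
  rw [cube, ofPred_forall]
  exact isOpen_iInter_of_finite fun i => isOpen_Ioo.preimage (by fun_prop)

lemma ball_subset_cube (n : ℕ) (h : ℝ) : Metric.ball 0 h ⊆ cube n h := fun x hx i =>
  abs_lt.1 ((PiLp.norm_apply_le x i).trans_lt (mem_ball_zero_iff.1 hx))

lemma cube_subset_ball (hn : 1 ≤ n) (hh : 0 < h) : cube n h ⊆ Metric.ball 0 (√n * h) := by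
  intro x hx
  have : Nonempty (Fin n) := ⟨⟨0, hn⟩⟩
  have hsum : ∑ i, ‖x i‖ ^ 2 < ∑ _i : Fin n, h ^ 2 :=
    Finset.sum_lt_sum_of_nonempty Finset.univ_nonempty fun i _ => by
      rw [Real.norm_eq_abs, sq_abs]
      exact sq_lt_sq' (hx i).1 (hx i).2
  rw [mem_ball_zero_iff, EuclideanSpace.norm_eq, ← Real.sqrt_sq hh.le,
    ← Real.sqrt_mul (by positivity)]
  exact Real.sqrt_lt_sqrt (by positivity) (by simpa using hsum)

lemma volume_ne_top_of_subset_cube (hn : 1 ≤ n) (hh : 0 < h) {A : Set (E n)}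
    (hA : A ⊆ cube n h) : volume A ≠ ⊤ :=
  measure_ne_top_of_subset (hA.trans (cube_subset_ball hn hh)) measure_ball_lt_top.ne

lemma toLp_update_mem_cube {x : Fin n → ℝ} (hx : WithLp.toLp 2 x ∈ cube n h) (i : Fin n) {t : ℝ}
    (ht : t ∈ Ioo (-h) h) : WithLp.toLp 2 (Function.update x i t) ∈ cube n h := by
  intro j
  rcases eq_or_ne j i with rfl | hj
  · simpa using ht
  · simpa [hj] using! hx j

lemma dist_toLp_update (x : Fin n → ℝ) (i : Fin n) (s t : ℝ) :
    dist (WithLp.toLp 2 (Function.update x i s)) (WithLp.toLp 2 (Function.update x i t)) =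
      dist s t := by
  rw [EuclideanSpace.dist_eq, Finset.sum_eq_single i]
  · simp [Real.sqrt_sq dist_nonneg]
  · intro j _ hj
    simp [hj]
  · simp

variable {u : E n → ℝ} {M α a b d : ℝ}

lemma le_volume_line_crossing (hα : 0 < α) (hM : 0 ≤ M) (hd : d ≤ 1) (hMd : M * d ^ α < b - a)
    (hu : ∀ x ∈ cube n h, ∀ y ∈ cube n h, dist x y < 1 → |u x - u y| ≤ M * dist x y ^ α)
    {x : Fin n → ℝ} (hx : WithLp.toLp 2 x ∈ cube n h) (hbx : b ≤ u (WithLp.toLp 2 x)) {i : Fin n}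
    {t₁ : ℝ} (ht₁ : t₁ ∈ Ioo (-h) h) (hat₁ : u (WithLp.toLp 2 (Function.update x i t₁)) ≤ a) :
    ENNReal.ofReal d ≤ volume {t | WithLp.toLp 2 (Function.update x i t) ∈
      cube n h ∩ {y | a < u y ∧ u y ≤ b}} := by
  refine (le_volume_crossing (γ := fun t => u (WithLp.toLp 2 (Function.update x i t)))
    ordConnected_Ioo hα hM hd hMd (fun s hs t ht hst => ?_) (hx i) ht₁ ?_ hat₁).trans
    (measure_mono fun t ht => ⟨toLp_update_mem_cube hx i ht.1, ht.2⟩)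
  · simpa only [dist_toLp_update] using hu _ (toLp_update_mem_cube hx i hs) _
      (toLp_update_mem_cube hx i ht) (by rwa [dist_toLp_update])
  · simpa using hbx

lemma mul_volume_superlevel_rpow_le (hn : 1 ≤ n) (hh : 0 < h) (hα : 0 < α) (hM : 0 ≤ M)
    (hd : d ≤ 1) (hMd : M * d ^ α < b - a)
    (hu : ∀ x ∈ cube n h, ∀ y ∈ cube n h, dist x y < 1 → |u x - u y| ≤ M * dist x y ^ α)
    (hne : (cube n h ∩ {x | b < u x}).Nonempty) :
    ENNReal.ofReal d * volume (cube n h ∩ {x | b < u x}) ^ ((n - 1 : ℝ) / n) ≤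
      volume (cube n h ∩ {x | a < u x ∧ u x ≤ b}) +
        ENNReal.ofReal (1 / (2 * h)) * volume (cube n h ∩ {x | a < u x}) := by
  have : Nonempty (Fin n) := ⟨⟨0, hn⟩⟩
  have hcont : ContinuousOn u (cube n h) := continuousOn_of_local_holder hα hu
  have hmeas (c : ℝ) : MeasurableSet (cube n h ∩ {x | c < u x}) :=
    (hcont.isOpen_inter_preimage (isOpen_cube n h) isOpen_Ioi).measurableSet
  set S := cube n h ∩ {x | b < u x}
  set G := cube n h ∩ {x | a < u x}
  have hlayer : cube n h ∩ {x | a < u x ∧ u x ≤ b} = G \ S := by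
    ext x
    simp only [G, S, mem_sdiff, mem_inter_iff, mem_ofPred_eq, not_and, not_lt]
    tauto
  have hτ : MeasurePreserving (WithLp.toLp 2 : (Fin n → ℝ) → E n) :=
    PiLp.volume_preserving_toLp (Fin n)
  have hvol {A : Set (E n)} (hA : MeasurableSet A) : volume (WithLp.toLp 2 ⁻¹' A) = volume A :=
    hτ.measure_preimage hA.nullMeasurableSet
  rw [hlayer, ← hvol (hmeas b), ← hvol (hmeas a), ← hvol ((hmeas a).diff (hmeas b)),
    preimage_sdiff]
  suffices hline : ∀ x ∈ WithLp.toLp 2 ⁻¹' S, ∀ i,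
      (∀ t ∈ Ioo (-h) h, Function.update x i t ∈ WithLp.toLp 2 ⁻¹' G) ∨ ENNReal.ofReal d ≤
        volume {t | Function.update x i t ∈ WithLp.toLp 2 ⁻¹' G \ WithLp.toLp 2 ⁻¹' S} by
    simpa only [Fintype.card_fin] using mul_volume_rpow_le_of_line hh hd
      (hτ.measurable (hmeas a)) (hτ.measurable (hmeas b))
      (hne.preimage (WithLp.toLp_surjective 2)) hline
  intro x hx i
  by_cases hfull : ∀ t ∈ Ioo (-h) h, Function.update x i t ∈ WithLp.toLp 2 ⁻¹' G
  · exact Or.inl hfull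
  · push Not at hfull
    obtain ⟨t₁, ht₁, hnot⟩ := hfull
    have hat₁ : u (WithLp.toLp 2 (Function.update x i t₁)) ≤ a :=
      not_lt.1 fun hlt => hnot ⟨toLp_update_mem_cube hx.1 i ht₁, hlt⟩
    right
    simpa only [hlayer] using!
      le_volume_line_crossing hα hM hd hMd hu hx.1 (le_of_lt hx.2) ht₁ hat₁

lemma exists_transition_layer (hn : 1 ≤ n) (hM : 0 ≤ M) (hα : 0 < α) (hab : a < b) :
    ∃ d : ℝ, 0 < d ∧ ∀ {u : E n → ℝ} {h : ℝ}, 1 / 2 ≤ h →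
      (∀ x ∈ cube n h, ∀ y ∈ cube n h, dist x y < 1 → |u x - u y| ≤ M * dist x y ^ α) →
      (cube n h ∩ {x | b < u x}).Nonempty →
        d * volume.real (cube n h ∩ {x | b < u x}) ^ ((n - 1 : ℝ) / n) ≤
          2 * volume.real (cube n h ∩ {x | a < u x ∧ u x ≤ b}) +
            volume.real (cube n h ∩ {x | b < u x}) / (2 * h) := by
  obtain ⟨d, hd0, hd1, hMd⟩ := exists_pos_mul_rpow_lt (M := M) hα (sub_pos.2 hab)
  refine ⟨d, hd0, fun {u h} hh hu hne => ?_⟩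
  have hh0 : 0 < h := by linarith
  have hfin (A : Set (E n)) : volume (cube n h ∩ A) ≠ ⊤ :=
    volume_ne_top_of_subset_cube hn hh0 inter_subset_left
  have hlayer := hfin {x | a < u x ∧ u x ≤ b}
  have hsup := hfin {x | a < u x}
  have hreal := ENNReal.toReal_mono (by finiteness)
    (mul_volume_superlevel_rpow_le hn hh0 hα hM hd1 hMd hu hne)
  rw [ENNReal.toReal_add hlayer (by finiteness), ENNReal.toReal_mul, ENNReal.toReal_mul,
    ENNReal.toReal_ofReal hd0.le, ENNReal.toReal_ofReal (by positivity),
    ← ENNReal.toReal_rpow] at hreal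
  simp only [← measureReal_def] at hreal
  have hsplit : volume.real (cube n h ∩ {x | a < u x}) ≤
      volume.real (cube n h ∩ {x | a < u x ∧ u x ≤ b}) +
        volume.real (cube n h ∩ {x | b < u x}) := by
    refine (measureReal_mono (fun x hx => ?_) (measure_union_ne_top hlayer (hfin _))).trans
      (measureReal_union_le _ _)
    rcases le_or_gt (u x) b with hxb | hxb
    · exact Or.inl ⟨hx.1, hx.2, hxb⟩
    · exact Or.inr ⟨hx.1, hxb⟩
  have hle : 1 / (2 * h) ≤ 1 := by rw [div_le_one (by positivity)]; linarith
  calc _ ≤ _ := hreal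
    _ ≤ volume.real (cube n h ∩ {x | a < u x ∧ u x ≤ b}) + 1 / (2 * h) *
        (volume.real (cube n h ∩ {x | a < u x ∧ u x ≤ b}) +
          volume.real (cube n h ∩ {x | b < u x})) := by gcongr
    _ ≤ _ := by
      have := mul_le_of_le_one_left (measureReal_nonneg (μ := volume)
        (s := cube n h ∩ {x | a < u x ∧ u x ≤ b})) hle
      rw [mul_add, one_div_mul_eq_div (2 * h) (volume.real (cube n h ∩ {x | b < u x}))]
      linarith

end Cube

/-! ### Growth of the superlevel sets -/

section Recursion

variable {n : ℕ} {c μ : ℝ}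

lemma mul_pow_le_mul_rpow (hn : 1 ≤ n) {B K : ℝ} (hB : 0 < B) (hK : 0 < K) (hc : 0 ≤ c)
    (hμ : 0 < μ) (hμc : μ ≤ (c / B ^ n) ^ n) :
    μ * (B * K) ^ n ≤ c * K * (μ * K ^ n) ^ ((n - 1 : ℝ) / n) := by
  have hn0 : (n : ℝ) ≠ 0 := by positivity
  have hroot : μ ^ (1 / n : ℝ) ≤ c / B ^ n := by
    rw [one_div]
    exact (Real.rpow_le_rpow hμ.le hμc (by positivity)).trans_eq
      (Real.pow_rpow_inv_natCast (by positivity) (by omega))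
  have hsplit : μ = μ ^ ((n - 1 : ℝ) / n) * μ ^ (1 / n : ℝ) := by
    rw [← Real.rpow_add hμ, ← add_div, sub_add_cancel, div_self hn0, Real.rpow_one]
  have hfactor : (μ * K ^ n) ^ ((n - 1 : ℝ) / n) * K = μ ^ ((n - 1 : ℝ) / n) * K ^ n := by
    rw [Real.mul_rpow hμ.le (by positivity), ← Real.rpow_natCast K, ← Real.rpow_mul hK.le,
      mul_div_cancel₀ _ hn0, mul_assoc, ← Real.rpow_add_one hK.ne', sub_add_cancel]
  calc μ * (B * K) ^ n = μ ^ ((n - 1 : ℝ) / n) * μ ^ (1 / n : ℝ) * (B ^ n * K ^ n) := by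
        rw [← hsplit, mul_pow]
    _ ≤ μ ^ ((n - 1 : ℝ) / n) * (c / B ^ n) * (B ^ n * K ^ n) := by gcongr
    _ = c * (μ ^ ((n - 1 : ℝ) / n) * K ^ n) := by field_simp
    _ = c * K * (μ * K ^ n) ^ ((n - 1 : ℝ) / n) := by rw [← hfactor]; ring

lemma mul_pow_le_of_recursion {ν N₀ Nmax : ℕ} (hn : 1 ≤ n) (hν : 2 ≤ ν) (hN₀ : 1 ≤ N₀)
    {f : ℕ → ℝ} (hf : Monotone f) (hc : 0 < c) (hμ : 0 < μ) (hf₀ : μ * (ν * N₀) ^ n ≤ f N₀)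
    (hμc : μ ≤ (c / (2 * ν) ^ n) ^ n)
    (hrec : ∀ N, N₀ ≤ N → ν * N ≤ Nmax → c * N * f N ^ ((n - 1 : ℝ) / n) ≤ f (ν * N)) :
    ∀ N, N₀ ≤ N → N ≤ Nmax → μ * (N : ℝ) ^ n ≤ f N := by
  intro N
  induction N using Nat.strong_induction_on with
  | _ N ih =>
    intro hN hNmax
    rcases lt_or_ge N (ν * N₀) with hlt | hge
    · calc μ * (N : ℝ) ^ n ≤ μ * (ν * N₀) ^ n := by
            have : (N : ℝ) ≤ ν * N₀ := by exact_mod_cast hlt.le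
            gcongr
        _ ≤ f N := hf₀.trans (hf hN)
    · set K := N / ν
      have hKN₀ : N₀ ≤ K := (Nat.le_div_iff_mul_le (by omega)).2 (by rwa [mul_comm])
      have hK : (1 : ℝ) ≤ K := by exact_mod_cast hN₀.trans hKN₀
      have hνK : ν * K ≤ N := Nat.mul_div_le N ν
      have hNK : (N : ℝ) ≤ 2 * ν * K := by
        have : (N : ℝ) < ν * (K + 1) := by exact_mod_cast Nat.lt_mul_div_succ N (by omega)
        nlinarith [(Nat.cast_nonneg ν : (0 : ℝ) ≤ ν)]
      have hn1 : (1 : ℝ) ≤ n := by exact_mod_cast hn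
      calc μ * (N : ℝ) ^ n ≤ μ * (2 * ν * K) ^ n := by gcongr
        _ ≤ c * K * (μ * (K : ℝ) ^ n) ^ ((n - 1 : ℝ) / n) :=
            mul_pow_le_mul_rpow hn (by positivity) (by positivity) hc.le hμ hμc
        _ ≤ c * K * f K ^ ((n - 1 : ℝ) / n) := by
            gcongr
            exact ih K (Nat.div_lt_self (by omega) (by omega)) hKN₀
              ((Nat.div_le_self N ν).trans hNmax)
        _ ≤ f (ν * K) := hrec K hKN₀ (by omega)
        _ ≤ f N := hf hνK

variable {ν : ℕ} {T c₀ r₀ r : ℝ} {V : ℝ → ℝ}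

lemma mul_pow_le_of_radius_recursion {N₀ : ℕ} (hn : 1 ≤ n) (hν : 2 ≤ ν) (hN₀ : 1 ≤ N₀)
    (hT : 0 < T) (hV : Monotone V) (hc : 0 < c) (hμ : 0 < μ)
    (hV₀ : μ * (ν * N₀) ^ n ≤ V (N₀ * T)) (hμc : μ ≤ (c / (2 * ν) ^ n) ^ n) (hr : N₀ * T ≤ r)
    (hrec : ∀ N : ℕ, N₀ ≤ N → ν * N * T ≤ r →
      c * N * V (N * T) ^ ((n - 1 : ℝ) / n) ≤ V (ν * N * T)) :
    μ / (2 * T) ^ n * r ^ n ≤ V r := by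
  set N := ⌊r / T⌋₊
  have hN₀N : N₀ ≤ N := Nat.le_floor ((le_div_iff₀ hT).2 hr)
  have hr0 : 0 ≤ r := le_trans (by positivity) hr
  have hNr : N * T ≤ r := (le_div_iff₀ hT).1 (Nat.floor_le (by positivity))
  have hrN : r ≤ 2 * T * N := by
    have hlt := (div_lt_iff₀ hT).1 (Nat.lt_floor_add_one (r / T))
    have : T ≤ N * T := le_mul_of_one_le_left hT.le (by exact_mod_cast hN₀.trans hN₀N)
    linarith
  have hgrowth : μ * (N : ℝ) ^ n ≤ V (N * T) := by
    refine mul_pow_le_of_recursion (f := fun N : ℕ => V (N * T)) hn hν hN₀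
      (fun i j hij => hV (by gcongr)) hc hμ hV₀ hμc (fun i hi hiN => ?_) N hN₀N le_rfl
    have : (ν * i : ℝ) ≤ N := by exact_mod_cast hiN
    simpa only [Nat.cast_mul] using
      hrec i hi ((mul_le_mul_of_nonneg_right this hT.le).trans hNr)
  calc μ / (2 * T) ^ n * r ^ n ≤ μ / (2 * T) ^ n * (2 * T * N) ^ n := by gcongr
    _ = μ * (N : ℝ) ^ n := by
        rw [mul_pow (2 * T), ← mul_assoc, div_mul_cancel₀ _ (by positivity)]
    _ ≤ V r := hgrowth.trans (hV hNr)

lemma exists_mul_pow_lt_of_recursion (hn : 1 ≤ n) (hν : 2 ≤ ν) (hT : 1 ≤ T) (hc : 0 < c)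
    (hc₀ : 0 < c₀) (hr₀ : 0 < r₀) :
    ∃ ct : ℝ, (0 < ct ∧ ct < 1) ∧ ∀ {V : ℝ → ℝ} {r : ℝ}, Monotone V → c₀ ≤ V r₀ → r₀ ≤ r →
      (∀ N : ℕ, 1 ≤ N → c₀ ≤ V (N * T) → ν * N * T ≤ r →
        c * N * V (N * T) ^ ((n - 1 : ℝ) / n) ≤ V (ν * N * T)) →
      ct * r ^ n < V r := by
  set N₀ := ⌈r₀⌉₊
  have hN₀ : 1 ≤ N₀ := Nat.one_le_ceil_iff.2 hr₀
  have : 0 < T := by linarith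
  have hr₀N : r₀ ≤ N₀ * T := (Nat.le_ceil r₀).trans (le_mul_of_one_le_right (by positivity) hT)
  obtain ⟨μ, hμ, hμ₀, hμc⟩ :
      ∃ μ : ℝ, 0 < μ ∧ μ ≤ c₀ / (ν * N₀) ^ n ∧ μ ≤ (c / (2 * ν) ^ n) ^ n :=
    ⟨_, lt_min (by positivity) (by positivity), min_le_left _ _, min_le_right _ _⟩
  obtain ⟨ct, hct, hct1, hctr, hctμ⟩ :
      ∃ ct : ℝ, 0 < ct ∧ ct < 1 ∧ ct < c₀ / (N₀ * T) ^ n ∧ ct < μ / (2 * T) ^ n := by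
    have hpos : 0 < min 1 (min (c₀ / (N₀ * T) ^ n) (μ / (2 * T) ^ n)) := by positivity
    obtain ⟨ct, hct, hlt⟩ := exists_between hpos
    exact ⟨ct, hct, by simpa only [lt_min_iff] using hlt⟩
  refine ⟨ct, ⟨hct, hct1⟩, fun {V r} hV hV₀ hr hrec => ?_⟩
  have hr0 : 0 < r := hr₀.trans_le hr
  rcases lt_or_ge r (N₀ * T) with hsmall | hlarge
  · calc ct * r ^ n < c₀ / (N₀ * T) ^ n * r ^ n := by gcongr
      _ ≤ c₀ / (N₀ * T) ^ n * (N₀ * T) ^ n := by gcongr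
      _ = c₀ := div_mul_cancel₀ _ (by positivity)
      _ ≤ V r := hV₀.trans (hV hr)
  · calc ct * r ^ n < μ / (2 * T) ^ n * r ^ n := by gcongr
      _ ≤ V r := by
        refine mul_pow_le_of_radius_recursion hn hν hN₀ (by positivity) hV hc hμ ?_ hμc hlarge
          fun N hN => hrec N (hN₀.trans hN) (hV₀.trans (hV (hr₀N.trans (by gcongr))))
        exact ((le_div_iff₀ (by positivity)).1 hμ₀).trans (hV₀.trans (hV hr₀N))

end Recursion

section Density

variable {n : ℕ} {u : E n → ℝ} {Ω : Set (E n)} {m p s₀ s c₁ c₀ α ε ϑ r : ℝ}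

/-- The volume of the part of the superlevel set `{u > ϑ}` in the ball of radius `ρ`: the quantity
whose growth in `ρ` the density estimate bounds from below. -/
def superlevelVolume (u : E n → ℝ) (ϑ ρ : ℝ) : ℝ := volume.real (Metric.ball 0 ρ ∩ {x | ϑ < u x})

lemma volume_ball_inter_ne_top (ρ : ℝ) (A : Set (E n)) : volume (Metric.ball 0 ρ ∩ A) ≠ ⊤ :=
  measure_ne_top_of_subset inter_subset_left measure_ball_lt_top.ne

lemma superlevelVolume_mono (u : E n → ℝ) (ϑ : ℝ) : Monotone (superlevelVolume u ϑ) :=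
  fun _ _ hρ => measureReal_mono (inter_subset_inter_left _ (Metric.ball_subset_ball hρ))
    (volume_ball_inter_ne_top _ _)

lemma superlevelVolume_anti (u : E n → ℝ) (ρ : ℝ) : Antitone fun ϑ => superlevelVolume u ϑ ρ :=
  fun _ _ hϑ => measureReal_mono (inter_subset_inter_right _ fun _ hx => hϑ.trans_lt hx)
    (volume_ball_inter_ne_top _ _)

lemma holder_of_ballHolderSeminorm_le {M : NNReal} (hu : ballHolderSeminorm α u Ω ≤ M)
    (hr : 0 < r) (hΩ : Metric.ball 0 (r + 2) ⊆ Ω) {x y : E n} (hx : x ∈ Metric.ball 0 r)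
    (hxy : dist x y < 1) : |u x - u y| ≤ M * dist x y ^ α := by
  rcases eq_or_ne x y with rfl | hne
  · rw [sub_self, abs_zero]
    positivity
  have hpos : 0 < dist x y ^ α := Real.rpow_pos_of_pos (dist_pos.2 hne) _
  have hquot : edist (u x) (u y) / edist x y ^ α ≤ M := by
    refine le_trans ?_ ((le_iSup₂_of_le (f := fun (R : ℝ)
      (_ : 0 < R ∧ Metric.ball (0 : E n) (R + 2) ⊆ Ω) => ⨆ x₀ ∈ Metric.ball (0 : E n) R,
        holderSeminorm α u (Metric.ball x₀ 1)) r ⟨hr, hΩ⟩ (le_iSup₂ x hx)).trans hu)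
    exact le_iSup₂_of_le x (Metric.mem_ball_self one_pos)
      (le_iSup₂_of_le y (Metric.mem_ball'.2 hxy) le_rfl)
  rwa [edist_dist x, ENNReal.ofReal_rpow_of_pos (dist_pos.2 hne),
    ENNReal.div_le_iff (by simpa using hpos) ENNReal.ofReal_ne_top, edist_dist,
    ← ENNReal.ofReal_coe_nnreal, ← ENNReal.ofReal_mul (NNReal.coe_nonneg M),
    ENNReal.ofReal_le_ofReal_iff (by positivity), Real.dist_eq] at hquot

lemma IsEpsMinimizer.exists_minimizesUpTo {W : ℝ → ℝ} (hu : IsEpsMinimizer W s p ε Ω u)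
    (hΩ : IsOpen Ω) {R : ℝ} (hR : Metric.closedBall 0 R ⊆ Ω) :
    ∃ Ω' : Set (E n), MeasurableSet Ω' ∧ volume Ω' ≠ ⊤ ∧ Metric.ball 0 R ⊆ Ω' ∧
      MinimizesUpTo W s p ε Ω' u := by
  by_cases hb : Bornology.IsBounded Ω
  · exact ⟨Ω, hΩ.measurableSet, hb.measure_lt_top.ne, Metric.ball_subset_closedBall.trans hR,
      hu.2.1 hb⟩
  · have hclosure : closure (Metric.ball 0 R) ⊆ Metric.closedBall (0 : E n) R :=
      Metric.closure_ball_subset_closedBall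
    exact ⟨Metric.ball 0 R, measurableSet_ball, measure_ball_lt_top.ne, subset_rfl,
      hu.2.2 hb _ Metric.isOpen_ball
        ((isCompact_closedBall 0 R).of_isClosed_subset isClosed_closure hclosure)
        (hclosure.trans hR)⟩

lemma exists_superlevel_isoperimetric (hn : 1 ≤ n) {M a b : ℝ} (hM : 0 ≤ M) (hα : 0 < α)
    (hab : a < b) :
    ∃ d : ℝ, 0 < d ∧ ∀ {u : E n → ℝ} {ρ R : ℝ}, 1 / 2 ≤ ρ → √n * ρ ≤ R →
      (∀ x ∈ Metric.ball 0 R, ∀ y ∈ Metric.ball 0 R, dist x y < 1 →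
        |u x - u y| ≤ M * dist x y ^ α) →
      0 < superlevelVolume u b ρ →
      d * superlevelVolume u b ρ ^ ((n - 1 : ℝ) / n) ≤
        2 * volume.real (Metric.ball 0 R ∩ {x | a < u x ∧ u x ≤ b}) +
          superlevelVolume u b R / (2 * ρ) := by
  obtain ⟨d, hd, hlayer⟩ := exists_transition_layer hn hM hα hab
  refine ⟨d, hd, fun {u ρ R} hρ hρR hu hpos => ?_⟩
  have hcube : cube n ρ ⊆ Metric.ball 0 R :=
    (cube_subset_ball hn (by linarith)).trans (Metric.ball_subset_ball hρR)
  have hle : superlevelVolume u b ρ ≤ volume.real (cube n ρ ∩ {x | b < u x}) :=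
    measureReal_mono (inter_subset_inter_left _ (ball_subset_cube n ρ))
      (volume_ne_top_of_subset_cube hn (by linarith) inter_subset_left)
  have hcube_le (A : Set (E n)) : volume.real (cube n ρ ∩ A) ≤
      volume.real (Metric.ball 0 R ∩ A) :=
    measureReal_mono (inter_subset_inter_left _ hcube) (volume_ball_inter_ne_top _ _)
  have hne : (cube n ρ ∩ {x | b < u x}).Nonempty :=
    nonempty_of_measureReal_ne_zero (hpos.trans_le hle).ne'
  have hn1 : (1 : ℝ) ≤ n := by exact_mod_cast hn
  calc d * superlevelVolume u b ρ ^ ((n - 1 : ℝ) / n)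
      ≤ d * volume.real (cube n ρ ∩ {x | b < u x}) ^ ((n - 1 : ℝ) / n) := by
        gcongr
    _ ≤ _ := hlayer hρ (fun x hx y hy => hu x (hcube hx) y (hcube hy)) hne
    _ ≤ _ := add_le_add (mul_le_mul_of_nonneg_left (hcube_le _) two_pos.le)
        (div_le_div_of_nonneg_right (hcube_le _) (by linarith))

lemma mul_le_of_layer_of_isoperimetric {κ A d D F N L V : ℝ} (hκ : 0 < κ) (hA : 0 ≤ A)
    (hV : 0 ≤ V) (hN : 0 < N) (hNL : N ≤ L) (hlayer : L * (κ * D) ≤ L * ε + A * V)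
    (hiso : d * F ≤ 2 * D + V / N) (hε : 4 * ε ≤ κ * (d * F)) :
    κ * d / (2 * (2 * A + κ)) * N * F ≤ V := by
  have hlayer' : N * (κ * D - ε) ≤ A * V := by
    rcases le_total (κ * D) ε with hle | hle
    · exact (mul_nonpos_of_nonneg_of_nonpos hN.le (sub_nonpos.2 hle)).trans (mul_nonneg hA hV)
    · calc N * (κ * D - ε) ≤ L * (κ * D - ε) := by have := sub_nonneg.2 hle; gcongr
        _ ≤ A * V := by linarith
  have hiso' : N * (κ * (d * F)) ≤ 2 * (N * (κ * D)) + κ * V := by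
    calc N * (κ * (d * F)) ≤ N * (κ * (2 * D + V / N)) := by gcongr
      _ = 2 * (N * (κ * D)) + κ * V := by field_simp
  have hε' : N * (4 * ε) ≤ N * (κ * (d * F)) := by gcongr
  rw [div_mul_eq_mul_div, div_mul_eq_mul_div, div_le_iff₀ (by positivity)]
  linarith

lemma exists_superlevel_recursion (hn : 1 ≤ n) {ν : ℕ} (hν : √n ≤ ν) (hp : 1 < p) (hm : 1 < m)
    (hs₀ : 1 < s₀ * p) (hc₁ : 0 < c₁) (hϑ : -1 < ϑ) (hc₀ : 0 < c₀) (hα : 0 < α) {M : ℝ}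
    (hM : 0 ≤ M) :
    ∃ δ T : ℝ, 0 < δ ∧ 1 ≤ T ∧ ∀ {Lam : ℝ}, 0 ≤ Lam → ∃ c : ℝ, 0 < c ∧
      ∀ {s lam θ q ε r : ℝ} {W : ℝ → ℝ} {Ω : Set (E n)} {u : E n → ℝ}, s₀ ≤ s → s < 1 →
      IsPotential W m lam Lam θ q c₁ → ϑ ≤ -1 + q → MeasurableSet Ω → volume Ω ≠ ⊤ →
      Metric.ball 0 r ⊆ Ω → 0 ≤ ε → ε < δ → MinimizesUpTo W s p ε Ω u →
      (∀ x ∈ Metric.ball 0 r, ∀ y ∈ Metric.ball 0 r, dist x y < 1 →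
        |u x - u y| ≤ M * dist x y ^ α) →
      ∀ N : ℕ, 1 ≤ N → c₀ ≤ superlevelVolume u ϑ (N * T) → 2 * ν * N * T ≤ r →
        c * N * superlevelVolume u ϑ (N * T) ^ ((n - 1 : ℝ) / n) ≤
          superlevelVolume u ϑ (2 * ν * N * T) := by
  obtain ⟨T, S, hT, hS, hlayer⟩ :=
    exists_layer_estimate hn hp hm hs₀ hc₁ (a₀ := (1 + ϑ) / 4) (by linarith)
  obtain ⟨d, hd, hiso⟩ :=
    exists_superlevel_isoperimetric hn hM hα (a := -1 + (1 + ϑ) / 2) (b := ϑ) (by linarith)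
  have hκ : 0 < c₁ * ((1 + ϑ) / 4) ^ ⌈m⌉₊ := mul_pos hc₁ (pow_pos (by linarith) _)
  set κ := c₁ * ((1 + ϑ) / 4) ^ ⌈m⌉₊
  have hn1 : (1 : ℝ) ≤ n := by exact_mod_cast hn
  have hν1 : 1 ≤ (ν : ℝ) := (Real.one_le_sqrt.2 hn1).trans hν
  refine ⟨κ * (d * c₀ ^ ((n - 1 : ℝ) / n)) / 4, T, by positivity, hT, fun {Lam} hLam =>
    ⟨κ * d / (2 * (2 * ((2 * Lam + 2 * c₁) * S) + κ)), by positivity, ?_⟩⟩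
  intro s lam θ q ε r W Ω u hs hs1 hW hϑq hΩ hΩf hrΩ hε hεδ hmin hu N hN hcN hNr
  have hN1 : (1 : ℝ) ≤ N := by exact_mod_cast hN
  have hNT : (N : ℝ) ≤ N * T := le_mul_of_one_le_right (by positivity) hT
  have hνNT : 0 ≤ ν * N * T := by positivity
  have hsub : Metric.ball (0 : E n) (ν * N * T) ⊆ Metric.ball 0 r :=
    Metric.ball_subset_ball (by linarith)
  have hlayer_le : (ν * N : ℝ) * (κ * volume.real (Metric.ball 0 (ν * N * T) ∩
        {x : E n | -1 + (1 + ϑ) / 2 < u x ∧ u x ≤ ϑ})) ≤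
      ν * N * ε + (2 * Lam + 2 * c₁) * S * superlevelVolume u ϑ (2 * ν * N * T) := by
    have hle := hlayer (N := ν * N) hs hs1 hW hϑq hΩ hΩf hε hmin
      ((Metric.ball_subset_ball (by push_cast; linarith)).trans hrΩ)
    simp only [Nat.cast_mul, ← mul_assoc] at hle ⊢
    refine le_trans ?_ hle
    gcongr
    · exact volume_ball_inter_ne_top _ _
    · intro
      linarith
  have hiso_le : d * superlevelVolume u ϑ (N * T) ^ ((n - 1 : ℝ) / n) ≤
      2 * volume.real (Metric.ball 0 (ν * N * T) ∩
        {x : E n | -1 + (1 + ϑ) / 2 < u x ∧ u x ≤ ϑ}) +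
          superlevelVolume u ϑ (2 * ν * N * T) / N := by
    refine (hiso (by linarith) (by rw [mul_assoc (ν : ℝ)]; gcongr)
      (fun x hx y hy => hu x (hsub hx) y (hsub hy)) (hc₀.trans_le hcN)).trans ?_
    gcongr
    · exact measureReal_nonneg
    · exact superlevelVolume_mono u ϑ (by linarith)
    · linarith
  have hε_le : 4 * ε ≤ κ * (d * superlevelVolume u ϑ (N * T) ^ ((n - 1 : ℝ) / n)) := by
    calc 4 * ε ≤ κ * (d * c₀ ^ ((n - 1 : ℝ) / n)) := by linarith
      _ ≤ _ := by gcongr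
  exact mul_le_of_layer_of_isoperimetric hκ (by positivity) measureReal_nonneg (by positivity)
    (le_mul_of_one_le_left (by positivity) hν1) hlayer_le hiso_le hε_le

lemma exists_density_estimate (hn : 1 ≤ n) (hp : 1 < p) (hm : 1 < m) (hs₀ : 1 < s₀ * p)
    (hc₁ : 0 < c₁) (hϑ : -1 < ϑ) (hc₀ : 0 < c₀) (hα : 0 < α) (M : NNReal) :
    ∃ δ : ℝ, 0 < δ ∧ ∀ {Lam r₀ : ℝ}, 0 ≤ Lam → 0 < r₀ → ∃ ct : ℝ, (0 < ct ∧ ct < 1) ∧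
      ∀ {s lam θ q ε r : ℝ} {W : ℝ → ℝ} {Ω : Set (E n)} {u : E n → ℝ}, s₀ ≤ s → s < 1 →
      IsPotential W m lam Lam θ q c₁ → ϑ ≤ -1 + q → IsOpen Ω → ballHolderSeminorm α u Ω ≤ M →
      c₀ ≤ superlevelVolume u ϑ r₀ → 0 ≤ ε → ε < δ → IsEpsMinimizer W s p ε Ω u → r₀ ≤ r →
      Metric.ball 0 (4 * r) ⊆ Ω → ct * r ^ n < superlevelVolume u ϑ r := by
  have hν : √(n : ℝ) ≤ ⌈√(n : ℝ)⌉₊ := Nat.le_ceil _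
  have hν1 : 1 ≤ ⌈√(n : ℝ)⌉₊ := Nat.one_le_ceil_iff.2 (by positivity)
  set ν := ⌈√(n : ℝ)⌉₊
  obtain ⟨δ, T, hδ, hT, hrec⟩ :=
    exists_superlevel_recursion hn hν hp hm hs₀ hc₁ hϑ hc₀ hα M.coe_nonneg
  refine ⟨δ, hδ, fun {Lam r₀} hLam hr₀ => ?_⟩
  obtain ⟨c, hc, hrec⟩ := hrec hLam
  obtain ⟨ct, hct, hgrowth⟩ :=
    exists_mul_pow_lt_of_recursion hn (by omega : 2 ≤ 2 * ν) hT hc hc₀ hr₀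
  refine ⟨ct, hct, fun {s lam θ q ε r W Ω u} hs hs1 hW hϑq hΩ hu hu₀ hε hεδ hmin hr hrΩ =>
    hgrowth (superlevelVolume_mono u ϑ) hu₀ hr fun N hN hcN hNr => ?_⟩
  push_cast at hNr ⊢
  have hr1 : 1 ≤ r := by
    have hνN : (1 : ℝ) ≤ 2 * ν * N := by exact_mod_cast Nat.mul_pos (by omega : 0 < 2 * ν) hN
    exact (one_le_mul_of_one_le_of_one_le hνN hT).trans hNr
  obtain ⟨Ω', hΩ', hΩ'f, hrΩ', hmin'⟩ := hmin.exists_minimizesUpTo hΩ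
    ((Metric.closedBall_subset_ball (by linarith : r < 4 * r)).trans hrΩ)
  have hholder : ∀ x ∈ Metric.ball 0 r, ∀ y ∈ Metric.ball 0 r, dist x y < 1 →
      |u x - u y| ≤ M * dist x y ^ α := fun x hx y _ hxy =>
    holder_of_ballHolderSeminorm_le hu (by linarith)
      ((Metric.ball_subset_ball (by linarith)).trans hrΩ) hx hxy
  exact hrec hs hs1 hW hϑq hΩ' hΩ'f hrΩ' hε hεδ hmin' hholder N hN hcN hNr

lemma rpow_mul_measureReal_le_setIntegral {X : Type*} [MeasurableSpace X] {μ : Measure X}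
    {A : Set X} {f : X → ℝ} {a : ℝ} (hm : 0 ≤ m) (ha : 0 ≤ a) (hA : NullMeasurableSet A μ)
    (hAμ : μ A ≠ ⊤) (hf : AEMeasurable f μ) {C : ℝ} (hfC : ∀ᵐ x ∂μ, |f x| ≤ C)
    (haf : ∀ x ∈ A, a ≤ |f x|) : a ^ m * μ.real A ≤ ∫ x in A, |f x| ^ m ∂μ := by
  have hint : IntegrableOn (fun x => |f x| ^ m) A μ := by
    refine Measure.integrableOn_of_bounded (M := C ^ m) hAμ
      (by fun_prop : AEMeasurable (fun x => |f x| ^ m) μ).aestronglyMeasurable ?_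
    filter_upwards [ae_restrict_of_ae hfC] with x hx
    rw [Real.norm_of_nonneg (by positivity)]
    gcongr
  calc a ^ m * μ.real A = ∫ _ in A, a ^ m ∂μ := by rw [setIntegral_const, smul_eq_mul, mul_comm]
    _ ≤ ∫ x in A, |f x| ^ m ∂μ := setIntegral_mono_on₀ (integrableOn_const hAμ) hint hA
        fun x hx => Real.rpow_le_rpow ha (haf x hx) hm

lemma superlevelVolume_le_add {a b θ r : ℝ} (hm : 0 ≤ m) (ha : -1 < a) (hb : θ ≤ b)
    (hu : AEMeasurable u volume) (hu1 : ∀ᵐ x, |u x| ≤ 1) :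
    superlevelVolume u a r ≤
      ((1 + a) ^ m)⁻¹ * (∫ x in Metric.ball 0 r ∩ {x | a < u x ∧ u x ≤ b}, |1 + u x| ^ m) +
        superlevelVolume u θ r := by
  have hnull : NullMeasurableSet (Metric.ball 0 r ∩ {x | a < u x ∧ u x ≤ b}) :=
    measurableSet_ball.nullMeasurableSet.inter
      ((nullMeasurableSet_lt aemeasurable_const hu).inter
        (nullMeasurableSet_le hu aemeasurable_const))
  have hlayer : volume.real (Metric.ball 0 r ∩ {x | a < u x ∧ u x ≤ b}) ≤
      ((1 + a) ^ m)⁻¹ *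
        ∫ x in Metric.ball 0 r ∩ {x | a < u x ∧ u x ≤ b}, |1 + u x| ^ m := by
    rw [le_inv_mul_iff₀ (Real.rpow_pos_of_pos (by linarith) _)]
    refine rpow_mul_measureReal_le_setIntegral (f := fun x => 1 + u x) (C := 2) hm (by linarith)
      hnull (volume_ball_inter_ne_top _ _) (hu.const_add 1) ?_
      fun x hx => (by linarith [hx.2.1] : 1 + a ≤ 1 + u x).trans (le_abs_self _)
    filter_upwards [hu1] with x hx
    exact (abs_add_le _ _).trans (by rw [abs_one]; linarith)
  calc superlevelVolume u a r
      ≤ volume.real (Metric.ball 0 r ∩ {x | a < u x ∧ u x ≤ b} ∪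
          Metric.ball 0 r ∩ {x | θ < u x}) := by
        refine measureReal_mono (fun x hx => ?_)
          (measure_union_ne_top (volume_ball_inter_ne_top _ _) (volume_ball_inter_ne_top _ _))
        rcases lt_or_ge θ (u x) with hlt | hle
        · exact Or.inr ⟨hx.1, hlt⟩
        · exact Or.inl ⟨hx.1, hx.2, hle.trans hb⟩
    _ ≤ _ := (measureReal_union_le _ _).trans (by unfold superlevelVolume; gcongr)

lemma exists_and_of_imp {β : Sort*} {A P : β → Prop} {h : Prop} (hA : ∃ x, A x)
    (hP : h → ∃ x, A x ∧ P x) : ∃ x, A x ∧ (h → P x) := by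
  by_cases hh : h
  · obtain ⟨x, hx, hPx⟩ := hP hh
    exact ⟨x, hx, fun _ => hPx⟩
  · obtain ⟨x, hx⟩ := hA
    exact ⟨x, hx, fun hh' => absurd hh' hh⟩

end Density

end
end DensityEstimates

open DensityEstimates in
/-- The order of the quantifiers, and the arguments of the functions `δ`, `Rstar`, `ct`, record what
each constant depends on: `c` on `m, θ_*`; `δ` on `s₀, n, p, m, c₁, θ_*, c₀, α, M`; `Rstar` on
`s₀, n, p, m, c₁, θ_*, r₀`; `ct` on `s₀, n, p, m, Λ, c₁, θ_*, r₀, c₀, α, M`, where `M` is any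
bound for `[u]_{B,α}`. -/
theorem mainTheorem2 (m θlow : ℝ) (hθlow : -1 < θlow) :
    ∃ c : ℝ, 0 < c ∧
    ∀ (n : ℕ) (p s₀ c₁ : ℝ), 1 ≤ n → 1 < p → p ≤ m → 1 / p < s₀ → s₀ < 1 → 0 < c₁ →
    ∃ (δ : (c₀ α : ℝ) → (M : NNReal) → ℝ) (Rstar : (r₀ : ℝ) → ℝ)
      (ct : (Lam r₀ c₀ α : ℝ) → (M : NNReal) → ℝ),
      (∀ c₀ α M, 0 < δ c₀ α M) ∧
      (∀ r₀, r₀ ≤ Rstar r₀) ∧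
      (∀ Lam r₀ c₀ α M, 0 < ct Lam r₀ c₀ α M ∧ ct Lam r₀ c₀ α M < 1) ∧
      ∀ (s : ℝ), s₀ ≤ s → s < 1 →
      ∀ (W : ℝ → ℝ) (lam Lam θ q : ℝ), IsPotential W m lam Lam θ q c₁ →
      ∀ (θ₁ θ₂ : ℝ), θ₁ ∈ Set.Ioc (-1) θ → θ₂ ∈ Set.Ioc (-1) θ →
        θlow = min θ₁ (min θ₂ (-1 + q)) →
      ∀ (Ω : Set (E n)), IsOpen Ω →
      ∀ (α : ℝ) (M : NNReal), 0 < α → α < 1 →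
      ∀ (u : E n → ℝ), MemCB α Ω u → MemX s p Ω u → ballHolderSeminorm α u Ω ≤ M →
      ∀ (c₀ r₀ : ℝ), 0 < c₀ → 0 < r₀ → Metric.ball 0 r₀ ⊆ Ω →
        c₀ < volume.real (Metric.ball 0 r₀ ∩ {x | θ₁ < u x}) →
      ∀ (ε : ℝ), 0 ≤ ε → ε < δ c₀ α M → IsEpsMinimizer W s p ε Ω u →
      ∀ (r : ℝ), Rstar r₀ ≤ r → Metric.ball 0 (4 * r) ⊆ Ω →
        ct Lam r₀ c₀ α M * r ^ n <
          c * (∫ x in Metric.ball 0 r ∩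
                {x | θlow < u x ∧ u x ≤ max θ₁ (max θ₂ (-1 + q))}, |1 + u x| ^ m)
            + volume.real (Metric.ball 0 r ∩ {x | θ₂ < u x}) := by
  refine ⟨((1 + θlow) ^ m)⁻¹, inv_pos.2 (Real.rpow_pos_of_pos (by linarith) _), ?_⟩
  intro n p s₀ c₁ hn hp hpm hs₀ _ hc₁
  have hs₀p : 1 < s₀ * p := (div_lt_iff₀ (by linarith)).1 hs₀
  choose δ hδ hct using fun (c₀ α : ℝ) (M : NNReal) =>
    exists_and_of_imp (h := 0 < c₀ ∧ 0 < α) ⟨1, one_pos⟩ fun h =>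
      exists_density_estimate hn hp (hp.trans_le hpm) hs₀p hc₁ hθlow h.1 h.2 M
  choose ct hct H using fun (Lam r₀ c₀ α : ℝ) (M : NNReal) =>
    exists_and_of_imp (h := (0 < c₀ ∧ 0 < α) ∧ 0 ≤ Lam ∧ 0 < r₀)
      ⟨1 / 2, one_half_pos, one_half_lt_one⟩ fun h => hct c₀ α M h.1 h.2.1 h.2.2
  refine ⟨δ, id, ct, hδ, fun _ => le_rfl, hct, ?_⟩
  intro s hs hs1 W lam Lam θ q hW θ₁ θ₂ _ _ hθ Ω hΩ α M hα _ u _ huX huM c₀ r₀ hc₀ hr₀ _ hu₀ ε hε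
    hεδ hmin r hr hrΩ
  obtain ⟨hθ₁, -, hq⟩ : θlow ≤ θ₁ ∧ θlow ≤ θ₂ ∧ θlow ≤ -1 + q := by
    simpa only [le_min_iff] using hθ.le
  have hLam : 0 ≤ Lam := zero_le_one.trans hW.one_le_Lam
  have hgrowth : ct Lam r₀ c₀ α M * r ^ n < superlevelVolume u θlow r :=
    H Lam r₀ c₀ α M ⟨⟨hc₀, hα⟩, hLam, hr₀⟩ hs hs1 hW hq hΩ huM
      (hu₀.le.trans (superlevelVolume_anti u r₀ hθ₁)) hε hεδ hmin hr hrΩ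
  exact hgrowth.trans_le (superlevelVolume_le_add (by linarith) hθlow
    ((le_max_left _ _).trans (le_max_right _ _)) huX.aemeasurable huX.bound)
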